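/- Let $n\ge 1$. For $1\le q\le p<\infty$, a measurable function $f:\mathbb R^n\to\mathbb C$ and $r>0$ put \[ m(f,p,q;r):=\sup_{x\in\mathbb R^n}|B(x,r)|^{\frac1p}\Big(\frac1{|B(x,r)|}\int_{B(x,r)}|f(y)|^q\,dy\Big)^{\frac1q},\qquad \|f\|_{\mathcal M^p_q}:=\sup_{r>0}m(f,p,q;r). \] The Morrey space $\mathcal M^p_q=\mathcal M^p_q(\mathbb R^n)$ is the set of all $f\in L^q_{\rm loc}(\mathbb R^n)$ (modulo equality almost everywhere) with $\|f\|_{\mathcal M^p_q}<\infty$. Its vanishing subspaces, equipped with the same norm, are \[ V_0\mathcal M^p_q:=\{f\in\mathcal M^p_q:\lim_{r\to0}m(f,p,q;r)=0\},\qquad V_\infty\mathcal M^p_q:=\{f\in\mathcal M^p_q:\lim_{r\to\infty}m(f,p,q;r)=0\}, \] \[ V^{(*)}\mathcal M^p_q:=\Big\{f\in\mathcal M^p_q:\lim_{N\to\infty}\sup_{x\in\mathbb R^n}\int_{B(x,1)}|f(y)|^q\chi_{\mathbb R^n\setminus B(0,N)}(y)\,dy=0\Big\}. \] For a compatible couple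 of Banach spaces $(X_0,X_1)$ and $\theta\in(0,1)$, the first complex interpolation space is $[X_0,X_1]_\theta:=\{F(\theta):F\in\mathcal F(X_0,X_1)\}$. Here $\mathcal F(X_0,X_1)$ is the set of bounded continuous functions $F:\{z\in\mathbb C:0\le\operatorname{Re}z\le1\}\to X_0+X_1$ that are holomorphic in $\{0<\operatorname{Re}z<1\}$ and such that, for $k=0,1$, the function $t\in\mathbb R\mapsto F(k+it)\in X_k$ is well defined, bounded and continuous. The sum $X_0+X_1$ has the norm $\|x\|=\inf\{\|a\|_{X_0}+\|b\|_{X_1}:x=a+b\}$. **Theorem.** Let $\theta\in(0,1)$, $1\le q_0\le p_0<\infty$, $1\le q_1\le p_1<\infty$, $\frac{p_0}{q_0}=\frac{p_1}{q_1}$ and $q_0\ne q_1$. Define $p$ and $q$ by \[ \frac1p=\frac{1-\theta}{p_0}+\frac{\theta}{p_1},\qquad \frac1q=\frac{1-\theta}{q_0}+\frac{\theta}{q_1}. \] Then the following equalities of sets of functions hold: \[ [V_0\mathcal M^{p_0}_{q_0},V_0\mathcal M^{p_1}_{q_1}]_\theta=[\mathcal M^{p_0}_{q_0},\mathcal M^{p_1}_{q_1}]_\theta=\Big\{f\in\mathcal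 M^p_q:\lim_{N\to\infty}\big\|f-\chi_{\{\frac1N\le|f|\le N\}}f\big\|_{\mathcal M^p_q}=0\Big\}, \] \[ [V_\infty\mathcal M^{p_0}_{q_0},V_\infty\mathcal M^{p_1}_{q_1}]_\theta=V_\infty\mathcal M^p_q\cap[\mathcal M^{p_0}_{q_0},\mathcal M^{p_1}_{q_1}]_\theta=\Big\{f\in V_\infty\mathcal M^p_q:\lim_{N\to\infty}\big\|f-\chi_{\{\frac1N\le|f|\le N\}}f\big\|_{\mathcal M^p_q}=0\Big\}, \] \[ [V^{(*)}\mathcal M^{p_0}_{q_0},V^{(*)}\mathcal M^{p_1}_{q_1}]_\theta=V^{(*)}\mathcal M^p_q\cap[\mathcal M^{p_0}_{q_0},\mathcal M^{p_1}_{q_1}]_\theta=\Big\{f\in V^{(*)}\mathcal M^p_q:\lim_{N\to\infty}\big\|f-\chi_{\{\frac1N\le|f|\le N\}}f\big\|_{\mathcal M^p_q}=0\Big\}. \] -/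

import Mathlib

open MeasureTheory Filter Topology Set
open scoped ENNReal

/-! ### Morrey spaces and vanishing Morrey spaces on `ℝⁿ` -/

/-- Classes modulo almost everywhere equality of (a.e. strongly) measurable functions `ℝⁿ → ℂ`;
all function spaces below are sets of such classes. -/
abbrev MeasFun (n : ℕ) : Type := EuclideanSpace ℝ (Fin n) →ₘ[volume] ℂ

/-- `m(f,p,q;r) = sup_x |B(x,r)|^(1/p) (|B(x,r)|⁻¹ ∫_{B(x,r)} |f|^q)^(1/q)`, as an extended
nonnegative number. -/
noncomputable def morreyM (n : ℕ) (p q : ℝ) (f : EuclideanSpace ℝ (Fin n) → ℂ) (r : ℝ) : ℝ≥0∞ :=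
  ⨆ x : EuclideanSpace ℝ (Fin n), volume (Metric.ball x r) ^ (1 / p) *
    ((volume (Metric.ball x r))⁻¹ * ∫⁻ y in Metric.ball x r, ‖f y‖ₑ ^ q) ^ (1 / q)

/-- The Morrey norm `sup_{r > 0} m(f,p,q;r)`, as an extended nonnegative number. -/
noncomputable def morreyNorm (n : ℕ) (p q : ℝ) (f : EuclideanSpace ℝ (Fin n) → ℂ) : ℝ≥0∞ :=
  ⨆ (r : ℝ) (_ : 0 < r), morreyM n p q f r

/-- The Morrey space `M^p_q(ℝⁿ)`. Finiteness of the norm makes `|f|^q` integrable on every ball,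
so the functions are automatically in `L^q_loc`. -/
def morreySet (n : ℕ) (p q : ℝ) : Set (MeasFun n) :=
  {f | morreyNorm n p q f < ∞}

/-- `V₀M^p_q`: the Morrey functions with `m(f,p,q;r) → 0` as `r → 0`. -/
def vanishingZeroSet (n : ℕ) (p q : ℝ) : Set (MeasFun n) :=
  {f | f ∈ morreySet n p q ∧ Tendsto (fun r : ℝ => morreyM n p q f r) (𝓝[>] 0) (𝓝 0)}

/-- `V_∞M^p_q`: the Morrey functions with `m(f,p,q;r) → 0` as `r → ∞`. -/
def vanishingInftySet (n : ℕ) (p q : ℝ) : Set (MeasFun n) :=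
  {f | f ∈ morreySet n p q ∧ Tendsto (fun r : ℝ => morreyM n p q f r) atTop (𝓝 0)}

/-- `sup_x ∫_{B(x,1)} |f|^q χ_{ℝⁿ \ B(0,N)}`. -/
noncomputable def outerMass (n : ℕ) (q : ℝ) (f : EuclideanSpace ℝ (Fin n) → ℂ) (N : ℕ) : ℝ≥0∞ :=
  ⨆ x : EuclideanSpace ℝ (Fin n), ∫⁻ y in Metric.ball x 1,
    (Metric.ball (0 : EuclideanSpace ℝ (Fin n)) N)ᶜ.indicator (fun y => ‖f y‖ₑ ^ q) y

/-- `V^{(*)}M^p_q`: the Morrey functions with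
`sup_x ∫_{B(x,1)} |f|^q χ_{ℝⁿ \ B(0,N)} → 0` as `N → ∞`. -/
def vanishingStarSet (n : ℕ) (p q : ℝ) : Set (MeasFun n) :=
  {f | f ∈ morreySet n p q ∧ Tendsto (fun N : ℕ => outerMass n q f N) atTop (𝓝 0)}

/-- The function `f - χ_{1/N ≤ |f| ≤ N} f`. -/
noncomputable def truncRemainder (n : ℕ) (f : EuclideanSpace ℝ (Fin n) → ℂ) (N : ℕ) :
    EuclideanSpace ℝ (Fin n) → ℂ :=
  fun y => f y - {y | 1 / (N : ℝ) ≤ ‖f y‖ ∧ ‖f y‖ ≤ (N : ℝ)}.indicator f y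

/-- `‖f - χ_{1/N ≤ |f| ≤ N} f‖_{M^p_q} → 0` as `N → ∞`. -/
def TruncationsConverge (n : ℕ) (p q : ℝ) (f : EuclideanSpace ℝ (Fin n) → ℂ) : Prop :=
  Tendsto (fun N : ℕ => morreyNorm n p q (truncRemainder n f N)) atTop (𝓝 0)

/-! ### Elementary facts needed for the linear and normed structure -/

section Facts

variable {n : ℕ} {p q : ℝ}

theorem morreyM_congr {f g : EuclideanSpace ℝ (Fin n) → ℂ} (h : f =ᵐ[volume] g) (r : ℝ) :
    morreyM n p q f r = morreyM n p q g r := by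
  unfold morreyM
  refine iSup_congr fun x => ?_
  have : ∫⁻ y in Metric.ball x r, ‖f y‖ₑ ^ q = ∫⁻ y in Metric.ball x r, ‖g y‖ₑ ^ q := by
    refine lintegral_congr_ae (ae_restrict_of_ae ?_)
    filter_upwards [h] with y hy
    rw [hy]
  rw [this]

theorem morreyNorm_congr {f g : EuclideanSpace ℝ (Fin n) → ℂ} (h : f =ᵐ[volume] g) :
    morreyNorm n p q f = morreyNorm n p q g := by
  unfold morreyNorm
  simp only [morreyM_congr h]

theorem outerMass_congr {f g : EuclideanSpace ℝ (Fin n) → ℂ} (h : f =ᵐ[volume] g) (N : ℕ) :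
    outerMass n q f N = outerMass n q g N := by
  unfold outerMass
  refine iSup_congr fun x => lintegral_congr_ae (ae_restrict_of_ae ?_)
  filter_upwards [h] with y hy
  simp only [indicator, hy]

theorem morreyM_zero (hq : 1 ≤ q) (r : ℝ) :
    morreyM n p q (fun _ => 0) r = 0 := by
  have h0 : 0 < q := by linarith
  simp [morreyM, h0, ENNReal.zero_rpow_of_pos, inv_pos.2 h0]

theorem morreyM_add_le (hq : 1 ≤ q) {f g : EuclideanSpace ℝ (Fin n) → ℂ}
    (hf : AEStronglyMeasurable f volume) (hg : AEStronglyMeasurable g volume) (r : ℝ) :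
    morreyM n p q (fun y => f y + g y) r ≤ morreyM n p q f r + morreyM n p q g r := by
  have h0 : 0 < q := by linarith
  have hq' : 0 ≤ 1 / q := by positivity
  unfold morreyM
  refine iSup_le fun x => ?_
  set B := Metric.ball x r
  have key : (∫⁻ y in B, ‖f y + g y‖ₑ ^ q) ^ (1 / q) ≤
      (∫⁻ y in B, ‖f y‖ₑ ^ q) ^ (1 / q) + (∫⁻ y in B, ‖g y‖ₑ ^ q) ^ (1 / q) := by
    refine le_trans ?_ (ENNReal.lintegral_Lp_add_le hf.restrict.enorm hg.restrict.enorm hq)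
    gcongr with y
    exact enorm_add_le _ _
  calc volume B ^ (1 / p) * ((volume B)⁻¹ * ∫⁻ y in B, ‖f y + g y‖ₑ ^ q) ^ (1 / q)
      = volume B ^ (1 / p) * (((volume B)⁻¹) ^ (1 / q) *
          (∫⁻ y in B, ‖f y + g y‖ₑ ^ q) ^ (1 / q)) := by
        rw [ENNReal.mul_rpow_of_nonneg _ _ hq']
    _ ≤ volume B ^ (1 / p) * (((volume B)⁻¹) ^ (1 / q) *
          ((∫⁻ y in B, ‖f y‖ₑ ^ q) ^ (1 / q) + (∫⁻ y in B, ‖g y‖ₑ ^ q) ^ (1 / q))) := by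
        gcongr
    _ = volume B ^ (1 / p) * ((volume B)⁻¹ * ∫⁻ y in B, ‖f y‖ₑ ^ q) ^ (1 / q) +
        volume B ^ (1 / p) * ((volume B)⁻¹ * ∫⁻ y in B, ‖g y‖ₑ ^ q) ^ (1 / q) := by
        rw [ENNReal.mul_rpow_of_nonneg _ _ hq', ENNReal.mul_rpow_of_nonneg _ _ hq', mul_add,
          mul_add]
    _ ≤ _ := add_le_add
        (le_iSup (fun x => volume (Metric.ball x r) ^ (1 / p) *
          ((volume (Metric.ball x r))⁻¹ * ∫⁻ y in Metric.ball x r, ‖f y‖ₑ ^ q) ^ (1 / q)) x)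
        (le_iSup (fun x => volume (Metric.ball x r) ^ (1 / p) *
          ((volume (Metric.ball x r))⁻¹ * ∫⁻ y in Metric.ball x r, ‖g y‖ₑ ^ q) ^ (1 / q)) x)

theorem morreyM_smul (hq : 1 ≤ q) (c : ℂ) (f : EuclideanSpace ℝ (Fin n) → ℂ) (r : ℝ) :
    morreyM n p q (fun y => c * f y) r = ‖c‖ₑ * morreyM n p q f r := by
  have h0 : 0 < q := by linarith
  have hq' : 0 ≤ 1 / q := by positivity
  unfold morreyM
  rw [ENNReal.mul_iSup]
  refine iSup_congr fun x => ?_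
  have : ∫⁻ y in Metric.ball x r, ‖c * f y‖ₑ ^ q =
      ‖c‖ₑ ^ q * ∫⁻ y in Metric.ball x r, ‖f y‖ₑ ^ q := by
    rw [← lintegral_const_mul' _ _ (by finiteness)]
    simp only [enorm_mul, ENNReal.mul_rpow_of_nonneg _ _ h0.le]
  rw [this, ← mul_assoc, mul_comm _ (‖c‖ₑ ^ q), mul_assoc (‖c‖ₑ ^ q),
    ENNReal.mul_rpow_of_nonneg _ _ hq', ← ENNReal.rpow_mul, mul_one_div_cancel h0.ne',
    ENNReal.rpow_one]
  ring

theorem morreyNorm_zero (hq : 1 ≤ q) : morreyNorm n p q (fun _ => 0) = 0 := by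
  simp [morreyNorm, morreyM_zero hq]

theorem morreyNorm_add_le (hq : 1 ≤ q) {f g : EuclideanSpace ℝ (Fin n) → ℂ}
    (hf : AEStronglyMeasurable f volume) (hg : AEStronglyMeasurable g volume) :
    morreyNorm n p q (fun y => f y + g y) ≤ morreyNorm n p q f + morreyNorm n p q g := by
  refine iSup₂_le fun r hr => (morreyM_add_le hq hf hg r).trans (add_le_add ?_ ?_)
  · exact le_iSup₂ (f := fun (r : ℝ) (_ : 0 < r) => morreyM n p q f r) r hr
  · exact le_iSup₂ (f := fun (r : ℝ) (_ : 0 < r) => morreyM n p q g r) r hr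

theorem morreyNorm_smul (hq : 1 ≤ q) (c : ℂ) (f : EuclideanSpace ℝ (Fin n) → ℂ) :
    morreyNorm n p q (fun y => c * f y) = ‖c‖ₑ * morreyNorm n p q f := by
  simp only [morreyNorm, morreyM_smul hq, ENNReal.mul_iSup]

theorem ae_zero_of_morreyNorm_eq_zero (hq : 1 ≤ q) {f : EuclideanSpace ℝ (Fin n) → ℂ}
    (hf : AEStronglyMeasurable f volume) (h : morreyNorm n p q f = 0) : f =ᵐ[volume] 0 := by
  have h0 : 0 < q := by linarith
  have hball : ∀ k : ℕ, ∀ᵐ y ∂volume.restrict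
      (Metric.ball (0 : EuclideanSpace ℝ (Fin n)) ((k : ℝ) + 1)), f y = 0 := by
    intro k
    have hk : (0 : ℝ) < (k : ℝ) + 1 := by positivity
    simp only [morreyNorm, morreyM, ENNReal.iSup_eq_zero] at h
    have h1 := h _ hk (0 : EuclideanSpace ℝ (Fin n))
    set B := Metric.ball (0 : EuclideanSpace ℝ (Fin n)) ((k : ℝ) + 1)
    have hpos : volume B ≠ 0 := (Metric.measure_ball_pos volume _ hk).ne'
    have hfin : volume B ≠ ∞ := measure_ball_lt_top.ne
    have h2 : ∫⁻ y in B, ‖f y‖ₑ ^ q = 0 := by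
      rcases mul_eq_zero.1 h1 with h1 | h1
      · exact absurd h1 (ENNReal.rpow_pos (pos_iff_ne_zero.2 hpos) hfin).ne'
      · rw [ENNReal.rpow_eq_zero_iff_of_pos (by positivity)] at h1
        rcases mul_eq_zero.1 h1 with h1 | h1
        · exact absurd h1 (ENNReal.inv_ne_zero.2 hfin)
        · exact h1
    rw [lintegral_eq_zero_iff' (hf.restrict.enorm.pow_const q)] at h2
    filter_upwards [h2] with y hy
    simpa [ENNReal.rpow_eq_zero_iff_of_pos h0] using hy
  have hU : (⋃ k : ℕ, Metric.ball (0 : EuclideanSpace ℝ (Fin n)) ((k : ℝ) + 1)) = univ := by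
    refine eq_univ_of_forall fun y => mem_iUnion.2 ?_
    obtain ⟨k, hk⟩ := exists_nat_gt (dist y 0)
    exact ⟨k, by simp only [Metric.mem_ball]; linarith⟩
  have := (ae_restrict_iUnion_iff _ _).2 hball
  rw [hU, Measure.restrict_univ] at this
  exact this

theorem outerMass_zero (hq : 1 ≤ q) (N : ℕ) : outerMass n q (fun _ => 0) N = 0 := by
  have h0 : 0 < q := by linarith
  simp [outerMass, h0, ENNReal.zero_rpow_of_pos]

theorem outerMass_add_le (hq : 1 ≤ q) {f g : EuclideanSpace ℝ (Fin n) → ℂ}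
    (hf : AEStronglyMeasurable f volume) (N : ℕ) :
    outerMass n q (fun y => f y + g y) N ≤
      (2 : ℝ≥0∞) ^ (q - 1) * (outerMass n q f N + outerMass n q g N) := by
  have hC : (2 : ℝ≥0∞) ^ (q - 1) ≠ ∞ := by
    exact ENNReal.rpow_ne_top_of_nonneg (by linarith) (by simp)
  refine iSup_le fun x => ?_
  have hm : MeasurableSet (Metric.ball (0 : EuclideanSpace ℝ (Fin n)) (N : ℝ))ᶜ :=
    Metric.isOpen_ball.measurableSet.compl
  calc _ ≤ ∫⁻ y in Metric.ball x 1, (2 : ℝ≥0∞) ^ (q - 1) *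
          ((Metric.ball (0 : EuclideanSpace ℝ (Fin n)) N)ᶜ.indicator (fun y => ‖f y‖ₑ ^ q) y +
          (Metric.ball (0 : EuclideanSpace ℝ (Fin n)) N)ᶜ.indicator (fun y => ‖g y‖ₑ ^ q) y) := by
        refine lintegral_mono fun y => ?_
        by_cases hy : y ∈ (Metric.ball (0 : EuclideanSpace ℝ (Fin n)) (N : ℝ))ᶜ
        · simp only [indicator_of_mem hy]
          refine le_trans ?_ (ENNReal.rpow_add_le_mul_rpow_add_rpow _ _ hq)
          gcongr
          exact enorm_add_le _ _
        · simp only [indicator_of_notMem hy]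
          simp
    _ = (2 : ℝ≥0∞) ^ (q - 1) * ((∫⁻ y in Metric.ball x 1,
          (Metric.ball (0 : EuclideanSpace ℝ (Fin n)) N)ᶜ.indicator (fun y => ‖f y‖ₑ ^ q) y) +
          ∫⁻ y in Metric.ball x 1,
          (Metric.ball (0 : EuclideanSpace ℝ (Fin n)) N)ᶜ.indicator (fun y => ‖g y‖ₑ ^ q) y) := by
        rw [lintegral_const_mul' _ _ hC, lintegral_add_left']
        exact (hf.restrict.enorm.pow_const q).indicator hm
    _ ≤ _ := by
        gcongr
        · exact le_iSup (fun x => ∫⁻ y in Metric.ball x 1,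
            (Metric.ball (0 : EuclideanSpace ℝ (Fin n)) N)ᶜ.indicator (fun y => ‖f y‖ₑ ^ q) y) x
        · exact le_iSup (fun x => ∫⁻ y in Metric.ball x 1,
            (Metric.ball (0 : EuclideanSpace ℝ (Fin n)) N)ᶜ.indicator (fun y => ‖g y‖ₑ ^ q) y) x

theorem outerMass_smul (hq : 1 ≤ q) (c : ℂ) (f : EuclideanSpace ℝ (Fin n) → ℂ) (N : ℕ) :
    outerMass n q (fun y => c * f y) N = ‖c‖ₑ ^ q * outerMass n q f N := by
  have h0 : 0 < q := by linarith
  unfold outerMass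
  rw [ENNReal.mul_iSup]
  refine iSup_congr fun x => ?_
  rw [← lintegral_const_mul' _ _ (by finiteness)]
  refine lintegral_congr fun y => ?_
  by_cases hy : y ∈ (Metric.ball (0 : EuclideanSpace ℝ (Fin n)) (N : ℝ))ᶜ
  · simp only [indicator_of_mem hy, enorm_mul, ENNReal.mul_rpow_of_nonneg _ _ h0.le]
  · simp only [indicator_of_notMem hy, mul_zero]

theorem measFun_coe_smul (c : ℂ) (f : MeasFun n) :
    ⇑(c • f) =ᵐ[volume] fun y => c * f y := by
  filter_upwards [AEEqFun.coeFn_smul c f] with y hy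
  simp [hy]

theorem measFun_coe_add (f g : MeasFun n) : ⇑(f + g) =ᵐ[volume] fun y => f y + g y :=
  AEEqFun.coeFn_add f g

theorem measFun_coe_zero : ⇑(0 : MeasFun n) =ᵐ[volume] fun _ => 0 :=
  AEEqFun.coeFn_zero

end Facts

/-! ### The spaces as normed spaces -/

/-- The Morrey space as a linear subspace of the measurable functions. -/
def morreySubmodule (n : ℕ) (p q : ℝ) (hq : 1 ≤ q) : Submodule ℂ (MeasFun n) where
  carrier := morreySet n p q
  zero_mem' := by
    change morreyNorm n p q _ < ∞
    rw [morreyNorm_congr measFun_coe_zero, morreyNorm_zero hq]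
    exact ENNReal.zero_lt_top
  add_mem' := by
    intro f g hf hg
    change morreyNorm n p q _ < ∞
    rw [morreyNorm_congr (measFun_coe_add f g)]
    exact (morreyNorm_add_le hq f.aestronglyMeasurable g.aestronglyMeasurable).trans_lt
      (ENNReal.add_lt_top.2 ⟨hf, hg⟩)
  smul_mem' := by
    intro c f hf
    change morreyNorm n p q _ < ∞
    rw [morreyNorm_congr (measFun_coe_smul c f), morreyNorm_smul hq]
    exact ENNReal.mul_lt_top enorm_lt_top hf

/-- The Morrey space `M^p_q(ℝⁿ)` as a type, which carries the Morrey norm. -/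
def MorreySpace (n : ℕ) (p q : ℝ) (hq : 1 ≤ q) : Type := ↥(morreySubmodule n p q hq)

noncomputable section

instance (n : ℕ) (p q : ℝ) (hq : 1 ≤ q) : AddCommGroup (MorreySpace n p q hq) :=
  inferInstanceAs (AddCommGroup ↥(morreySubmodule n p q hq))

instance (n : ℕ) (p q : ℝ) (hq : 1 ≤ q) : Module ℂ (MorreySpace n p q hq) :=
  inferInstanceAs (Module ℂ ↥(morreySubmodule n p q hq))

/-- The inclusion of the Morrey space in the measurable functions. -/
def MorreySpace.incl (n : ℕ) (p q : ℝ) (hq : 1 ≤ q) : MorreySpace n p q hq →ₗ[ℂ] MeasFun n :=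
  (morreySubmodule n p q hq).subtype

theorem MorreySpace.incl_mem {n : ℕ} {p q : ℝ} {hq : 1 ≤ q} (f : MorreySpace n p q hq) :
    MorreySpace.incl n p q hq f ∈ morreySet n p q :=
  f.2

instance (n : ℕ) (p q : ℝ) (hq : 1 ≤ q) : Norm (MorreySpace n p q hq) :=
  ⟨fun f => (morreyNorm n p q (MorreySpace.incl n p q hq f)).toReal⟩

theorem MorreySpace.norm_def {n : ℕ} {p q : ℝ} {hq : 1 ≤ q} (f : MorreySpace n p q hq) :
    ‖f‖ = (morreyNorm n p q (MorreySpace.incl n p q hq f)).toReal :=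
  rfl

theorem MorreySpace.core (n : ℕ) (p q : ℝ) (hq : 1 ≤ q) :
    NormedSpace.Core ℂ (MorreySpace n p q hq) where
  norm_nonneg f := ENNReal.toReal_nonneg
  norm_smul c f := by
    rw [norm_def, norm_def, map_smul, morreyNorm_congr (measFun_coe_smul c _),
      morreyNorm_smul hq, ENNReal.toReal_mul, toReal_enorm]
  norm_triangle f g := by
    rw [norm_def, norm_def, norm_def, map_add, morreyNorm_congr (measFun_coe_add _ _),
      ← ENNReal.toReal_add f.incl_mem.ne g.incl_mem.ne]
    exact ENNReal.toReal_mono (ENNReal.add_lt_top.2 ⟨f.incl_mem, g.incl_mem⟩).ne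
      (morreyNorm_add_le hq (AEEqFun.aestronglyMeasurable _) (AEEqFun.aestronglyMeasurable _))
  norm_eq_zero_iff f := by
    rw [norm_def, ENNReal.toReal_eq_zero_iff, or_iff_left f.incl_mem.ne]
    constructor
    · intro h
      have h1 := ae_zero_of_morreyNorm_eq_zero hq (AEEqFun.aestronglyMeasurable _) h
      exact Subtype.ext (AEEqFun.ext (h1.trans AEEqFun.coeFn_zero.symm))
    · rintro rfl
      rw [map_zero, morreyNorm_congr measFun_coe_zero, morreyNorm_zero hq]

instance (n : ℕ) (p q : ℝ) (hq : 1 ≤ q) : NormedAddCommGroup (MorreySpace n p q hq) :=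
  NormedAddCommGroup.ofCore (MorreySpace.core n p q hq)

instance (n : ℕ) (p q : ℝ) (hq : 1 ≤ q) : NormedSpace ℂ (MorreySpace n p q hq) :=
  NormedSpace.ofCore (MorreySpace.core n p q hq)

/-- `V₀M^p_q` as a subspace of `M^p_q`, with the Morrey norm. -/
def VanishingZero (n : ℕ) (p q : ℝ) (hq : 1 ≤ q) : Submodule ℂ (MorreySpace n p q hq) where
  carrier := {f | MorreySpace.incl n p q hq f ∈ vanishingZeroSet n p q}
  zero_mem' := by
    refine ⟨MorreySpace.incl_mem _, ?_⟩
    simp only [map_zero, morreyM_congr measFun_coe_zero, morreyM_zero hq]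
    exact tendsto_const_nhds
  add_mem' := by
    intro f g hf hg
    refine ⟨MorreySpace.incl_mem _, ?_⟩
    simp only [map_add, morreyM_congr (measFun_coe_add _ _)]
    refine tendsto_of_tendsto_of_tendsto_of_le_of_le tendsto_const_nhds
      (by simpa using hf.2.add hg.2) (fun _ => zero_le) (fun r => morreyM_add_le hq
        (AEEqFun.aestronglyMeasurable _) (AEEqFun.aestronglyMeasurable _) r)
  smul_mem' := by
    intro c f hf
    refine ⟨MorreySpace.incl_mem _, ?_⟩
    simp only [map_smul, morreyM_congr (measFun_coe_smul _ _), morreyM_smul hq]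
    simpa using ENNReal.Tendsto.const_mul hf.2 (Or.inr (by finiteness))

/-- `V_∞M^p_q` as a subspace of `M^p_q`, with the Morrey norm. -/
def VanishingInfty (n : ℕ) (p q : ℝ) (hq : 1 ≤ q) : Submodule ℂ (MorreySpace n p q hq) where
  carrier := {f | MorreySpace.incl n p q hq f ∈ vanishingInftySet n p q}
  zero_mem' := by
    refine ⟨MorreySpace.incl_mem _, ?_⟩
    simp only [map_zero, morreyM_congr measFun_coe_zero, morreyM_zero hq]
    exact tendsto_const_nhds
  add_mem' := by
    intro f g hf hg
    refine ⟨MorreySpace.incl_mem _, ?_⟩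
    simp only [map_add, morreyM_congr (measFun_coe_add _ _)]
    refine tendsto_of_tendsto_of_tendsto_of_le_of_le tendsto_const_nhds
      (by simpa using hf.2.add hg.2) (fun _ => zero_le) (fun r => morreyM_add_le hq
        (AEEqFun.aestronglyMeasurable _) (AEEqFun.aestronglyMeasurable _) r)
  smul_mem' := by
    intro c f hf
    refine ⟨MorreySpace.incl_mem _, ?_⟩
    simp only [map_smul, morreyM_congr (measFun_coe_smul _ _), morreyM_smul hq]
    simpa using ENNReal.Tendsto.const_mul hf.2 (Or.inr (by finiteness))

/-- `V^{(*)}M^p_q` as a subspace of `M^p_q`, with the Morrey norm. -/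
def VanishingStar (n : ℕ) (p q : ℝ) (hq : 1 ≤ q) : Submodule ℂ (MorreySpace n p q hq) where
  carrier := {f | MorreySpace.incl n p q hq f ∈ vanishingStarSet n p q}
  zero_mem' := by
    refine ⟨MorreySpace.incl_mem _, ?_⟩
    simp only [map_zero, outerMass_congr measFun_coe_zero, outerMass_zero hq]
    exact tendsto_const_nhds
  add_mem' := by
    intro f g hf hg
    refine ⟨MorreySpace.incl_mem _, ?_⟩
    simp only [map_add, outerMass_congr (measFun_coe_add _ _)]
    have hC : (2 : ℝ≥0∞) ^ (q - 1) ≠ ∞ :=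
      ENNReal.rpow_ne_top_of_nonneg (by linarith) (by simp)
    refine tendsto_of_tendsto_of_tendsto_of_le_of_le tendsto_const_nhds
      (by simpa using ENNReal.Tendsto.const_mul (hf.2.add hg.2) (Or.inr hC)) (fun _ => zero_le)
      (fun N => outerMass_add_le hq (AEEqFun.aestronglyMeasurable _) N)
  smul_mem' := by
    intro c f hf
    refine ⟨MorreySpace.incl_mem _, ?_⟩
    simp only [map_smul, outerMass_congr (measFun_coe_smul _ _), outerMass_smul hq]
    simpa using ENNReal.Tendsto.const_mul hf.2
      (Or.inr (ENNReal.rpow_ne_top_of_nonneg (by linarith : (0 : ℝ) ≤ q) enorm_ne_top))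

/-! ### The first complex interpolation method -/

section Interpolation

variable {X₀ X₁ Z : Type*} [NormedAddCommGroup X₀] [NormedSpace ℂ X₀]
  [NormedAddCommGroup X₁] [NormedSpace ℂ X₁] [AddCommGroup Z] [Module ℂ Z]

/-- The map `(a, b) ↦ ι₀ a + ι₁ b` on `X₀ × X₁` with the norm `‖a‖ + ‖b‖`. -/
def coupleMap (ι₀ : X₀ →ₗ[ℂ] Z) (ι₁ : X₁ →ₗ[ℂ] Z) : WithLp 1 (X₀ × X₁) →ₗ[ℂ] Z :=
  (ι₀.coprod ι₁) ∘ₗ (WithLp.linearEquiv 1 ℂ (X₀ × X₁)).toLinearMap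

/-- The sum `X₀ + X₁` of a couple of normed spaces embedded in `Z` by `ι₀`, `ι₁`: pairs `(a, b)`
up to the equality of `ι₀ a + ι₁ b` in `Z`. Its quotient norm is
`‖x‖ = inf {‖a‖ + ‖b‖ : x = a + b}`. -/
abbrev CoupleSum (ι₀ : X₀ →ₗ[ℂ] Z) (ι₁ : X₁ →ₗ[ℂ] Z) : Type _ :=
  WithLp 1 (X₀ × X₁) ⧸ LinearMap.ker (coupleMap ι₀ ι₁)

/-- The injection of `X₀ + X₁` into `Z`. -/
def CoupleSum.toAmbient (ι₀ : X₀ →ₗ[ℂ] Z) (ι₁ : X₁ →ₗ[ℂ] Z) : CoupleSum ι₀ ι₁ →ₗ[ℂ] Z :=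
  (LinearMap.ker (coupleMap ι₀ ι₁)).liftQ (coupleMap ι₀ ι₁) le_rfl

/-- Membership in the class `𝓕(X₀, X₁)`: `F` is bounded and continuous on the closed strip
`0 ≤ Re z ≤ 1` with values in `X₀ + X₁`, holomorphic in the open strip `0 < Re z < 1`, and
`t ↦ F(k + it)` is a bounded continuous function with values in `X_k`, for `k = 0, 1`.
(Only the values of `F` on the closed strip matter.) -/
structure IsCalderon (ι₀ : X₀ →ₗ[ℂ] Z) (ι₁ : X₁ →ₗ[ℂ] Z) (F : ℂ → CoupleSum ι₀ ι₁) : Prop where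
  bounded : ∃ C : ℝ, ∀ z ∈ Complex.HadamardThreeLines.verticalClosedStrip 0 1, ‖F z‖ ≤ C
  continuousOn : ContinuousOn F (Complex.HadamardThreeLines.verticalClosedStrip 0 1)
  holomorphic : DifferentiableOn ℂ F (Complex.HadamardThreeLines.verticalStrip 0 1)
  left : ∃ g : ℝ → X₀, Continuous g ∧ (∃ C : ℝ, ∀ t, ‖g t‖ ≤ C) ∧
    ∀ t : ℝ, CoupleSum.toAmbient ι₀ ι₁ (F (t * Complex.I)) = ι₀ (g t)
  right : ∃ g : ℝ → X₁, Continuous g ∧ (∃ C : ℝ, ∀ t, ‖g t‖ ≤ C) ∧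
    ∀ t : ℝ, CoupleSum.toAmbient ι₀ ι₁ (F (1 + t * Complex.I)) = ι₁ (g t)

/-- The first complex interpolation space `[X₀, X₁]_θ = {F(θ) : F ∈ 𝓕(X₀, X₁)}`, as a set of
elements of `Z`. -/
def complexInterpolation (ι₀ : X₀ →ₗ[ℂ] Z) (ι₁ : X₁ →ₗ[ℂ] Z) (θ : ℝ) : Set Z :=
  {f | ∃ F : ℂ → CoupleSum ι₀ ι₁, IsCalderon ι₀ ι₁ F ∧ CoupleSum.toAmbient ι₀ ι₁ (F θ) = f}

end Interpolation

/-- `[M^{p₀}_{q₀}, M^{p₁}_{q₁}]_θ`. -/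
def interpMorrey (n : ℕ) (p₀ q₀ p₁ q₁ : ℝ) (h₀ : 1 ≤ q₀) (h₁ : 1 ≤ q₁) (θ : ℝ) :
    Set (MeasFun n) :=
  complexInterpolation (MorreySpace.incl n p₀ q₀ h₀) (MorreySpace.incl n p₁ q₁ h₁) θ

/-- `[W₀, W₁]_θ` for subspaces `W₀ ⊆ M^{p₀}_{q₀}`, `W₁ ⊆ M^{p₁}_{q₁}` with the Morrey norms. -/
def interpSub {n : ℕ} {p₀ q₀ p₁ q₁ : ℝ} {h₀ : 1 ≤ q₀} {h₁ : 1 ≤ q₁}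
    (W₀ : Submodule ℂ (MorreySpace n p₀ q₀ h₀)) (W₁ : Submodule ℂ (MorreySpace n p₁ q₁ h₁))
    (θ : ℝ) : Set (MeasFun n) :=
  complexInterpolation (MorreySpace.incl n p₀ q₀ h₀ ∘ₗ W₀.subtype)
    (MorreySpace.incl n p₁ q₁ h₁ ∘ₗ W₁.subtype) θ

end

/-!
# Complex interpolation of vanishing Morrey spaces

Write `p/q = p₀/q₀ = p₁/q₁`; then `q` lies strictly between `q₀` and `q₁`.

Elements of the interpolation spaces are limits of functions in the intersection. Pairing `F ∈
𝓕(M^{p₀}_{q₀}, M^{p₁}_{q₁})` with simple functions and applying the three lines theorem to the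
resulting scalar functions gives, by duality of the `L^q` norms on balls, the bound `m(F(θ),p,q;r) ≤
(sup_t m(F(it),p₀,q₀;r))^{1-θ} (sup_t m(F(1+it),p₁,q₁;r))^θ` and its analogue for the outer masses.
Hence `F(θ)` lies in `M^p_q`, and inherits the vanishing properties at infinity of the boundary
values. After multiplication by `e^{z²-θ²}` the boundary values tend to `0` at infinity, and
averages of `t ↦ F(θ + it)` against a narrow Gaussian approximate `F(θ)` in the norm of `M^p_q`; by
a shift of contour such an average is an integral over either boundary line, so that it belongs to
`M^{p₀}_{q₀} ∩ M^{p₁}_{q₁}` (`WeakCalderon.exists_mem_inter_morreyNorm_sub_le`). A function `h` in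
the intersection has convergent truncations in `M^p_q`: where `|h| > N`, one has `|h|^q ≤ N^{q-q₁}
|h|^{q₁}` if `q < q₁`, and similarly where `|h|` is small; this property passes to limits
(`truncationsConverge_of_approx`).

Conversely, let the truncations of `f ∈ M^p_q` converge. With `ℓ = (q/q₁ - q/q₀) log |f|` the
functions `F(it) = f e^{(it-θ)ℓ}` and `F(1+it) = f e^{(1+it-θ)ℓ}` have the absolute values
`|f|^{q/q₀}` and `|f|^{q/q₁}`, which belong to `M^{p₀}_{q₀}` and `M^{p₁}_{q₁}` and, when `f` is in
one of the vanishing spaces, to the vanishing subspaces of these. The function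
`F(z) = f e^{(z-θ)ℓ}` is assembled from the semigroups `z ↦ e^{-z|ℓ|}`, whose strong continuity on
the boundary lines is exactly what the convergence of the truncations provides
(`mem_interpSub_of_factorization`). For `V₀` no assumption on `f` is needed, as the truncated
functions are bounded and so have vanishing Morrey means on small balls
(`mem_vanishingZeroSet_of_truncationsConverge`).
-/


/-! ### Local `L^q` norms and elementary properties of the Morrey functionals -/

section Basics

variable {n : ℕ} {p q p₀ q₀ p₁ q₁ θ : ℝ}

/-- The `L^q` norm of `f` over the set `S`, as an extended nonnegative number. -/
noncomputable def lpOn (q : ℝ) (S : Set (EuclideanSpace ℝ (Fin n)))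
    (f : EuclideanSpace ℝ (Fin n) → ℂ) : ℝ≥0∞ :=
  (∫⁻ y in S, ‖f y‖ₑ ^ q) ^ (1 / q)

/-- The weight `|B|^(1/p) (|B|⁻¹)^(1/q)` by which the Morrey functional multiplies the `L^q` norm
over the ball `B = B(x, r)`. -/
noncomputable def ballWeight (p q : ℝ) (x : EuclideanSpace ℝ (Fin n)) (r : ℝ) : ℝ≥0∞ :=
  volume (Metric.ball x r) ^ (1 / p) * ((volume (Metric.ball x r))⁻¹) ^ (1 / q)

theorem morreyM_eq_iSup_lpOn (hq : 0 < q) (f : EuclideanSpace ℝ (Fin n) → ℂ) (r : ℝ) :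
    morreyM n p q f r = ⨆ x, ballWeight p q x r * lpOn q (Metric.ball x r) f := by
  unfold morreyM ballWeight lpOn
  refine iSup_congr fun x => ?_
  rw [ENNReal.mul_rpow_of_nonneg _ _ (by positivity), mul_assoc]

theorem volume_ball_ne_zero (x : EuclideanSpace ℝ (Fin n)) {r : ℝ} (hr : 0 < r) :
    volume (Metric.ball x r) ≠ 0 := (Metric.measure_ball_pos volume _ hr).ne'

theorem volume_ball_ne_top (x : EuclideanSpace ℝ (Fin n)) (r : ℝ) :
    volume (Metric.ball x r) ≠ ∞ := measure_ball_lt_top.ne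

theorem ballWeight_ne_zero (p q : ℝ) (x : EuclideanSpace ℝ (Fin n)) {r : ℝ}
    (hr : 0 < r) : ballWeight p q x r ≠ 0 := by
  have h1 := volume_ball_ne_zero x hr
  have h2 := volume_ball_ne_top x r
  refine mul_ne_zero ?_ ?_
  · exact (ENNReal.rpow_pos (pos_iff_ne_zero.2 h1) h2).ne'
  · exact (ENNReal.rpow_pos (ENNReal.inv_pos.2 h2) (ENNReal.inv_ne_top.2 h1)).ne'

theorem ballWeight_ne_top (hp : 0 < p) (hq : 0 < q) (x : EuclideanSpace ℝ (Fin n)) {r : ℝ}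
    (hr : 0 < r) : ballWeight p q x r ≠ ∞ := by
  have h1 := volume_ball_ne_zero x hr
  have h2 := volume_ball_ne_top x r
  exact ENNReal.mul_ne_top (ENNReal.rpow_ne_top_of_nonneg (by positivity) h2)
    (ENNReal.rpow_ne_top_of_nonneg (by positivity) (ENNReal.inv_ne_top.2 h1))

theorem ballWeight_interpolate (hθ : θ ∈ Ioo (0 : ℝ) 1)
    (hp : 1 / p = (1 - θ) / p₀ + θ / p₁) (hq : 1 / q = (1 - θ) / q₀ + θ / q₁)
    (x : EuclideanSpace ℝ (Fin n)) {r : ℝ} (hr : 0 < r) :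
    ballWeight p q x r = ballWeight p₀ q₀ x r ^ (1 - θ) * ballWeight p₁ q₁ x r ^ θ := by
  have h1 := volume_ball_ne_zero x hr
  have h2 := volume_ball_ne_top x r
  unfold ballWeight
  set V := volume (Metric.ball x r)
  rw [ENNReal.mul_rpow_of_nonneg _ _ (by linarith [hθ.2]),
    ENNReal.mul_rpow_of_nonneg _ _ hθ.1.le, hp, hq,
    ENNReal.rpow_add _ _ h1 h2, ENNReal.rpow_add _ _ (ENNReal.inv_ne_zero.2 h2)
      (ENNReal.inv_ne_top.2 h1)]
  simp only [← ENNReal.rpow_mul]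
  rw [show 1 / p₀ * (1 - θ) = (1 - θ) / p₀ by ring, show 1 / q₀ * (1 - θ) = (1 - θ) / q₀ by ring,
    show 1 / p₁ * θ = θ / p₁ by ring, show 1 / q₁ * θ = θ / q₁ by ring]
  ring

theorem ballWeight_mul_lpOn_le_morreyM (hq : 0 < q) (f : EuclideanSpace ℝ (Fin n) → ℂ) (r : ℝ)
    (x : EuclideanSpace ℝ (Fin n)) :
    ballWeight p q x r * lpOn q (Metric.ball x r) f ≤ morreyM n p q f r := by
  rw [morreyM_eq_iSup_lpOn hq]
  exact le_iSup (fun x => ballWeight p q x r * lpOn q (Metric.ball x r) f) x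

theorem morreyM_le_morreyNorm (f : EuclideanSpace ℝ (Fin n) → ℂ) {r : ℝ} (hr : 0 < r) :
    morreyM n p q f r ≤ morreyNorm n p q f :=
  le_iSup₂ (f := fun (r : ℝ) (_ : 0 < r) => morreyM n p q f r) r hr

theorem lpOn_ball_le (hp : 0 < p) (hq : 0 < q) (f : EuclideanSpace ℝ (Fin n) → ℂ)
    (x : EuclideanSpace ℝ (Fin n)) {r : ℝ} (hr : 0 < r) :
    lpOn q (Metric.ball x r) f ≤ (ballWeight p q x r)⁻¹ * morreyM n p q f r := by
  have h := ballWeight_mul_lpOn_le_morreyM (p := p) hq f r x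
  rwa [ENNReal.mul_le_iff_le_inv (ballWeight_ne_zero p q x hr)
    (ballWeight_ne_top hp hq x hr)] at h

theorem lpOn_mono_set (hq : 0 < q) {S T : Set (EuclideanSpace ℝ (Fin n))} (h : S ⊆ T)
    (f : EuclideanSpace ℝ (Fin n) → ℂ) : lpOn q S f ≤ lpOn q T f := by
  unfold lpOn
  gcongr

theorem lpOn_congr {S : Set (EuclideanSpace ℝ (Fin n))} {f g : EuclideanSpace ℝ (Fin n) → ℂ}
    (h : f =ᵐ[volume] g) : lpOn q S f = lpOn q S g := by
  unfold lpOn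
  congr 1
  refine lintegral_congr_ae (ae_restrict_of_ae ?_)
  filter_upwards [h] with y hy
  rw [hy]

theorem lpOn_rpow (hq : 0 < q) (S : Set (EuclideanSpace ℝ (Fin n)))
    (f : EuclideanSpace ℝ (Fin n) → ℂ) : lpOn q S f ^ q = ∫⁻ y in S, ‖f y‖ₑ ^ q := by
  rw [lpOn, ← ENNReal.rpow_mul, one_div_mul_cancel hq.ne', ENNReal.rpow_one]

theorem lpOn_le_iff (hq : 0 < q) {S : Set (EuclideanSpace ℝ (Fin n))}
    {f : EuclideanSpace ℝ (Fin n) → ℂ} {A : ℝ≥0∞} :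
    lpOn q S f ≤ A ↔ ∫⁻ y in S, ‖f y‖ₑ ^ q ≤ A ^ q := by
  rw [lpOn, one_div, ENNReal.rpow_inv_le_iff hq]

theorem morreyM_mono (hq : 0 < q) {f g : EuclideanSpace ℝ (Fin n) → ℂ}
    (h : ∀ᵐ y, ‖f y‖ₑ ≤ ‖g y‖ₑ) (r : ℝ) : morreyM n p q f r ≤ morreyM n p q g r := by
  unfold morreyM
  refine iSup_mono fun x => ?_
  gcongr _ * (_ * ?_) ^ _
  refine lintegral_mono_ae (ae_restrict_of_ae ?_)
  filter_upwards [h] with y hy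
  gcongr

theorem morreyNorm_mono (hq : 0 < q) {f g : EuclideanSpace ℝ (Fin n) → ℂ}
    (h : ∀ᵐ y, ‖f y‖ₑ ≤ ‖g y‖ₑ) : morreyNorm n p q f ≤ morreyNorm n p q g :=
  iSup₂_mono fun r _ => morreyM_mono hq h r

/-- A function dominated by `|f|^(q/q₀)` has its Morrey functional in `M^{p₀}_{q₀}` dominated by
a power of that of `f` in `M^p_q`, because `p/q = p₀/q₀`. -/
theorem morreyM_le_rpow (hp : 0 < p) (hq : 0 < q) (hp₀ : 0 < p₀) (hq₀ : 0 < q₀)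
    (hratio : p / q = p₀ / q₀) {f g : EuclideanSpace ℝ (Fin n) → ℂ}
    (h : ∀ᵐ y, ‖g y‖ₑ ^ q₀ ≤ ‖f y‖ₑ ^ q) {r : ℝ} :
    morreyM n p₀ q₀ g r ≤ morreyM n p q f r ^ (q / q₀) := by
  unfold morreyM
  refine iSup_le fun x => ?_
  have key : volume (Metric.ball x r) ^ (1 / p₀) *
      ((volume (Metric.ball x r))⁻¹ * ∫⁻ y in Metric.ball x r, ‖g y‖ₑ ^ q₀) ^ (1 / q₀) ≤
      (volume (Metric.ball x r) ^ (1 / p) *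
      ((volume (Metric.ball x r))⁻¹ * ∫⁻ y in Metric.ball x r, ‖f y‖ₑ ^ q) ^ (1 / q)) ^
        (q / q₀) := by
    have e1 : 1 / p * (q / q₀) = 1 / p₀ := by
      rw [div_eq_div_iff hq.ne' hq₀.ne'] at hratio
      field_simp
      linarith
    have e2 : 1 / q * (q / q₀) = 1 / q₀ := by field_simp
    rw [ENNReal.mul_rpow_of_nonneg (_ ^ (1 / p)) _ (by positivity), ← ENNReal.rpow_mul,
      ← ENNReal.rpow_mul, e1, e2]
    gcongr _ * (_ * ?_) ^ _
    exact lintegral_mono_ae (ae_restrict_of_ae h)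
  refine key.trans ?_
  gcongr
  exact le_iSup (fun x => volume (Metric.ball x r) ^ (1 / p) *
      ((volume (Metric.ball x r))⁻¹ * ∫⁻ y in Metric.ball x r, ‖f y‖ₑ ^ q) ^ (1 / q)) x

theorem morreyNorm_le_rpow (hp : 0 < p) (hq : 0 < q) (hp₀ : 0 < p₀) (hq₀ : 0 < q₀)
    (hratio : p / q = p₀ / q₀) {f g : EuclideanSpace ℝ (Fin n) → ℂ}
    (h : ∀ᵐ y, ‖g y‖ₑ ^ q₀ ≤ ‖f y‖ₑ ^ q) :
    morreyNorm n p₀ q₀ g ≤ morreyNorm n p q f ^ (q / q₀) := by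
  refine iSup₂_le fun r hr => (morreyM_le_rpow hp hq hp₀ hq₀ hratio h).trans ?_
  gcongr
  exact morreyM_le_morreyNorm f hr

theorem lintegral_enorm_le_lpOn (hq : 1 ≤ q) {S : Set (EuclideanSpace ℝ (Fin n))}
    {f : EuclideanSpace ℝ (Fin n) → ℂ} (hf : AEStronglyMeasurable f volume) :
    ∫⁻ y in S, ‖f y‖ₑ ≤ lpOn q S f * volume S ^ (1 - 1 / q) := by
  have h0 : 0 < q := by linarith
  have h1 : 1 / q ≤ 1 := by rw [div_le_one h0]; exact hq
  have := ENNReal.lintegral_mul_norm_pow_le (μ := volume.restrict S)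
    (f := fun y => ‖f y‖ₑ ^ q) (g := fun _ => 1) (hf.restrict.enorm.pow_const q)
    aemeasurable_const (p := 1 / q) (q := 1 - 1 / q) (by positivity) (by linarith) (by ring)
  simpa [← ENNReal.rpow_mul, mul_inv_cancel₀ h0.ne', lpOn] using this

/-- A finite constant bounding `L¹` norms over subsets of `B(0, R)` by the Morrey norm. -/
noncomputable def localBound (n : ℕ) (p q R : ℝ) : ℝ≥0∞ :=
  (ballWeight p q (0 : EuclideanSpace ℝ (Fin n)) R)⁻¹ *
    volume (Metric.ball (0 : EuclideanSpace ℝ (Fin n)) R) ^ (1 - 1 / q)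

theorem localBound_ne_top (hq : 1 ≤ q) {R : ℝ} (hR : 0 < R) :
    localBound n p q R ≠ ∞ := by
  have h0 : 0 < q := by linarith
  have h1 : 1 / q ≤ 1 := by rw [div_le_one h0]; exact hq
  exact ENNReal.mul_ne_top (ENNReal.inv_ne_top.2 (ballWeight_ne_zero p q _ hR))
    (ENNReal.rpow_ne_top_of_nonneg (by linarith) (volume_ball_ne_top _ _))

theorem lintegral_enorm_le_morreyNorm (hp : 0 < p) (hq : 1 ≤ q) {R : ℝ} (hR : 0 < R)
    {S : Set (EuclideanSpace ℝ (Fin n))} (hS : S ⊆ Metric.ball 0 R)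
    {f : EuclideanSpace ℝ (Fin n) → ℂ} (hf : AEStronglyMeasurable f volume) :
    ∫⁻ y in S, ‖f y‖ₑ ≤ localBound n p q R * morreyNorm n p q f := by
  have h0 : 0 < q := by linarith
  have h1 : 1 / q ≤ 1 := by rw [div_le_one h0]; exact hq
  calc ∫⁻ y in S, ‖f y‖ₑ ≤ ∫⁻ y in Metric.ball 0 R, ‖f y‖ₑ := lintegral_mono_set hS
    _ ≤ lpOn q (Metric.ball 0 R) f * volume (Metric.ball 0 R) ^ (1 - 1 / q) :=
        lintegral_enorm_le_lpOn hq hf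
    _ ≤ ((ballWeight p q 0 R)⁻¹ * morreyNorm n p q f) *
        volume (Metric.ball (0 : EuclideanSpace ℝ (Fin n)) R) ^ (1 - 1 / q) := by
        gcongr
        refine (lpOn_ball_le hp h0 f 0 hR).trans ?_
        gcongr
        exact morreyM_le_morreyNorm f hR
    _ = _ := by unfold localBound; ring

theorem integrableOn_of_mem_morreySet (hp : 0 < p) (hq : 1 ≤ q)
    {S : Set (EuclideanSpace ℝ (Fin n))} (hS : Bornology.IsBounded S)
    {f : MeasFun n} (hf : f ∈ morreySet n p q) : IntegrableOn f S := by
  obtain ⟨R, hR, hSR⟩ := hS.subset_ball_lt 0 0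
  refine ⟨f.aestronglyMeasurable.restrict, ?_⟩
  exact (lintegral_enorm_le_morreyNorm hp hq hR hSR f.aestronglyMeasurable).trans_lt
    (ENNReal.mul_lt_top (localBound_ne_top hq hR).lt_top hf)

theorem morreyNorm_le_of_lpOn_le (hq : 0 < q) {f : EuclideanSpace ℝ (Fin n) → ℂ} {A : ℝ≥0∞}
    (h : ∀ x r, 0 < r → ballWeight p q x r * lpOn q (Metric.ball x r) f ≤ A) :
    morreyNorm n p q f ≤ A := by
  refine iSup₂_le fun r hr => ?_
  rw [morreyM_eq_iSup_lpOn hq]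
  exact iSup_le fun x => h x r hr

/-- Fatou property of the Morrey norm. -/
theorem morreyNorm_le_of_tendsto (hp : 0 < p) (hq : 0 < q)
    {f : EuclideanSpace ℝ (Fin n) → ℂ} {u : ℕ → EuclideanSpace ℝ (Fin n) → ℂ}
    (hu : ∀ k, AEStronglyMeasurable (u k) volume)
    (hlim : ∀ᵐ y, Tendsto (fun k => u k y) atTop (𝓝 (f y))) {A : ℝ≥0∞}
    (hA : ∀ᶠ k in atTop, morreyNorm n p q (u k) ≤ A) : morreyNorm n p q f ≤ A := by
  refine morreyNorm_le_of_lpOn_le hq fun x r hr => ?_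
  rw [ENNReal.mul_le_iff_le_inv (ballWeight_ne_zero p q x hr) (ballWeight_ne_top hp hq x hr),
    lpOn_le_iff hq]
  have h1 : ∫⁻ y in Metric.ball x r, ‖f y‖ₑ ^ q ≤
      liminf (fun k => ∫⁻ y in Metric.ball x r, ‖u k y‖ₑ ^ q) atTop := by
    refine le_trans (le_of_eq ?_)
      (lintegral_liminf_le' fun k => (hu k).restrict.enorm.pow_const q)
    refine lintegral_congr_ae (ae_restrict_of_ae ?_)
    filter_upwards [hlim] with y hy
    exact ((ENNReal.continuous_rpow_const.tendsto _).comp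
      ((continuous_enorm.tendsto _).comp hy)).liminf_eq.symm
  refine h1.trans (liminf_le_of_frequently_le' (Eventually.frequently ?_))
  filter_upwards [hA] with k hk
  have h2 := lpOn_ball_le hp hq (u k) x hr
  rw [lpOn_le_iff hq] at h2
  refine h2.trans ?_
  gcongr
  exact (morreyM_le_morreyNorm _ hr).trans hk

end Basics

/-! ### Completeness of the Morrey spaces -/

section Complete

variable {n : ℕ} {p q : ℝ} {hq : 1 ≤ q}

/-- The element of the Morrey space given by a class of finite Morrey norm. -/
def MorreySpace.ofMem (hq : 1 ≤ q) (f : MeasFun n) (hf : f ∈ morreySet n p q) :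
    MorreySpace n p q hq := ⟨f, hf⟩

@[simp]
theorem MorreySpace.incl_ofMem (f : MeasFun n) (hf : f ∈ morreySet n p q) :
    MorreySpace.incl n p q hq (MorreySpace.ofMem hq f hf) = f := rfl

theorem MorreySpace.incl_injective : Function.Injective (MorreySpace.incl n p q hq) :=
  Subtype.val_injective

theorem MorreySpace.enorm_eq (f : MorreySpace n p q hq) :
    ‖f‖ₑ = morreyNorm n p q (MorreySpace.incl n p q hq f) := by
  rw [← ofReal_norm, MorreySpace.norm_def, ENNReal.ofReal_toReal f.incl_mem.ne]

theorem measFun_coe_sub (f g : MeasFun n) : ⇑(f - g) =ᵐ[volume] fun y => f y - g y :=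
  AEEqFun.coeFn_sub f g

theorem morreyNorm_sub_eq_enorm (f g : MorreySpace n p q hq) :
    morreyNorm n p q (fun y => MorreySpace.incl n p q hq f y - MorreySpace.incl n p q hq g y) =
      ‖f - g‖ₑ := by
  rw [MorreySpace.enorm_eq, map_sub, morreyNorm_congr (measFun_coe_sub _ _)]

theorem ae_of_forall_ae_restrict_ball {P : EuclideanSpace ℝ (Fin n) → Prop}
    (h : ∀ k : ℕ, ∀ᵐ y ∂volume.restrict
      (Metric.ball (0 : EuclideanSpace ℝ (Fin n)) ((k : ℝ) + 1)), P y) : ∀ᵐ y, P y := by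
  have hU : (⋃ k : ℕ, Metric.ball (0 : EuclideanSpace ℝ (Fin n)) ((k : ℝ) + 1)) = univ := by
    refine eq_univ_of_forall fun y => mem_iUnion.2 ?_
    obtain ⟨k, hk⟩ := exists_nat_gt (dist y 0)
    exact ⟨k, by simp only [Metric.mem_ball]; linarith⟩
  have := (ae_restrict_iUnion_iff _ _).2 h
  rwa [hU, Measure.restrict_univ] at this

theorem ae_exists_tendsto_of_summable_morreyNorm (hp : 0 < p) (hq : 1 ≤ q)
    {u : ℕ → EuclideanSpace ℝ (Fin n) → ℂ} (hu : ∀ k, AEStronglyMeasurable (u k) volume)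
    (hsum : ∑' k, morreyNorm n p q (fun y => u k y - u (k + 1) y) ≠ ∞) :
    ∀ᵐ y, ∃ l, Tendsto (fun k => u k y) atTop (𝓝 l) := by
  refine ae_of_forall_ae_restrict_ball fun k => ?_
  have hk : (0 : ℝ) < (k : ℝ) + 1 := by positivity
  have hm : ∀ j, AEStronglyMeasurable (fun y => u j y - u (j + 1) y) volume :=
    fun j => (hu j).sub (hu (j + 1))
  have h1 : ∫⁻ y in Metric.ball (0 : EuclideanSpace ℝ (Fin n)) ((k : ℝ) + 1),
      ∑' j, ‖u j y - u (j + 1) y‖ₑ ≠ ∞ := by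
    rw [lintegral_tsum fun j => (hm j).restrict.enorm]
    refine ne_top_of_le_ne_top (b := localBound n p q (k + 1) *
      ∑' j, morreyNorm n p q (fun y => u j y - u (j + 1) y))
      (ENNReal.mul_ne_top (localBound_ne_top hq hk) hsum) ?_
    rw [← ENNReal.tsum_mul_left]
    exact ENNReal.tsum_le_tsum fun j =>
      lintegral_enorm_le_morreyNorm hp hq hk subset_rfl (hm j)
  have h2 := ae_lt_top' (AEMeasurable.tsum fun j => (hm j).restrict.enorm) h1
  filter_upwards [h2] with y hy
  refine cauchySeq_tendsto_of_complete
    (cauchySeq_of_edist_le_of_tsum_ne_top (fun j => ‖u j y - u (j + 1) y‖ₑ) (fun j => ?_) hy.ne)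
  rw [edist_eq_enorm_sub]

theorem MorreySpace.completeSpace (hp : 0 < p) (hq : 1 ≤ q) :
    CompleteSpace (MorreySpace n p q hq) := by
  have h0 : 0 < q := by linarith
  refine Metric.complete_of_convergent_controlled_sequences (fun k => (1 / 2 : ℝ) ^ k)
    (fun k => by positivity) fun u hu => ?_
  set v : ℕ → EuclideanSpace ℝ (Fin n) → ℂ := fun k => MorreySpace.incl n p q hq (u k) with hv
  have hvm : ∀ k, AEStronglyMeasurable (v k) volume := fun k => AEEqFun.aestronglyMeasurable _
  have hd : ∀ N k, N ≤ k →
      morreyNorm n p q (fun y => v k y - v N y) ≤ ENNReal.ofReal ((1 / 2 : ℝ) ^ N) := by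
    intro N k hk
    rw [hv, morreyNorm_sub_eq_enorm, ← ofReal_norm, ← dist_eq_norm]
    exact ENNReal.ofReal_le_ofReal (hu N k N hk le_rfl).le
  have hsum : ∑' k, morreyNorm n p q (fun y => v k y - v (k + 1) y) ≠ ∞ := by
    have : Summable fun k : ℕ => (1 / 2 : ℝ) ^ k := summable_geometric_two
    refine ne_top_of_le_ne_top this.tsum_ofReal_ne_top (ENNReal.tsum_le_tsum fun k => ?_)
    rw [hv, morreyNorm_sub_eq_enorm, ← ofReal_norm, ← dist_eq_norm]
    exact ENNReal.ofReal_le_ofReal (hu k k (k + 1) le_rfl (by omega)).le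
  obtain ⟨f, hfm, hf⟩ := exists_stronglyMeasurable_limit_of_tendsto_ae hvm
    (ae_exists_tendsto_of_summable_morreyNorm hp hq hvm hsum)
  have hfN : ∀ N, morreyNorm n p q (fun y => f y - v N y) ≤ ENNReal.ofReal ((1 / 2 : ℝ) ^ N) := by
    intro N
    refine morreyNorm_le_of_tendsto hp h0 (u := fun k y => v k y - v N y)
      (fun k => (hvm k).sub (hvm N)) ?_ ?_
    · filter_upwards [hf] with y hy
      exact hy.sub_const _
    · filter_upwards [eventually_ge_atTop N] with k hk
      exact hd N k hk
  have hmem : AEEqFun.mk f hfm.aestronglyMeasurable ∈ morreySet n p q := by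
    change morreyNorm n p q _ < ∞
    have e : ⇑(AEEqFun.mk f hfm.aestronglyMeasurable : MeasFun n) =ᵐ[volume]
        fun y => (f y - v 0 y) + v 0 y := by
      filter_upwards [AEEqFun.coeFn_mk f hfm.aestronglyMeasurable] with y hy
      rw [hy]; ring
    rw [morreyNorm_congr e]
    refine (morreyNorm_add_le hq (hfm.aestronglyMeasurable.sub (hvm 0)) (hvm 0)).trans_lt
      (ENNReal.add_lt_top.2 ⟨(hfN 0).trans_lt ENNReal.ofReal_lt_top, (u 0).incl_mem⟩)
  refine ⟨MorreySpace.ofMem hq _ hmem, ?_⟩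
  rw [tendsto_iff_dist_tendsto_zero]
  refine squeeze_zero (fun _ => dist_nonneg) (fun N => ?_)
    (tendsto_pow_atTop_nhds_zero_of_lt_one (r := (1 / 2 : ℝ)) (by norm_num) (by norm_num))
  rw [dist_comm, dist_eq_norm, ← ENNReal.ofReal_le_ofReal_iff (by positivity),
    ofReal_norm, ← morreyNorm_sub_eq_enorm]
  refine le_trans (le_of_eq (morreyNorm_congr ?_)) (hfN N)
  filter_upwards [AEEqFun.coeFn_mk f hfm.aestronglyMeasurable] with y hy
  rw [MorreySpace.incl_ofMem, hy]

end Complete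

/-! ### Duality for local `L^q` norms -/

section Duality

variable {n : ℕ} {q r : ℝ}

/-- The number `conj (sgn c) |c|^a`, with value `0` at `c = 0` for every exponent `a : ℂ`. -/
noncomputable def dualPow (a c : ℂ) : ℂ :=
  if c = 0 then 0 else (starRingEnd ℂ c / ‖c‖) * Complex.exp (a * Real.log ‖c‖)

theorem dualPow_zero (a : ℂ) : dualPow a 0 = 0 := by simp [dualPow]

theorem norm_dualPow {a c : ℂ} (hc : c ≠ 0) : ‖dualPow a c‖ = ‖c‖ ^ a.re := by
  have h : 0 < ‖c‖ := norm_pos_iff.2 hc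
  rw [dualPow, if_neg hc, norm_mul, norm_div, RCLike.norm_conj, Complex.norm_real, norm_norm,
    div_self h.ne', one_mul, Complex.norm_exp, Complex.re_mul_ofReal, Real.rpow_def_of_pos h,
    mul_comm]

theorem enorm_dualPow_le (a c : ℂ) : ‖dualPow a c‖ₑ ≤ ‖c‖ₑ ^ a.re := by
  by_cases hc : c = 0
  · simp [hc, dualPow_zero]
  · rw [← ofReal_norm, ← ofReal_norm, norm_dualPow hc,
      ENNReal.ofReal_rpow_of_pos (norm_pos_iff.2 hc)]

theorem continuousAt_dualPow {a c : ℂ} (hc : c ≠ 0) : ContinuousAt (dualPow a) c := by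
  have h : dualPow a =ᶠ[𝓝 c]
      fun c => (starRingEnd ℂ c / ‖c‖) * Complex.exp (a * Real.log ‖c‖) := by
    filter_upwards [isOpen_ne.mem_nhds hc] with d hd
    exact if_neg hd
  refine ContinuousAt.congr ?_ h.symm
  have h1 : ‖c‖ ≠ 0 := norm_ne_zero_iff.2 hc
  have h2 : ContinuousAt (fun c : ℂ => Real.log ‖c‖) c := continuous_norm.continuousAt.log h1
  have h3 : ContinuousAt (fun c : ℂ => ((Real.log ‖c‖ : ℝ) : ℂ)) c :=
    Complex.continuous_ofReal.continuousAt.comp h2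
  have h4 : ContinuousAt (fun c : ℂ => starRingEnd ℂ c / ((‖c‖ : ℝ) : ℂ)) c :=
    Complex.continuous_conj.continuousAt.div
      (Complex.continuous_ofReal.comp continuous_norm).continuousAt (by exact_mod_cast h1)
  exact h4.mul (Complex.continuous_exp.continuousAt.comp (continuousAt_const.mul h3))

theorem mul_dualPow_self (hq : 1 ≤ q) (c : ℂ) :
    c * dualPow ((q - 1 : ℝ) : ℂ) c = ((‖c‖ ^ q : ℝ) : ℂ) := by
  by_cases hc : c = 0
  · have : q ≠ 0 := by linarith
    simp [hc, dualPow_zero, Real.zero_rpow this]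
  · have h : 0 < ‖c‖ := norm_pos_iff.2 hc
    rw [dualPow, if_neg hc, ← mul_assoc, mul_div_assoc', Complex.mul_conj,
      Complex.normSq_eq_norm_sq]
    have : (‖c‖ : ℝ) ^ q = (‖c‖ ^ 2 / ‖c‖) * Real.exp ((q - 1) * Real.log ‖c‖) := by
      rw [mul_comm (q - 1), ← Real.rpow_def_of_pos h, sq, mul_div_cancel_right₀ _ h.ne',
        ← Real.rpow_one_add' h.le (by linarith)]
      congr 1
      ring
    rw [this]
    push_cast
    ring

/-- Hölder's inequality against the test function `conj (sgn s) |s|^a`, `Re a = q (1 - 1/r)`. -/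
theorem enorm_setIntegral_mul_dualPow_le (hr : 1 ≤ r)
    {S : Set (EuclideanSpace ℝ (Fin n))} {h : EuclideanSpace ℝ (Fin n) → ℂ}
    (hh : AEStronglyMeasurable h volume) {a : ℂ} (ha : a.re = q * (1 - 1 / r))
    (s : SimpleFunc (EuclideanSpace ℝ (Fin n)) ℂ) :
    ‖∫ y in S, h y * dualPow a (s y)‖ₑ ≤
      lpOn r S h * (∫⁻ y in S, ‖s y‖ₑ ^ q) ^ (1 - 1 / r) := by
  have h0 : 0 < r := by linarith
  have h1 : 1 / r ≤ 1 := by rw [div_le_one h0]; exact hr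
  refine (enorm_integral_le_lintegral_enorm _).trans ?_
  have := ENNReal.lintegral_mul_norm_pow_le (μ := volume.restrict S)
    (f := fun y => ‖h y‖ₑ ^ r) (g := fun y => ‖s y‖ₑ ^ q) (hh.restrict.enorm.pow_const r)
    (s.measurable.enorm.pow_const q).aemeasurable (p := 1 / r) (q := 1 - 1 / r)
    (by positivity) (by linarith) (by ring)
  refine le_trans (lintegral_mono fun y => ?_) this
  rw [enorm_mul, ← ENNReal.rpow_mul, ← ENNReal.rpow_mul, mul_one_div_cancel h0.ne',
    ENNReal.rpow_one, ← ha]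
  gcongr
  exact enorm_dualPow_le _ _

theorem lintegral_simpleFunc_rpow_ne_top (hq : 0 < q) {S : Set (EuclideanSpace ℝ (Fin n))}
    (hS : volume S ≠ ∞) (s : SimpleFunc (EuclideanSpace ℝ (Fin n)) ℂ) :
    ∫⁻ y in S, ‖s y‖ₑ ^ q ≠ ∞ := by
  obtain ⟨C, hC⟩ := s.exists_forall_norm_le
  have h1 : ∀ y, ‖s y‖ₑ ^ q ≤ ENNReal.ofReal C ^ q := fun y => by
    rw [← ofReal_norm]
    gcongr
    exact hC y
  refine ne_top_of_le_ne_top ?_ (lintegral_mono h1)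
  rw [setLIntegral_const]
  exact ENNReal.mul_ne_top (ENNReal.rpow_ne_top_of_nonneg hq.le ENNReal.ofReal_ne_top) hS

theorem lintegral_rpow_le_of_dual_of_bounded (hq : 1 ≤ q) {S : Set (EuclideanSpace ℝ (Fin n))}
    (hSv : volume S ≠ ∞) {h : EuclideanSpace ℝ (Fin n) → ℂ}
    (hm : Measurable h) (hi : IntegrableOn h S) {A : ℝ≥0∞}
    (H : ∀ s : SimpleFunc (EuclideanSpace ℝ (Fin n)) ℂ,
      ‖∫ y in S, h y * dualPow ((q - 1 : ℝ) : ℂ) (s y)‖ₑ ≤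
        A * (∫⁻ y in S, ‖s y‖ₑ ^ q) ^ (1 - 1 / q)) (k : ℕ) :
    ∫⁻ y in S, ‖{y | ‖h y‖ ≤ k}.indicator h y‖ₑ ^ q ≤ A ^ q := by
  have h0 : 0 < q := by linarith
  have h1q : 1 / q ≤ 1 := by rw [div_le_one h0]; exact hq
  set E : Set (EuclideanSpace ℝ (Fin n)) := {y | ‖h y‖ ≤ k} with hE
  have hEm : MeasurableSet E := measurableSet_le hm.norm measurable_const
  set g := E.indicator h with hg
  have hgm : Measurable g := hm.indicator hEm
  have hgk : ∀ y, ‖g y‖ ≤ k := fun y => by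
    by_cases hy : y ∈ E
    · rw [hg, indicator_of_mem hy]; exact hy
    · rw [hg, indicator_of_notMem hy]; simp
  set s : ℕ → SimpleFunc (EuclideanSpace ℝ (Fin n)) ℂ :=
    fun j => SimpleFunc.approxOn g hgm univ 0 (mem_univ _) j with hs
  have hsk : ∀ j y, ‖s j y‖ ≤ 2 * k := fun j y => by
    have := SimpleFunc.norm_approxOn_zero_le hgm (mem_univ (0 : ℂ)) y j
    linarith [hgk y]
  have hst : ∀ y, Tendsto (fun j => s j y) atTop (𝓝 (g y)) := fun y =>
    SimpleFunc.tendsto_approxOn hgm (mem_univ _) (by simp)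
  set I := ∫⁻ y in S, ‖g y‖ₑ ^ q with hI
  have hIt : I ≠ ∞ := by
    have h1 : ∀ y, ‖g y‖ₑ ^ q ≤ ENNReal.ofReal k ^ q := fun y => by
      rw [← ofReal_norm]
      gcongr
      exact hgk y
    refine ne_top_of_le_ne_top ?_ (lintegral_mono h1)
    rw [setLIntegral_const]
    exact ENNReal.mul_ne_top (ENNReal.rpow_ne_top_of_nonneg h0.le ENNReal.ofReal_ne_top) hSv
  have lim1 : Tendsto (fun j => ∫ y in S, h y * dualPow ((q - 1 : ℝ) : ℂ) (s j y)) atTop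
      (𝓝 (∫ y in S, ((‖g y‖ ^ q : ℝ) : ℂ))) := by
    refine tendsto_integral_of_dominated_convergence
      (fun y => ‖h y‖ * (2 * k) ^ (q - 1)) (fun j => ?_) (hi.norm.mul_const _) (fun j => ?_) ?_
    · exact hm.aestronglyMeasurable.mul
        ((s j).map (dualPow _)).measurable.aestronglyMeasurable
    · refine ae_of_all _ fun y => ?_
      rw [norm_mul]
      gcongr
      by_cases hc : s j y = 0
      · rw [hc, dualPow_zero, norm_zero]; positivity
      · rw [norm_dualPow hc, Complex.ofReal_re]
        exact Real.rpow_le_rpow (norm_nonneg _) (hsk j y) (by linarith)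
    · refine ae_of_all _ fun y => ?_
      by_cases hc : h y = 0
      · have : g y = 0 := by
          by_cases hy : y ∈ E
          · rw [hg, indicator_of_mem hy, hc]
          · rw [hg, indicator_of_notMem hy]
        simp [hc, this, Real.zero_rpow h0.ne']
      by_cases hy : y ∈ E
      · have hgy : g y = h y := by rw [hg, indicator_of_mem hy]
        rw [hgy, ← mul_dualPow_self hq]
        exact ((continuousAt_dualPow hc).tendsto.comp (hgy ▸ hst y)).const_mul _
      · have hgy : g y = 0 := by rw [hg, indicator_of_notMem hy]
        have hz : ∀ j, s j y = 0 := fun j => by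
          have := SimpleFunc.norm_approxOn_zero_le hgm (mem_univ (0 : ℂ)) y j
          rw [hgy] at this
          simpa using this
        simp [hz, hgy, dualPow_zero, Real.zero_rpow h0.ne']
  have lim2 : Tendsto (fun j => ∫⁻ y in S, ‖s j y‖ₑ ^ q) atTop (𝓝 I) := by
    refine tendsto_lintegral_of_dominated_convergence (fun _ => ENNReal.ofReal (2 * k) ^ q)
      (fun j => (s j).measurable.enorm.pow_const q) (fun j => ae_of_all _ fun y => ?_) ?_
      (ae_of_all _ fun y => ?_)
    · beta_reduce
      rw [← ofReal_norm]
      gcongr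
      exact hsk j y
    · rw [setLIntegral_const]
      exact ENNReal.mul_ne_top (ENNReal.rpow_ne_top_of_nonneg h0.le ENNReal.ofReal_ne_top) hSv
    · exact (ENNReal.continuous_rpow_const.tendsto _).comp
        ((continuous_enorm.tendsto _).comp (hst y))
  have hIe : ‖∫ y in S, ((‖g y‖ ^ q : ℝ) : ℂ)‖ₑ = I := by
    rw [integral_complex_ofReal, hI]
    have hnn : 0 ≤ ∫ y in S, ‖g y‖ ^ q := integral_nonneg fun y => by positivity
    rw [← ofReal_norm, Complex.norm_real, Real.norm_of_nonneg hnn,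
      ofReal_integral_eq_lintegral_ofReal]
    · refine lintegral_congr fun y => ?_
      rw [← ofReal_norm, ENNReal.ofReal_rpow_of_nonneg (norm_nonneg _) h0.le]
    · refine ⟨(hgm.norm.pow_const q).aestronglyMeasurable, ?_⟩
      refine lt_of_le_of_lt (le_of_eq ?_) hIt.lt_top
      refine lintegral_congr fun y => ?_
      rw [Real.enorm_of_nonneg (by positivity), ← ofReal_norm,
        ENNReal.ofReal_rpow_of_nonneg (norm_nonneg _) h0.le]
    · exact ae_of_all _ fun y => by positivity
  by_cases hA : A = ∞
  · rw [hA, ENNReal.top_rpow_of_pos h0]; exact le_top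
  have hfin : I ≤ A * I ^ (1 - 1 / q) := by
    have l1 := (continuous_enorm.tendsto _).comp lim1
    rw [hIe] at l1
    have l2 : Tendsto (fun j => A * (∫⁻ y in S, ‖s j y‖ₑ ^ q) ^ (1 - 1 / q)) atTop
        (𝓝 (A * I ^ (1 - 1 / q))) :=
      ENNReal.Tendsto.const_mul ((ENNReal.continuous_rpow_const.tendsto _).comp lim2) (Or.inr hA)
    exact le_of_tendsto_of_tendsto l1 l2
      (Eventually.of_forall fun j => H (s j))
  by_cases hI0 : I = 0
  · rw [hI0]; exact zero_le
  have h3 : I ^ (1 / q) * I ^ (1 - 1 / q) = I := by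
    rw [← ENNReal.rpow_add _ _ hI0 hIt]; simp
  have h4 : I ^ (1 / q) ≤ A := by
    have hne : I ^ (1 - 1 / q) ≠ 0 := (ENNReal.rpow_pos (pos_iff_ne_zero.2 hI0) hIt).ne'
    have hnt : I ^ (1 - 1 / q) ≠ ∞ := ENNReal.rpow_ne_top_of_nonneg (by linarith) hIt
    exact (ENNReal.mul_le_mul_iff_left hne hnt).1 (h3.trans_le hfin)
  rwa [one_div, ENNReal.rpow_inv_le_iff h0] at h4

/-- The `L^q` norm over `S` is at most `A` when all pairings with the test functions
`conj (sgn s) |s|^(q-1)`, `s` simple, satisfy the bound of Hölder's inequality with constant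
`A`. -/
theorem lpOn_le_of_dual (hq : 1 ≤ q) {S : Set (EuclideanSpace ℝ (Fin n))}
    (hSv : volume S ≠ ∞) {h : EuclideanSpace ℝ (Fin n) → ℂ}
    (hm : Measurable h) (hi : IntegrableOn h S) {A : ℝ≥0∞}
    (H : ∀ s : SimpleFunc (EuclideanSpace ℝ (Fin n)) ℂ,
      ‖∫ y in S, h y * dualPow ((q - 1 : ℝ) : ℂ) (s y)‖ₑ ≤
        A * (∫⁻ y in S, ‖s y‖ₑ ^ q) ^ (1 - 1 / q)) :
    lpOn q S h ≤ A := by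
  have h0 : 0 < q := by linarith
  rw [lpOn_le_iff h0]
  have hkm : ∀ k : ℕ, Measurable ({y | ‖h y‖ ≤ k}.indicator h) := fun k =>
    hm.indicator (measurableSet_le hm.norm measurable_const)
  calc ∫⁻ y in S, ‖h y‖ₑ ^ q
      = ∫⁻ y in S, liminf (fun k : ℕ => ‖{y | ‖h y‖ ≤ k}.indicator h y‖ₑ ^ q) atTop := by
        refine lintegral_congr fun y => ?_
        obtain ⟨K, hK⟩ := exists_nat_ge ‖h y‖
        refine (Tendsto.liminf_eq (tendsto_const_nhds.congr' ?_)).symm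
        filter_upwards [eventually_ge_atTop K] with k hk
        have : y ∈ {y | ‖h y‖ ≤ (k : ℝ)} := hK.trans (by exact_mod_cast hk)
        rw [indicator_of_mem this]
    _ ≤ liminf (fun k : ℕ => ∫⁻ y in S, ‖{y | ‖h y‖ ≤ k}.indicator h y‖ₑ ^ q) atTop :=
        lintegral_liminf_le fun k => (hkm k).enorm.pow_const q
    _ ≤ A ^ q := liminf_le_of_frequently_le'
        (Eventually.of_forall fun k =>
          lintegral_rpow_le_of_dual_of_bounded hq hSv hm hi H k).frequently

end Duality

/-! ### Weakly holomorphic families with Morrey boundary values -/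

section WeakFamilies

open Complex.HadamardThreeLines

variable {n : ℕ} {p q p₀ q₀ p₁ q₁ θ : ℝ} {hq₀ : 1 ≤ q₀} {hq₁ : 1 ≤ q₁}

/-- A family `H` of locally integrable functions, parametrized by the strip `0 ≤ Re z ≤ 1`, whose
integrals over bounded sets are bounded, continuous on the strip and holomorphic in its interior,
and whose boundary values `g₀`, `g₁` are continuous with values in the two Morrey spaces and vanish
at infinity. Testing by integrals over bounded sets is all that the estimates below need of the
class `𝓕`. -/
structure WeakCalderon (H : ℂ → MeasFun n) (g₀ : ℝ → MorreySpace n p₀ q₀ hq₀)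
    (g₁ : ℝ → MorreySpace n p₁ q₁ hq₁) : Prop where
  integrableOn : ∀ z ∈ verticalClosedStrip 0 1, ∀ S : Set (EuclideanSpace ℝ (Fin n)),
    Bornology.IsBounded S → IntegrableOn (H z) S
  diffContOnCl : ∀ S : Set (EuclideanSpace ℝ (Fin n)), MeasurableSet S → Bornology.IsBounded S →
    DiffContOnCl ℂ (fun z => ∫ y in S, H z y) (verticalStrip 0 1)
  bounded : ∀ S : Set (EuclideanSpace ℝ (Fin n)), MeasurableSet S → Bornology.IsBounded S →
    ∃ C : ℝ, ∀ z ∈ verticalClosedStrip 0 1, ‖∫ y in S, H z y‖ ≤ C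
  left : ∀ t : ℝ, H (t * Complex.I) = MorreySpace.incl n p₀ q₀ hq₀ (g₀ t)
  right : ∀ t : ℝ, H (1 + t * Complex.I) = MorreySpace.incl n p₁ q₁ hq₁ (g₁ t)
  continuous_left : Continuous g₀
  continuous_right : Continuous g₁
  zero_left : Tendsto g₀ (cocompact ℝ) (𝓝 0)
  zero_right : Tendsto g₁ (cocompact ℝ) (𝓝 0)

theorem closure_verticalStrip : closure (verticalStrip 0 1) = verticalClosedStrip 0 1 := by
  rw [verticalStrip, verticalClosedStrip, ← closure_Ioo zero_ne_one, Complex.closure_preimage_re]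

theorem setIntegral_mul_dualPow_eq_sum {S : Set (EuclideanSpace ℝ (Fin n))}
    {h : EuclideanSpace ℝ (Fin n) → ℂ} (hi : IntegrableOn h S) (a : ℂ)
    (s : SimpleFunc (EuclideanSpace ℝ (Fin n)) ℂ) :
    ∫ y in S, h y * dualPow a (s y) =
      ∑ c ∈ s.range, dualPow a c * ∫ y in S ∩ s ⁻¹' {c}, h y := by
  have h1 : ∀ y, h y * dualPow a (s y) =
      ∑ c ∈ s.range, dualPow a c * (s ⁻¹' {c}).indicator h y := fun y => by
    rw [Finset.sum_eq_single (s y)]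
    · rw [indicator_of_mem (by simp), mul_comm]
    · intro c _ hc
      rw [indicator_of_notMem (by simpa using hc.symm), mul_zero]
    · intro hy
      exact absurd (s.mem_range_self y) hy
  simp_rw [h1]
  rw [integral_finsetSum]
  · refine Finset.sum_congr rfl fun c _ => ?_
    rw [integral_const_mul, setIntegral_indicator (s.measurableSet_fiber c)]
  · intro c _
    exact (hi.indicator (s.measurableSet_fiber c)).const_mul _

variable {H : ℂ → MeasFun n} {g₀ : ℝ → MorreySpace n p₀ q₀ hq₀} {g₁ : ℝ → MorreySpace n p₁ q₁ hq₁}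

theorem differentiable_dualPow {a : ℂ → ℂ} (ha : Differentiable ℂ a) (c : ℂ) :
    Differentiable ℂ fun z => dualPow (a z) c := by
  by_cases hc : c = 0
  · simp [hc, dualPow_zero]
  · simp only [dualPow, if_neg hc]
    fun_prop

theorem norm_dualPow_le {a c : ℂ} {M : ℝ} (ha : |a.re| ≤ M) :
    ‖dualPow a c‖ ≤ Real.exp (M * |Real.log ‖c‖|) := by
  by_cases hc : c = 0
  · rw [hc, dualPow_zero, norm_zero]; positivity
  · rw [norm_dualPow hc, Real.rpow_def_of_pos (norm_pos_iff.2 hc)]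
    refine Real.exp_le_exp.2 ?_
    calc _ ≤ |Real.log ‖c‖ * a.re| := le_abs_self _
      _ = |a.re| * |Real.log ‖c‖| := by rw [abs_mul, mul_comm]
      _ ≤ _ := by gcongr

theorem WeakCalderon.diffContOnCl_dual (W : WeakCalderon H g₀ g₁)
    {S : Set (EuclideanSpace ℝ (Fin n))} (hS : MeasurableSet S) (hSb : Bornology.IsBounded S)
    {a : ℂ → ℂ} (ha : Differentiable ℂ a) (s : SimpleFunc (EuclideanSpace ℝ (Fin n)) ℂ) :
    DiffContOnCl ℂ (fun z => ∫ y in S, H z y * dualPow (a z) (s y)) (verticalStrip 0 1) := by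
  have h1 : ∀ c, DiffContOnCl ℂ (fun z => dualPow (a z) c * ∫ y in S ∩ s ⁻¹' {c}, H z y)
      (verticalStrip 0 1) := fun c =>
    (differentiable_dualPow ha c).diffContOnCl.smul
      (W.diffContOnCl _ (hS.inter (s.measurableSet_fiber c)) (hSb.subset inter_subset_left))
  have h2 : ∀ z ∈ closure (verticalStrip 0 1), ∫ y in S, H z y * dualPow (a z) (s y) =
      ∑ c ∈ s.range, dualPow (a z) c * ∫ y in S ∩ s ⁻¹' {c}, H z y := fun z hz =>
    setIntegral_mul_dualPow_eq_sum (W.integrableOn z (closure_verticalStrip ▸ hz) S hSb) _ s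
  exact ⟨(DifferentiableOn.fun_sum fun c _ => (h1 c).differentiableOn).congr
      fun z hz => h2 z (subset_closure hz),
    (continuousOn_finsetSum _ fun c _ => (h1 c).continuousOn).congr h2⟩

theorem WeakCalderon.bounded_dual (W : WeakCalderon H g₀ g₁)
    {S : Set (EuclideanSpace ℝ (Fin n))} (hS : MeasurableSet S) (hSb : Bornology.IsBounded S)
    {a : ℂ → ℂ} {M : ℝ} (ha : ∀ z ∈ verticalClosedStrip 0 1, |(a z).re| ≤ M)
    (s : SimpleFunc (EuclideanSpace ℝ (Fin n)) ℂ) :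
    ∃ C : ℝ, ∀ z ∈ verticalClosedStrip 0 1, ‖∫ y in S, H z y * dualPow (a z) (s y)‖ ≤ C := by
  choose C hC using fun c : ℂ => W.bounded (S ∩ s ⁻¹' {c}) (hS.inter (s.measurableSet_fiber c))
    (hSb.subset inter_subset_left)
  refine ⟨∑ c ∈ s.range, Real.exp (M * |Real.log ‖c‖|) * C c, fun z hz => ?_⟩
  rw [setIntegral_mul_dualPow_eq_sum (W.integrableOn z hz S hSb)]
  refine norm_sum_le_of_le _ fun c _ => ?_
  rw [norm_mul]
  exact mul_le_mul (norm_dualPow_le (ha z hz)) (hC c z hz) (norm_nonneg _) (Real.exp_pos _).le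

/-- Three lines theorem for local `L^q` norms, with the norms on the two boundary lines. -/
theorem WeakCalderon.lpOn_le (W : WeakCalderon H g₀ g₁) (hθ : θ ∈ Ioo (0 : ℝ) 1) (hq' : 1 ≤ q)
    (hq : 1 / q = (1 - θ) / q₀ + θ / q₁)
    {S : Set (EuclideanSpace ℝ (Fin n))} (hS : MeasurableSet S) (hSb : Bornology.IsBounded S)
    {A₀ A₁ : ℝ≥0∞} (hA₀ : A₀ ≠ ∞) (hA₁ : A₁ ≠ ∞)
    (h₀ : ∀ t, lpOn q₀ S (MorreySpace.incl n p₀ q₀ hq₀ (g₀ t)) ≤ A₀)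
    (h₁ : ∀ t, lpOn q₁ S (MorreySpace.incl n p₁ q₁ hq₁ (g₁ t)) ≤ A₁) :
    lpOn q S (H θ) ≤ A₀ ^ (1 - θ) * A₁ ^ θ := by
  have hq0 : 0 < q := by linarith
  have hq00 : 0 < q₀ := by linarith
  have hq10 : 0 < q₁ := by linarith
  have h1θ : 0 < 1 - θ := by linarith [hθ.2]
  have e0 : 0 ≤ 1 - 1 / q₀ := by rw [sub_nonneg, div_le_one hq00]; exact hq₀
  have e1 : 0 ≤ 1 - 1 / q₁ := by rw [sub_nonneg, div_le_one hq10]; exact hq₁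
  have hθs : (θ : ℂ) ∈ verticalClosedStrip 0 1 := ⟨hθ.1.le, hθ.2.le⟩
  have hSv : volume S ≠ ∞ := hSb.measure_lt_top.ne
  refine lpOn_le_of_dual hq' hSv (H θ).measurable (W.integrableOn _ hθs S hSb) fun s => ?_
  set T := ∫⁻ y in S, ‖s y‖ₑ ^ q with hT
  have hTt : T ≠ ∞ := lintegral_simpleFunc_rpow_ne_top hq0 hSv s
  -- The exponent is chosen so that `|s|^(Re a)` is a power of `|s|^q` dual to `L^{q₀}` on the
  -- left line and to `L^{q₁}` on the right line.
  set a : ℂ → ℂ := fun z => q * (1 - ((1 - z) / q₀ + z / q₁)) with ha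
  have hare : ∀ z, (a z).re = q * (1 - ((1 - z.re) / q₀ + z.re / q₁)) := fun z => by
    rw [ha]; simp
  have hab : ∀ z ∈ verticalClosedStrip 0 1, |(a z).re| ≤ q := fun z hz => by
    have hz' : 0 ≤ z.re ∧ z.re ≤ 1 := hz
    have b0 : 0 ≤ 1 - ((1 - z.re) / q₀ + z.re / q₁) := by
      have : 1 - ((1 - z.re) / q₀ + z.re / q₁) =
        (1 - z.re) * (1 - 1 / q₀) + z.re * (1 - 1 / q₁) := by ring
      rw [this]
      have := sub_nonneg.2 hz'.2
      have := hz'.1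
      positivity
    have b1 : 0 ≤ (1 - z.re) / q₀ + z.re / q₁ := by
      have := sub_nonneg.2 hz'.2
      have := hz'.1
      positivity
    rw [hare, abs_of_nonneg (by positivity)]
    exact mul_le_of_le_one_right hq0.le (by linarith)
  have hadiff : Differentiable ℂ a := by rw [ha]; fun_prop
  have haθ : a θ = ((q - 1 : ℝ) : ℂ) := by
    have : (1 - θ) / q₀ + θ / q₁ = 1 / q := hq.symm
    have h2 : ((1 - (θ : ℂ)) / q₀ + θ / q₁) = 1 / q := by exact_mod_cast this
    rw [ha]
    simp only
    rw [h2]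
    have : (q : ℂ) ≠ 0 := by exact_mod_cast hq0.ne'
    push_cast
    field_simp
  set Φ : ℂ → ℂ := fun z => ∫ y in S, H z y * dualPow (a z) (s y) with hΦ
  obtain ⟨C, hC⟩ := W.bounded_dual hS hSb hab s
  set M₀ := A₀ * T ^ (1 - 1 / q₀) with hM₀
  set M₁ := A₁ * T ^ (1 - 1 / q₁) with hM₁
  have hM₀t : M₀ ≠ ∞ := ENNReal.mul_ne_top hA₀ (ENNReal.rpow_ne_top_of_nonneg e0 hTt)
  have hM₁t : M₁ ≠ ∞ := ENNReal.mul_ne_top hA₁ (ENNReal.rpow_ne_top_of_nonneg e1 hTt)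
  have key := norm_le_interp_of_mem_verticalClosedStrip₀₁' Φ hθs
    (W.diffContOnCl_dual hS hSb hadiff s) (a := M₀.toReal) (b := M₁.toReal)
    ⟨C, by rintro _ ⟨z, hz, rfl⟩; exact hC z hz⟩ ?_ ?_
  · rw [Complex.ofReal_re, hΦ] at key
    simp only [haθ] at key
    rw [← ofReal_norm]
    refine (ENNReal.ofReal_le_ofReal key).trans (le_of_eq ?_)
    rw [ENNReal.ofReal_mul (by positivity), ← ENNReal.ofReal_rpow_of_nonneg (by positivity) h1θ.le,
      ← ENNReal.ofReal_rpow_of_nonneg (by positivity) hθ.1.le, ENNReal.ofReal_toReal hM₀t,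
      ENNReal.ofReal_toReal hM₁t, hM₀, hM₁, ENNReal.mul_rpow_of_nonneg _ _ h1θ.le,
      ENNReal.mul_rpow_of_nonneg _ _ hθ.1.le, ← ENNReal.rpow_mul, ← ENNReal.rpow_mul]
    have : 1 - 1 / q = (1 - 1 / q₀) * (1 - θ) + (1 - 1 / q₁) * θ := by rw [hq]; ring
    rw [this, ENNReal.rpow_add_of_nonneg _ _ (by positivity) (mul_nonneg e1 hθ.1.le)]
    ring
  · intro z hz
    have hz0 : z.re = 0 := hz
    have hzt : z = (z.im : ℝ) * Complex.I := by
      apply Complex.ext <;> simp [hz0]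
    rw [← ENNReal.ofReal_le_iff_le_toReal hM₀t, ofReal_norm, hΦ]
    have hb := enorm_setIntegral_mul_dualPow_le (S := S) (q := q) (a := a z) hq₀
      (H z).aestronglyMeasurable (by rw [hare, hz0]; ring) s
    refine hb.trans ?_
    rw [hM₀, hzt, W.left]
    gcongr
    exact h₀ _
  · intro z hz
    have hz0 : z.re = 1 := hz
    have hzt : z = 1 + (z.im : ℝ) * Complex.I := by
      apply Complex.ext <;> simp [hz0]
    rw [← ENNReal.ofReal_le_iff_le_toReal hM₁t, ofReal_norm, hΦ]
    have hb := enorm_setIntegral_mul_dualPow_le (S := S) (q := q) (a := a z) hq₁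
      (H z).aestronglyMeasurable (by rw [hare, hz0]; ring) s
    refine hb.trans ?_
    rw [hM₁, hzt, W.right]
    gcongr
    exact h₁ _

/-- Three lines theorem for the Morrey functional at the radius `r`. -/
theorem WeakCalderon.morreyM_le (W : WeakCalderon H g₀ g₁) (hθ : θ ∈ Ioo (0 : ℝ) 1)
    (hp₀ : 0 < p₀) (hp₁ : 0 < p₁) (hq' : 1 ≤ q)
    (hp : 1 / p = (1 - θ) / p₀ + θ / p₁) (hq : 1 / q = (1 - θ) / q₀ + θ / q₁)
    {A : ℝ≥0∞} (hA : A ≠ ∞) {r : ℝ} (hr : 0 < r)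
    (h₀ : ∀ t, morreyM n p₀ q₀ (MorreySpace.incl n p₀ q₀ hq₀ (g₀ t)) r ≤ A)
    (h₁ : ∀ t, morreyM n p₁ q₁ (MorreySpace.incl n p₁ q₁ hq₁ (g₁ t)) r ≤ A) :
    morreyM n p q (H θ) r ≤ A := by
  have hq0 : 0 < q := by linarith
  have hq00 : 0 < q₀ := by linarith
  have hq10 : 0 < q₁ := by linarith
  have h1θ : 0 < 1 - θ := by linarith [hθ.2]
  rw [morreyM_eq_iSup_lpOn hq0]
  refine iSup_le fun x => ?_
  set w₀ := ballWeight p₀ q₀ x r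
  set w₁ := ballWeight p₁ q₁ x r
  have n₀ : w₀ ≠ 0 := ballWeight_ne_zero p₀ q₀ x hr
  have n₁ : w₁ ≠ 0 := ballWeight_ne_zero p₁ q₁ x hr
  have t₀ : w₀ ≠ ∞ := ballWeight_ne_top hp₀ hq00 x hr
  have t₁ : w₁ ≠ ∞ := ballWeight_ne_top hp₁ hq10 x hr
  have key := W.lpOn_le hθ hq' hq (S := Metric.ball x r) measurableSet_ball Metric.isBounded_ball
    (A₀ := w₀⁻¹ * A) (A₁ := w₁⁻¹ * A) (ENNReal.mul_ne_top (ENNReal.inv_ne_top.2 n₀) hA)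
    (ENNReal.mul_ne_top (ENNReal.inv_ne_top.2 n₁) hA)
    (fun t => (lpOn_ball_le hp₀ hq00 _ x hr).trans (by gcongr; exact h₀ t))
    (fun t => (lpOn_ball_le hp₁ hq10 _ x hr).trans (by gcongr; exact h₁ t))
  rw [ballWeight_interpolate hθ hp hq x hr]
  calc w₀ ^ (1 - θ) * w₁ ^ θ * lpOn q (Metric.ball x r) (H θ)
      ≤ w₀ ^ (1 - θ) * w₁ ^ θ * ((w₀⁻¹ * A) ^ (1 - θ) * (w₁⁻¹ * A) ^ θ) := by gcongr
    _ = (w₀ * (w₀⁻¹ * A)) ^ (1 - θ) * (w₁ * (w₁⁻¹ * A)) ^ θ := by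
        rw [ENNReal.mul_rpow_of_nonneg w₀ _ h1θ.le, ENNReal.mul_rpow_of_nonneg w₁ _ hθ.1.le]
        ring
    _ = A := by
        rw [← mul_assoc, ENNReal.mul_inv_cancel n₀ t₀, ← mul_assoc, ENNReal.mul_inv_cancel n₁ t₁,
          one_mul, ← ENNReal.rpow_add_of_nonneg _ _ h1θ.le hθ.1.le, sub_add_cancel,
          ENNReal.rpow_one]

/-- Three lines theorem for the Morrey norm. -/
theorem WeakCalderon.morreyNorm_le (W : WeakCalderon H g₀ g₁) (hθ : θ ∈ Ioo (0 : ℝ) 1)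
    (hp₀ : 0 < p₀) (hp₁ : 0 < p₁) (hq' : 1 ≤ q)
    (hp : 1 / p = (1 - θ) / p₀ + θ / p₁) (hq : 1 / q = (1 - θ) / q₀ + θ / q₁)
    {A : ℝ≥0∞} (hA : A ≠ ∞) (h₀ : ∀ t, ‖g₀ t‖ₑ ≤ A) (h₁ : ∀ t, ‖g₁ t‖ₑ ≤ A) :
    morreyNorm n p q (H θ) ≤ A :=
  iSup₂_le fun _ hr => W.morreyM_le hθ hp₀ hp₁ hq' hp hq hA hr
    (fun t => (morreyM_le_morreyNorm _ hr).trans ((g₀ t).enorm_eq ▸ h₀ t))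
    (fun t => (morreyM_le_morreyNorm _ hr).trans ((g₁ t).enorm_eq ▸ h₁ t))

end WeakFamilies

/-! ### From the class `𝓕` to weakly holomorphic families -/

section FromCalderon

open Complex.HadamardThreeLines

section Couple

variable {X₀ X₁ Y₀ Y₁ Z : Type*} [NormedAddCommGroup X₀] [NormedSpace ℂ X₀]
  [NormedAddCommGroup X₁] [NormedSpace ℂ X₁] [NormedAddCommGroup Y₀] [NormedSpace ℂ Y₀]
  [NormedAddCommGroup Y₁] [NormedSpace ℂ Y₁] [AddCommGroup Z] [Module ℂ Z]

theorem CoupleSum.toAmbient_mk (ι₀ : X₀ →ₗ[ℂ] Z) (ι₁ : X₁ →ₗ[ℂ] Z) (x : WithLp 1 (X₀ × X₁)) :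
    CoupleSum.toAmbient ι₀ ι₁ (Submodule.Quotient.mk x) = ι₀ x.fst + ι₁ x.snd := rfl

/-- The continuous linear map induced on `X₀ + X₁` by two continuous linear maps on `X₀` and
`X₁` that agree on the intersection. -/
noncomputable def CoupleSum.lift {Y : Type*} [TopologicalSpace Y] [AddCommGroup Y] [Module ℂ Y]
    [ContinuousAdd Y] (ι₀ : X₀ →ₗ[ℂ] Z) (ι₁ : X₁ →ₗ[ℂ] Z)
    (L₀ : X₀ →L[ℂ] Y) (L₁ : X₁ →L[ℂ] Y)
    (h : ∀ a b, ι₀ a + ι₁ b = 0 → L₀ a + L₁ b = 0) : CoupleSum ι₀ ι₁ →L[ℂ] Y :=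
  (LinearMap.ker (coupleMap ι₀ ι₁)).liftQL
    (L₀ ∘L WithLp.fstL 1 ℂ X₀ X₁ + L₁ ∘L WithLp.sndL 1 ℂ X₀ X₁)
    fun x hx => h x.fst x.snd hx

/-- The map of sums of couples induced by continuous linear maps `Y₀ → X₀`, `Y₁ → X₁` that are
compatible with the maps to the ambient space. -/
noncomputable def CoupleSum.map {κ₀ : Y₀ →ₗ[ℂ] Z} {κ₁ : Y₁ →ₗ[ℂ] Z} (ι₀ : X₀ →ₗ[ℂ] Z)
    (ι₁ : X₁ →ₗ[ℂ] Z) (j₀ : Y₀ →L[ℂ] X₀) (j₁ : Y₁ →L[ℂ] X₁) (h₀ : ∀ y, ι₀ (j₀ y) = κ₀ y)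
    (h₁ : ∀ y, ι₁ (j₁ y) = κ₁ y) : CoupleSum κ₀ κ₁ →L[ℂ] CoupleSum ι₀ ι₁ :=
  Submodule.liftQL _
    ((LinearMap.ker (coupleMap ι₀ ι₁)).mkQL ∘L
      (WithLp.prodContinuousLinearEquiv 1 ℂ X₀ X₁).symm.toContinuousLinearMap ∘L
      (j₀.prodMap j₁) ∘L (WithLp.prodContinuousLinearEquiv 1 ℂ Y₀ Y₁).toContinuousLinearMap)
    fun x hx => (Submodule.Quotient.mk_eq_zero _).2 <| by
      change ι₀ (j₀ x.fst) + ι₁ (j₁ x.snd) = 0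
      rw [h₀, h₁]
      exact hx

theorem CoupleSum.toAmbient_map {κ₀ : Y₀ →ₗ[ℂ] Z} {κ₁ : Y₁ →ₗ[ℂ] Z} (ι₀ : X₀ →ₗ[ℂ] Z)
    (ι₁ : X₁ →ₗ[ℂ] Z) (j₀ : Y₀ →L[ℂ] X₀) (j₁ : Y₁ →L[ℂ] X₁) (h₀ : ∀ y, ι₀ (j₀ y) = κ₀ y)
    (h₁ : ∀ y, ι₁ (j₁ y) = κ₁ y) (x : CoupleSum κ₀ κ₁) :
    CoupleSum.toAmbient ι₀ ι₁ (CoupleSum.map ι₀ ι₁ j₀ j₁ h₀ h₁ x) =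
      CoupleSum.toAmbient κ₀ κ₁ x := by
  obtain ⟨x, rfl⟩ := Submodule.Quotient.mk_surjective _ x
  rw [CoupleSum.toAmbient_mk, ← h₀, ← h₁]
  rfl

/-- Composition with a continuous linear map preserves differentiability also for maps with values
in seminormed spaces, such as `X₀ + X₁` before its kernel is known to be closed. -/
theorem DifferentiableOn.continuousLinearMap_comp {F G : Type*} [TopologicalSpace F]
    [AddCommGroup F] [Module ℂ F] [TopologicalSpace G] [AddCommGroup G] [Module ℂ G]
    (L : F →L[ℂ] G) {f : ℂ → F} {s : Set ℂ} (hf : DifferentiableOn ℂ f s) :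
    DifferentiableOn ℂ (fun z => L (f z)) s := by
  intro z hz
  obtain ⟨f', hf'⟩ := hf z hz
  refine ⟨L ∘L f', ⟨?_⟩⟩
  refine ((L.isBigOTVS_fun_comp).trans_isLittleOTVS
    (HasFDerivAtFilter.isLittleOTVS hf')).congr_left fun x => ?_
  simp

theorem IsCalderon.map {κ₀ : Y₀ →ₗ[ℂ] Z} {κ₁ : Y₁ →ₗ[ℂ] Z} {ι₀ : X₀ →ₗ[ℂ] Z}
    {ι₁ : X₁ →ₗ[ℂ] Z} (j₀ : Y₀ →L[ℂ] X₀) (j₁ : Y₁ →L[ℂ] X₁) (h₀ : ∀ y, ι₀ (j₀ y) = κ₀ y)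
    (h₁ : ∀ y, ι₁ (j₁ y) = κ₁ y) {F : ℂ → CoupleSum κ₀ κ₁} (hF : IsCalderon κ₀ κ₁ F) :
    IsCalderon ι₀ ι₁ fun z => CoupleSum.map ι₀ ι₁ j₀ j₁ h₀ h₁ (F z) where
  bounded := by
    obtain ⟨C, hC⟩ := hF.bounded
    refine ⟨‖CoupleSum.map ι₀ ι₁ j₀ j₁ h₀ h₁‖ * C, fun z hz => ?_⟩
    refine ((CoupleSum.map ι₀ ι₁ j₀ j₁ h₀ h₁).le_opNorm _).trans ?_
    gcongr
    exact hC z hz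
  continuousOn := (CoupleSum.map ι₀ ι₁ j₀ j₁ h₀ h₁).continuous.comp_continuousOn hF.continuousOn
  holomorphic := hF.holomorphic.continuousLinearMap_comp _
  left := by
    obtain ⟨g, hg, ⟨C, hC⟩, h⟩ := hF.left
    refine ⟨fun t => j₀ (g t), by fun_prop, ⟨‖j₀‖ * C, fun t => ?_⟩, fun t => ?_⟩
    · refine (j₀.le_opNorm _).trans ?_
      gcongr
      exact hC t
    · rw [CoupleSum.toAmbient_map, h, h₀]
  right := by
    obtain ⟨g, hg, ⟨C, hC⟩, h⟩ := hF.right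
    refine ⟨fun t => j₁ (g t), by fun_prop, ⟨‖j₁‖ * C, fun t => ?_⟩, fun t => ?_⟩
    · refine (j₁.le_opNorm _).trans ?_
      gcongr
      exact hC t
    · rw [CoupleSum.toAmbient_map, h, h₁]

end Couple

variable {n : ℕ} {p q p₀ q₀ p₁ q₁ θ : ℝ} {hq : 1 ≤ q} {hq₀ : 1 ≤ q₀} {hq₁ : 1 ≤ q₁}

theorem setIntegral_measFun_add {S : Set (EuclideanSpace ℝ (Fin n))} {f g : MeasFun n}
    (hf : IntegrableOn f S) (hg : IntegrableOn g S) :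
    ∫ y in S, (f + g) y = (∫ y in S, f y) + ∫ y in S, g y := by
  rw [← integral_add hf hg]
  exact integral_congr_ae (ae_restrict_of_ae (measFun_coe_add f g))

theorem setIntegral_measFun_smul {S : Set (EuclideanSpace ℝ (Fin n))} (c : ℂ) (f : MeasFun n) :
    ∫ y in S, (c • f) y = c * ∫ y in S, f y := by
  rw [← integral_const_mul]
  exact integral_congr_ae (ae_restrict_of_ae (measFun_coe_smul c f))

/-- Integration over a bounded set as a continuous functional on the Morrey space. -/
noncomputable def MorreySpace.setIntegralCLM (hp : 0 < p) (hq : 1 ≤ q)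
    (S : Set (EuclideanSpace ℝ (Fin n))) (hS : Bornology.IsBounded S) :
    MorreySpace n p q hq →L[ℂ] ℂ :=
  LinearMap.mkContinuousOfExistsBound
    { toFun := fun f => ∫ y in S, MorreySpace.incl n p q hq f y
      map_add' := fun f g => by
        rw [map_add, setIntegral_measFun_add
          (integrableOn_of_mem_morreySet hp hq hS f.incl_mem)
          (integrableOn_of_mem_morreySet hp hq hS g.incl_mem)]
      map_smul' := fun c f => by
        rw [map_smul, setIntegral_measFun_smul]; rfl } <| by
    obtain ⟨R, hR, hSR⟩ := hS.subset_ball_lt 0 0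
    refine ⟨(localBound n p q R).toReal, fun f => ?_⟩
    have h := (enorm_integral_le_lintegral_enorm _).trans
      (lintegral_enorm_le_morreyNorm hp hq hR hSR
      (MorreySpace.incl n p q hq f).aestronglyMeasurable)
    have ht : localBound n p q R * morreyNorm n p q (MorreySpace.incl n p q hq f) ≠ ∞ :=
      ENNReal.mul_ne_top (localBound_ne_top hq hR) f.incl_mem.ne
    rw [MorreySpace.norm_def, ← ENNReal.toReal_mul, ← toReal_enorm]
    exact ENNReal.toReal_mono ht h

theorem MorreySpace.setIntegralCLM_apply (hp : 0 < p) (hq : 1 ≤ q)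
    (S : Set (EuclideanSpace ℝ (Fin n))) (hS : Bornology.IsBounded S) (f : MorreySpace n p q hq) :
    MorreySpace.setIntegralCLM hp hq S hS f = ∫ y in S, MorreySpace.incl n p q hq f y := rfl

theorem integrableOn_toAmbient (hp₀ : 0 < p₀) (hp₁ : 0 < p₁)
    {S : Set (EuclideanSpace ℝ (Fin n))} (hS : Bornology.IsBounded S)
    (x : CoupleSum (MorreySpace.incl n p₀ q₀ hq₀) (MorreySpace.incl n p₁ q₁ hq₁)) :
    IntegrableOn (CoupleSum.toAmbient (MorreySpace.incl n p₀ q₀ hq₀)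
      (MorreySpace.incl n p₁ q₁ hq₁) x : MeasFun n) S := by
  obtain ⟨x, rfl⟩ := Submodule.Quotient.mk_surjective _ x
  rw [CoupleSum.toAmbient_mk]
  exact ((integrableOn_of_mem_morreySet hp₀ hq₀ hS x.fst.incl_mem).add
    (integrableOn_of_mem_morreySet hp₁ hq₁ hS x.snd.incl_mem)).congr
    (ae_restrict_of_ae (measFun_coe_add _ _).symm)

/-- Integration over a bounded set as a continuous functional on `M^{p₀}_{q₀} + M^{p₁}_{q₁}`. -/
noncomputable def coupleIntegralCLM (hp₀ : 0 < p₀) (hp₁ : 0 < p₁) (hq₀ : 1 ≤ q₀) (hq₁ : 1 ≤ q₁)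
    (S : Set (EuclideanSpace ℝ (Fin n))) (hS : Bornology.IsBounded S) :
    CoupleSum (MorreySpace.incl n p₀ q₀ hq₀) (MorreySpace.incl n p₁ q₁ hq₁) →L[ℂ] ℂ :=
  CoupleSum.lift _ _ (MorreySpace.setIntegralCLM hp₀ hq₀ S hS)
    (MorreySpace.setIntegralCLM hp₁ hq₁ S hS) fun a b hab => by
      rw [MorreySpace.setIntegralCLM_apply, MorreySpace.setIntegralCLM_apply,
        ← setIntegral_measFun_add (integrableOn_of_mem_morreySet hp₀ hq₀ hS a.incl_mem)
          (integrableOn_of_mem_morreySet hp₁ hq₁ hS b.incl_mem), hab]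
      exact (integral_congr_ae (ae_restrict_of_ae measFun_coe_zero)).trans (by simp)

theorem coupleIntegralCLM_apply (hp₀ : 0 < p₀) (hp₁ : 0 < p₁)
    (S : Set (EuclideanSpace ℝ (Fin n))) (hS : Bornology.IsBounded S)
    (x : CoupleSum (MorreySpace.incl n p₀ q₀ hq₀) (MorreySpace.incl n p₁ q₁ hq₁)) :
    coupleIntegralCLM hp₀ hp₁ hq₀ hq₁ S hS x = ∫ y in S, CoupleSum.toAmbient _ _ x y := by
  obtain ⟨x, rfl⟩ := Submodule.Quotient.mk_surjective _ x
  rw [CoupleSum.toAmbient_mk, setIntegral_measFun_add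
    (integrableOn_of_mem_morreySet hp₀ hq₀ hS x.fst.incl_mem)
    (integrableOn_of_mem_morreySet hp₁ hq₁ hS x.snd.incl_mem)]
  rfl

/-- The factor `e^(z² - θ²)`: it equals `1` at `θ` and decays at infinity in the strip. -/
noncomputable def decayFactor (θ : ℝ) (z : ℂ) : ℂ := Complex.exp (z ^ 2 - θ ^ 2)

theorem norm_decayFactor_le {z : ℂ} (hz : z ∈ verticalClosedStrip 0 1) :
    ‖decayFactor θ z‖ ≤ Real.exp (1 - z.im ^ 2) := by
  have h : 0 ≤ z.re ∧ z.re ≤ 1 := hz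
  rw [decayFactor, Complex.norm_exp]
  refine Real.exp_le_exp.2 ?_
  have : (z ^ 2 - (θ : ℂ) ^ 2).re = z.re ^ 2 - z.im ^ 2 - θ ^ 2 := by
    simp [sq]
  rw [this]
  nlinarith [sq_nonneg θ]

theorem tendsto_decay_smul {X : Type*} [NormedAddCommGroup X] [NormedSpace ℂ X] {g : ℝ → X}
    {C : ℝ} (hC : ∀ t, ‖g t‖ ≤ C) {c : ℝ → ℂ} (hc : ∀ t, ‖c t‖ ≤ Real.exp (1 - t ^ 2)) :
    Tendsto (fun t => c t • g t) (cocompact ℝ) (𝓝 0) := by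
  have h2 : Tendsto (fun t : ℝ => Real.exp (1 - t ^ 2) * C) (cocompact ℝ) (𝓝 0) := by
    have : Tendsto (fun t : ℝ => 1 - t ^ 2) (cocompact ℝ) atBot := by
      have h3 : Tendsto (fun t : ℝ => ‖t‖ ^ 2) (cocompact ℝ) atTop :=
        (tendsto_pow_atTop two_ne_zero).comp (tendsto_norm_cocompact_atTop)
      have h4 := tendsto_atBot_add_const_left _ (1 : ℝ) (tendsto_neg_atTop_atBot.comp h3)
      refine h4.congr fun t => ?_
      simp [sub_eq_add_neg]
    simpa using (Real.tendsto_exp_atBot.comp this).mul_const C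
  refine squeeze_zero_norm (fun t => ?_) h2
  rw [norm_smul]
  exact mul_le_mul (hc t) (hC t) (norm_nonneg _) (Real.exp_pos _).le

theorem mem_closedStrip_left (t : ℝ) : (t * Complex.I : ℂ) ∈ verticalClosedStrip 0 1 := by
  simp [verticalClosedStrip]

theorem mem_closedStrip_right (t : ℝ) : (1 + t * Complex.I : ℂ) ∈ verticalClosedStrip 0 1 := by
  simp [verticalClosedStrip]

/-- Multiplication by `e^(z² - θ²)` turns a function of the class `𝓕` into a weakly holomorphic
family with the same value at `θ`, whose boundary values are multiples of the given ones. -/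
theorem IsCalderon.exists_weakCalderon (hp₀ : 0 < p₀) (hp₁ : 0 < p₁)
    {F : ℂ → CoupleSum (MorreySpace.incl n p₀ q₀ hq₀) (MorreySpace.incl n p₁ q₁ hq₁)}
    (hF : IsCalderon _ _ F) (θ : ℝ) :
    ∃ H : ℂ → MeasFun n, ∃ g₀ : ℝ → MorreySpace n p₀ q₀ hq₀, ∃ g₁ : ℝ → MorreySpace n p₁ q₁ hq₁,
      WeakCalderon H g₀ g₁ ∧ H θ = CoupleSum.toAmbient _ _ (F θ) ∧
      (∀ t : ℝ, ∃ c : ℂ, MorreySpace.incl n p₀ q₀ hq₀ (g₀ t) =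
        c • CoupleSum.toAmbient _ _ (F (t * Complex.I))) ∧
      ∀ t : ℝ, ∃ c : ℂ, MorreySpace.incl n p₁ q₁ hq₁ (g₁ t) =
        c • CoupleSum.toAmbient _ _ (F (1 + t * Complex.I)) := by
  obtain ⟨g₀, hg₀, ⟨C₀, hC₀⟩, h₀⟩ := hF.left
  obtain ⟨g₁, hg₁, ⟨C₁, hC₁⟩, h₁⟩ := hF.right
  have hdiff : Differentiable ℂ (decayFactor θ) := by unfold decayFactor; fun_prop
  have hcont : Continuous (decayFactor θ) := hdiff.continuous
  have hint : ∀ S (hS : Bornology.IsBounded S) z,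
      ∫ y in S, CoupleSum.toAmbient _ _ (decayFactor θ z • F z) y =
        decayFactor θ z * coupleIntegralCLM hp₀ hp₁ hq₀ hq₁ S hS (F z) := fun S hS z => by
    rw [← coupleIntegralCLM_apply hp₀ hp₁ S hS, map_smul, smul_eq_mul]
  refine ⟨fun z => CoupleSum.toAmbient _ _ (decayFactor θ z • F z),
    fun t => decayFactor θ (t * Complex.I) • g₀ t,
    fun t => decayFactor θ (1 + t * Complex.I) • g₁ t, ?_, ?_, ?_, ?_⟩
  · refine ⟨fun z _ S hS => integrableOn_toAmbient hp₀ hp₁ hS _, fun S _ hS => ?_,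
      fun S _ hS => ?_, fun t => ?_, fun t => ?_, ?_, ?_, ?_, ?_⟩
    · simp_rw [hint S hS]
      refine hdiff.diffContOnCl.smul ⟨?_, ?_⟩
      · exact hF.holomorphic.continuousLinearMap_comp _
      · rw [closure_verticalStrip]
        exact (coupleIntegralCLM hp₀ hp₁ hq₀ hq₁ S hS).continuous.comp_continuousOn hF.continuousOn
    · obtain ⟨C, hC⟩ := hF.bounded
      refine ⟨Real.exp 1 * (‖coupleIntegralCLM hp₀ hp₁ hq₀ hq₁ S hS‖ * C), fun z hz => ?_⟩
      rw [hint S hS, norm_mul]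
      refine mul_le_mul ((norm_decayFactor_le hz).trans ?_) ?_ (norm_nonneg _) (Real.exp_pos _).le
      · exact Real.exp_le_exp.2 (by nlinarith [sq_nonneg z.im])
      · refine ((coupleIntegralCLM hp₀ hp₁ hq₀ hq₁ S hS).le_opNorm _).trans ?_
        gcongr
        exact hC z hz
    · rw [map_smul, h₀, map_smul]
    · rw [map_smul, h₁, map_smul]
    · exact (hcont.comp (by fun_prop)).smul hg₀
    · exact (hcont.comp (by fun_prop)).smul hg₁
    · exact tendsto_decay_smul hC₀ fun t => by
        simpa using norm_decayFactor_le (θ := θ) (mem_closedStrip_left t)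
    · exact tendsto_decay_smul hC₁ fun t => by
        simpa using norm_decayFactor_le (θ := θ) (mem_closedStrip_right t)
  · simp [decayFactor]
  · exact fun t => ⟨_, by rw [map_smul, h₀]⟩
  · exact fun t => ⟨_, by rw [map_smul, h₁]⟩

theorem exists_weakCalderon_of_mem_interpMorrey (hp₀ : 0 < p₀) (hp₁ : 0 < p₁) {f : MeasFun n}
    (hf : f ∈ interpMorrey n p₀ q₀ p₁ q₁ hq₀ hq₁ θ) :
    ∃ H : ℂ → MeasFun n, ∃ g₀ : ℝ → MorreySpace n p₀ q₀ hq₀, ∃ g₁ : ℝ → MorreySpace n p₁ q₁ hq₁,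
      WeakCalderon H g₀ g₁ ∧ H θ = f := by
  obtain ⟨F, hF, rfl⟩ := hf
  obtain ⟨H, g₀, g₁, W, h, -, -⟩ := hF.exists_weakCalderon hp₀ hp₁ θ
  exact ⟨H, g₀, g₁, W, h⟩

theorem interpSub_subset_interpMorrey (W₀ : Submodule ℂ (MorreySpace n p₀ q₀ hq₀))
    (W₁ : Submodule ℂ (MorreySpace n p₁ q₁ hq₁)) :
    interpSub W₀ W₁ θ ⊆ interpMorrey n p₀ q₀ p₁ q₁ hq₀ hq₁ θ := by
  rintro f ⟨F, hF, rfl⟩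
  exact ⟨_, IsCalderon.map W₀.subtypeL W₁.subtypeL (fun _ => rfl) (fun _ => rfl) hF,
    CoupleSum.toAmbient_map _ _ _ _ _ _ _⟩

theorem exists_weakCalderon_of_mem_interpSub (hp₀ : 0 < p₀) (hp₁ : 0 < p₁)
    {W₀ : Submodule ℂ (MorreySpace n p₀ q₀ hq₀)} {W₁ : Submodule ℂ (MorreySpace n p₁ q₁ hq₁)}
    {f : MeasFun n} (hf : f ∈ interpSub W₀ W₁ θ) :
    ∃ H : ℂ → MeasFun n, ∃ g₀ : ℝ → MorreySpace n p₀ q₀ hq₀, ∃ g₁ : ℝ → MorreySpace n p₁ q₁ hq₁,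
      WeakCalderon H g₀ g₁ ∧ H θ = f ∧ (∀ t, g₀ t ∈ W₀) ∧ ∀ t, g₁ t ∈ W₁ := by
  obtain ⟨F, hF, rfl⟩ := hf
  obtain ⟨H, g₀, g₁, W, h, h₀, h₁⟩ :=
    (IsCalderon.map W₀.subtypeL W₁.subtypeL (fun _ => rfl) (fun _ => rfl)
      hF).exists_weakCalderon hp₀ hp₁ θ
  obtain ⟨k₀, -, -, hk₀⟩ := hF.left
  obtain ⟨k₁, -, -, hk₁⟩ := hF.right
  refine ⟨H, g₀, g₁, W, h.trans (CoupleSum.toAmbient_map _ _ _ _ _ _ _), fun t => ?_, fun t => ?_⟩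
  · obtain ⟨c, hc⟩ := h₀ t
    have : g₀ t = c • (k₀ t : MorreySpace n p₀ q₀ hq₀) := by
      apply MorreySpace.incl_injective
      exact (hc.trans (congrArg (c • ·)
        ((CoupleSum.toAmbient_map _ _ _ _ _ _ _).trans (hk₀ t)))).trans (map_smul _ _ _).symm
    rw [this]
    exact W₀.smul_mem _ (k₀ t).2
  · obtain ⟨c, hc⟩ := h₁ t
    have : g₁ t = c • (k₁ t : MorreySpace n p₁ q₁ hq₁) := by
      apply MorreySpace.incl_injective
      exact (hc.trans (congrArg (c • ·)
        ((CoupleSum.toAmbient_map _ _ _ _ _ _ _).trans (hk₁ t)))).trans (map_smul _ _ _).symm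
    rw [this]
    exact W₁.smul_mem _ (k₁ t).2

end FromCalderon

/-! ### Membership of interpolated functions in the vanishing subspaces -/

section Membership

variable {n : ℕ} {p q p₀ q₀ p₁ q₁ θ : ℝ} {hq₀ : 1 ≤ q₀} {hq₁ : 1 ≤ q₁}

/-- Seminorms that are equicontinuous and tend to zero at each point of a curve vanishing at
infinity tend to zero uniformly on the curve. -/
theorem eventually_forall_le_of_tendsto_zero {ι X : Type*} [NormedAddCommGroup X] {l : Filter ι}
    {ρ : ι → X → ℝ≥0∞} {C : ℝ≥0∞} (hC : C ≠ ∞) (hadd : ∀ i x y, ρ i (x + y) ≤ ρ i x + ρ i y)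
    (hle : ∀ᶠ i in l, ∀ x, ρ i x ≤ C * ‖x‖ₑ) {g : ℝ → X} (hg : Continuous g)
    (hg0 : Tendsto g (cocompact ℝ) (𝓝 0)) (hl : ∀ t, Tendsto (fun i => ρ i (g t)) l (𝓝 0))
    {ε : ℝ≥0∞} (hε : 0 < ε) : ∀ᶠ i in l, ∀ t, ρ i (g t) ≤ ε := by
  have hε2 : 0 < ε / 2 := ENNReal.half_pos hε.ne'
  have hsmall : ∀ᶠ x : X in 𝓝 0, C * ‖x‖ₑ < ε / 2 := by
    have : Tendsto (fun x : X => C * ‖x‖ₑ) (𝓝 0) (𝓝 (C * ‖(0 : X)‖ₑ)) :=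
      ENNReal.Tendsto.const_mul (continuous_enorm.tendsto 0) (Or.inr hC)
    rw [enorm_zero, mul_zero] at this
    exact this.eventually_lt_const hε2
  obtain ⟨K, hK, hKs⟩ := mem_cocompact.1 (hg0.eventually hsmall)
  have hcomp : ∀ᶠ i in l, ∀ t ∈ K, ρ i (g t) ≤ ε := by
    refine hK.induction_on (p := fun T => ∀ᶠ i in l, ∀ t ∈ T, ρ i (g t) ≤ ε) ?_ ?_ ?_ ?_
    · simp
    · exact fun s t hst h => h.mono fun i hi u hu => hi u (hst hu)
    · exact fun s t hs ht => (hs.and ht).mono fun i hi u hu => hu.elim (hi.1 u) (hi.2 u)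
    · intro t _
      have h1 : ∀ᶠ s in 𝓝 t, C * ‖g s - g t‖ₑ < ε / 2 := by
        have : Tendsto (fun s => g s - g t) (𝓝 t) (𝓝 0) := by
          simpa using (hg.tendsto t).sub_const (g t)
        exact this.eventually hsmall
      refine ⟨_, mem_nhdsWithin_of_mem_nhds h1, ?_⟩
      filter_upwards [hle, (hl t).eventually_lt_const hε2] with i hi1 hi2 s hs
      calc ρ i (g s) = ρ i ((g s - g t) + g t) := by rw [sub_add_cancel]
        _ ≤ ρ i (g s - g t) + ρ i (g t) := hadd _ _ _
        _ ≤ ε / 2 + ε / 2 := add_le_add ((hi1 _).trans (le_of_lt hs)) hi2.le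
        _ = ε := ENNReal.add_halves ε
  filter_upwards [hcomp, hle] with i h1 h2 t
  by_cases ht : t ∈ K
  · exact h1 t ht
  · exact (h2 _).trans ((le_of_lt (hKs ht)).trans ENNReal.half_le_self)

theorem exists_enorm_le_of_tendsto_cocompact {X : Type*} [NormedAddCommGroup X] {g : ℝ → X}
    (hg : Continuous g) (hg0 : Tendsto g (cocompact ℝ) (𝓝 0)) :
    ∃ C : ℝ, ∀ t, ‖g t‖ ≤ C := by
  obtain ⟨C, hC⟩ := (ZeroAtInftyContinuousMap.isBounded_range
    (⟨⟨g, hg⟩, hg0⟩ : ZeroAtInftyContinuousMap ℝ X)).exists_norm_le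
  exact ⟨C, fun t => hC _ ⟨t, rfl⟩⟩

theorem morreyM_incl_add_le {hq : 1 ≤ q} (f g : MorreySpace n p q hq) (r : ℝ) :
    morreyM n p q (MorreySpace.incl n p q hq (f + g)) r ≤
      morreyM n p q (MorreySpace.incl n p q hq f) r +
        morreyM n p q (MorreySpace.incl n p q hq g) r := by
  rw [map_add, morreyM_congr (measFun_coe_add _ _)]
  exact morreyM_add_le hq (AEEqFun.aestronglyMeasurable _) (AEEqFun.aestronglyMeasurable _) r

variable {H : ℂ → MeasFun n} {g₀ : ℝ → MorreySpace n p₀ q₀ hq₀} {g₁ : ℝ → MorreySpace n p₁ q₁ hq₁}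

theorem WeakCalderon.mem_morreySet (W : WeakCalderon H g₀ g₁) (hθ : θ ∈ Ioo (0 : ℝ) 1)
    (hp₀ : 0 < p₀) (hp₁ : 0 < p₁) (hq' : 1 ≤ q)
    (hp : 1 / p = (1 - θ) / p₀ + θ / p₁) (hq : 1 / q = (1 - θ) / q₀ + θ / q₁) :
    H θ ∈ morreySet n p q := by
  obtain ⟨C₀, hC₀⟩ := exists_enorm_le_of_tendsto_cocompact W.continuous_left W.zero_left
  obtain ⟨C₁, hC₁⟩ := exists_enorm_le_of_tendsto_cocompact W.continuous_right W.zero_right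
  refine (W.morreyNorm_le hθ hp₀ hp₁ hq' hp hq (A := ENNReal.ofReal (max C₀ C₁))
    ENNReal.ofReal_ne_top (fun t => ?_) fun t => ?_).trans_lt ENNReal.ofReal_lt_top
  · rw [← ofReal_norm]
    exact ENNReal.ofReal_le_ofReal ((hC₀ t).trans (le_max_left _ _))
  · rw [← ofReal_norm]
    exact ENNReal.ofReal_le_ofReal ((hC₁ t).trans (le_max_right _ _))

theorem WeakCalderon.mem_vanishingInftySet (W : WeakCalderon H g₀ g₁) (hθ : θ ∈ Ioo (0 : ℝ) 1)
    (hp₀ : 0 < p₀) (hp₁ : 0 < p₁) (hq' : 1 ≤ q)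
    (hp : 1 / p = (1 - θ) / p₀ + θ / p₁) (hq : 1 / q = (1 - θ) / q₀ + θ / q₁)
    (h₀ : ∀ t, g₀ t ∈ VanishingInfty n p₀ q₀ hq₀) (h₁ : ∀ t, g₁ t ∈ VanishingInfty n p₁ q₁ hq₁) :
    H θ ∈ vanishingInftySet n p q := by
  refine ⟨W.mem_morreySet hθ hp₀ hp₁ hq' hp hq, ENNReal.tendsto_nhds_zero.2 fun ε hε => ?_⟩
  have hε' : 0 < min ε 1 := lt_min hε one_pos
  have k₀ := eventually_forall_le_of_tendsto_zero (l := atTop)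
    (ρ := fun (r : ℝ) f => morreyM n p₀ q₀ (MorreySpace.incl n p₀ q₀ hq₀ f) r) ENNReal.one_ne_top
    (fun r f g => morreyM_incl_add_le f g r)
    (by
      filter_upwards [eventually_gt_atTop 0] with r hr f
      rw [one_mul, f.enorm_eq]
      exact morreyM_le_morreyNorm _ hr) W.continuous_left W.zero_left (fun t => (h₀ t).2) hε'
  have k₁ := eventually_forall_le_of_tendsto_zero (l := atTop)
    (ρ := fun (r : ℝ) f => morreyM n p₁ q₁ (MorreySpace.incl n p₁ q₁ hq₁ f) r) ENNReal.one_ne_top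
    (fun r f g => morreyM_incl_add_le f g r)
    (by
      filter_upwards [eventually_gt_atTop 0] with r hr f
      rw [one_mul, f.enorm_eq]
      exact morreyM_le_morreyNorm _ hr) W.continuous_right W.zero_right (fun t => (h₁ t).2) hε'
  filter_upwards [k₀, k₁, eventually_gt_atTop 0] with r hr₀ hr₁ hr
  exact (W.morreyM_le hθ hp₀ hp₁ hq' hp hq
    (ne_top_of_le_ne_top ENNReal.one_ne_top (min_le_right _ _)) hr hr₀ hr₁).trans (min_le_left _ _)

/-- The supremum over the unit balls of the `L^q` norms over their parts outside `B(0, N)`; its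
power with exponent `q` is `outerMass`. -/
noncomputable def outerNorm (n : ℕ) (q : ℝ) (f : EuclideanSpace ℝ (Fin n) → ℂ) (N : ℕ) : ℝ≥0∞ :=
  ⨆ x : EuclideanSpace ℝ (Fin n), lpOn q (Metric.ball x 1 ∩ (Metric.ball 0 N)ᶜ) f

theorem outerMass_eq_rpow (hq : 0 < q) (f : EuclideanSpace ℝ (Fin n) → ℂ) (N : ℕ) :
    outerMass n q f N = outerNorm n q f N ^ q := by
  unfold outerMass outerNorm
  have h := (ENNReal.orderIsoRpow q hq).map_iSup
    fun x : EuclideanSpace ℝ (Fin n) => lpOn q (Metric.ball x 1 ∩ (Metric.ball 0 N)ᶜ) f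
  simp only [ENNReal.orderIsoRpow_apply] at h
  rw [h]
  refine iSup_congr fun x => ?_
  rw [lpOn_rpow hq, setLIntegral_indicator Metric.isOpen_ball.measurableSet.compl, inter_comm]

theorem tendsto_outerMass_iff (hq : 0 < q) (f : EuclideanSpace ℝ (Fin n) → ℂ) :
    Tendsto (fun N : ℕ => outerMass n q f N) atTop (𝓝 0) ↔
      Tendsto (fun N : ℕ => outerNorm n q f N) atTop (𝓝 0) := by
  simp_rw [outerMass_eq_rpow hq]
  constructor
  · intro h
    have h2 := (ENNReal.continuous_rpow_const (y := 1 / q)).tendsto 0 |>.comp h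
    rw [ENNReal.zero_rpow_of_pos (by positivity)] at h2
    refine h2.congr fun N => ?_
    simp [← ENNReal.rpow_mul, mul_inv_cancel₀ hq.ne']
  · intro h
    have h2 := (ENNReal.continuous_rpow_const (y := q)).tendsto 0 |>.comp h
    rwa [ENNReal.zero_rpow_of_pos hq] at h2

theorem lpOn_add_le (hq : 1 ≤ q) {S : Set (EuclideanSpace ℝ (Fin n))}
    {f g : EuclideanSpace ℝ (Fin n) → ℂ} (hf : AEStronglyMeasurable f volume)
    (hg : AEStronglyMeasurable g volume) :
    lpOn q S (fun y => f y + g y) ≤ lpOn q S f + lpOn q S g := by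
  have h0 : 0 < q := by linarith
  refine le_trans ?_ (ENNReal.lintegral_Lp_add_le hf.restrict.enorm hg.restrict.enorm hq)
  unfold lpOn
  gcongr with y
  exact enorm_add_le _ _

theorem outerNorm_incl_add_le {hq : 1 ≤ q} (f g : MorreySpace n p q hq) (N : ℕ) :
    outerNorm n q (MorreySpace.incl n p q hq (f + g)) N ≤
      outerNorm n q (MorreySpace.incl n p q hq f) N +
        outerNorm n q (MorreySpace.incl n p q hq g) N := by
  refine iSup_le fun x => ?_
  rw [map_add, lpOn_congr (measFun_coe_add _ _)]
  refine (lpOn_add_le hq (AEEqFun.aestronglyMeasurable _) (AEEqFun.aestronglyMeasurable _)).trans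
    (add_le_add ?_ ?_)
  · exact le_iSup (fun x => lpOn q (Metric.ball x 1 ∩ (Metric.ball 0 (N : ℝ))ᶜ)
      (MorreySpace.incl n p q hq f)) x
  · exact le_iSup (fun x => lpOn q (Metric.ball x 1 ∩ (Metric.ball 0 (N : ℝ))ᶜ)
      (MorreySpace.incl n p q hq g)) x

theorem outerNorm_le (hp : 0 < p) {hq : 1 ≤ q} (f : MorreySpace n p q hq) (N : ℕ) :
    outerNorm n q (MorreySpace.incl n p q hq f) N ≤
      (ballWeight p q (0 : EuclideanSpace ℝ (Fin n)) 1)⁻¹ * ‖f‖ₑ := by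
  have h0 : 0 < q := by linarith
  refine iSup_le fun x => (lpOn_mono_set h0 inter_subset_left _).trans
    ((lpOn_ball_le hp h0 _ x one_pos).trans ?_)
  have : ballWeight p q x 1 = ballWeight p q (0 : EuclideanSpace ℝ (Fin n)) 1 := by
    unfold ballWeight
    rw [Measure.addHaar_ball_center volume x]
  rw [this, f.enorm_eq]
  gcongr
  exact morreyM_le_morreyNorm _ one_pos

theorem WeakCalderon.mem_vanishingStarSet (W : WeakCalderon H g₀ g₁) (hθ : θ ∈ Ioo (0 : ℝ) 1)
    (hp₀ : 0 < p₀) (hp₁ : 0 < p₁) (hq' : 1 ≤ q)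
    (hp : 1 / p = (1 - θ) / p₀ + θ / p₁) (hq : 1 / q = (1 - θ) / q₀ + θ / q₁)
    (h₀ : ∀ t, g₀ t ∈ VanishingStar n p₀ q₀ hq₀) (h₁ : ∀ t, g₁ t ∈ VanishingStar n p₁ q₁ hq₁) :
    H θ ∈ vanishingStarSet n p q := by
  have hq0 : 0 < q := by linarith
  have hq00 : 0 < q₀ := by linarith
  have hq10 : 0 < q₁ := by linarith
  have h1θ : 0 < 1 - θ := by linarith [hθ.2]
  refine ⟨W.mem_morreySet hθ hp₀ hp₁ hq' hp hq, (tendsto_outerMass_iff hq0 _).2 ?_⟩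
  refine ENNReal.tendsto_nhds_zero.2 fun ε hε => ?_
  have hε' : 0 < min ε 1 := lt_min hε one_pos
  have hεt : min ε 1 ≠ ∞ := ne_top_of_le_ne_top ENNReal.one_ne_top (min_le_right _ _)
  have k₀ := eventually_forall_le_of_tendsto_zero (l := atTop)
    (ρ := fun (N : ℕ) f => outerNorm n q₀ (MorreySpace.incl n p₀ q₀ hq₀ f) N)
    (ENNReal.inv_ne_top.2 (ballWeight_ne_zero p₀ q₀ 0 one_pos))
    (fun N f g => outerNorm_incl_add_le f g N)
    (Eventually.of_forall fun N f => outerNorm_le hp₀ f N) W.continuous_left W.zero_left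
    (fun t => (tendsto_outerMass_iff hq00 _).1 (h₀ t).2) hε'
  have k₁ := eventually_forall_le_of_tendsto_zero (l := atTop)
    (ρ := fun (N : ℕ) f => outerNorm n q₁ (MorreySpace.incl n p₁ q₁ hq₁ f) N)
    (ENNReal.inv_ne_top.2 (ballWeight_ne_zero p₁ q₁ 0 one_pos))
    (fun N f g => outerNorm_incl_add_le f g N)
    (Eventually.of_forall fun N f => outerNorm_le hp₁ f N) W.continuous_right W.zero_right
    (fun t => (tendsto_outerMass_iff hq10 _).1 (h₁ t).2) hε'
  filter_upwards [k₀, k₁] with N hN₀ hN₁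
  refine iSup_le fun x => ?_
  refine (W.lpOn_le hθ hq' hq (measurableSet_ball.inter measurableSet_ball.compl)
    (Metric.isBounded_ball.subset inter_subset_left) hεt hεt
    (fun t => (le_iSup _ x).trans (hN₀ t)) (fun t => (le_iSup _ x).trans (hN₁ t))).trans ?_
  rw [← ENNReal.rpow_add_of_nonneg _ _ h1θ.le hθ.1.le, sub_add_cancel, ENNReal.rpow_one]
  exact min_le_left _ _

end Membership

/-! ### Density of the intersection of the couple -/

section Density

open Complex.HadamardThreeLines

/-- Cauchy's theorem for a strip: the integral over vertical lines of a function with Gaussian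
decay does not depend on the line. -/
theorem integral_vertical_line_eq {Ξ : ℂ → ℂ} (hΞ : DiffContOnCl ℂ Ξ (verticalStrip 0 1)) {K b : ℝ}
    (hb : 0 < b)
    (hK : ∀ z ∈ verticalClosedStrip 0 1, ‖Ξ z‖ ≤ K * Real.exp (-b * z.im ^ 2)) {s s' : ℝ}
    (hs : s ∈ Icc (0 : ℝ) 1) (hs' : s' ∈ Icc (0 : ℝ) 1) :
    ∫ τ : ℝ, Ξ (s + τ * Complex.I) = ∫ τ : ℝ, Ξ (s' + τ * Complex.I) := by
  have hcont : ContinuousOn Ξ (verticalClosedStrip 0 1) := closure_verticalStrip ▸ hΞ.continuousOn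
  have hline : ∀ u ∈ Icc (0 : ℝ) 1, Integrable fun τ : ℝ => Ξ (u + τ * Complex.I) := fun u hu => by
    have hmem : ∀ τ : ℝ, (u + τ * Complex.I : ℂ) ∈ verticalClosedStrip 0 1 := fun τ => by
      simpa [verticalClosedStrip] using hu
    refine Integrable.mono' ((integrable_exp_neg_mul_sq hb).const_mul K) ?_
      (ae_of_all _ fun τ => by simpa using hK _ (hmem τ))
    exact (hcont.comp_continuous (by fun_prop) hmem).aestronglyMeasurable
  have hlim : ∀ u ∈ Icc (0 : ℝ) 1, Tendsto
      (fun T : ℝ => ∫ τ in (-T)..T, Ξ (u + τ * Complex.I)) atTop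
      (𝓝 (∫ τ : ℝ, Ξ (u + τ * Complex.I))) := fun u hu =>
    intervalIntegral_tendsto_integral (hline u hu) tendsto_neg_atTop_atBot tendsto_id
  have hIcc : uIcc s s' ⊆ Icc (0 : ℝ) 1 := uIcc_subset_Icc hs hs'
  have hhor : ∀ σ : ℝ → ℝ, (∀ T, σ T ^ 2 = T ^ 2) →
      Tendsto (fun T : ℝ => ∫ x in s..s', Ξ (x + σ T * Complex.I)) atTop (𝓝 0) := fun σ hσ => by
    have hz : Tendsto (fun T : ℝ => K * Real.exp (-b * T ^ 2) * |s' - s|) atTop (𝓝 0) := by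
      have h1 : Tendsto (fun T : ℝ => -b * T ^ 2) atTop atBot :=
        (tendsto_pow_atTop two_ne_zero).const_mul_atTop_of_neg (by linarith)
      simpa using ((Real.tendsto_exp_atBot.comp h1).const_mul K).mul_const |s' - s|
    refine squeeze_zero_norm (fun T => ?_) hz
    refine intervalIntegral.norm_integral_le_of_norm_le_const fun x hx => ?_
    have hx' := hIcc (uIoc_subset_uIcc hx)
    have := hK (x + σ T * Complex.I) (by simpa [verticalClosedStrip] using hx')
    simpa [hσ] using this
  have hrect : ∀ T : ℝ, (∫ x in s..s', Ξ (x + (-T : ℝ) * Complex.I)) -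
      (∫ x in s..s', Ξ (x + (T : ℝ) * Complex.I)) +
      Complex.I • (∫ τ in (-T)..T, Ξ (s' + τ * Complex.I)) -
      Complex.I • (∫ τ in (-T)..T, Ξ (s + τ * Complex.I)) = 0 := fun T => by
    have := Complex.integral_boundary_rect_eq_zero_of_continuousOn_of_differentiableOn Ξ
      (s + (-T : ℝ) * Complex.I) (s' + (T : ℝ) * Complex.I) ?_ ?_
    · simpa using this
    · refine hcont.mono fun z hz => ?_
      have := hz.1
      simp only [Complex.add_re, Complex.ofReal_re, Complex.mul_re, Complex.I_re, mul_zero,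
        Complex.ofReal_im, Complex.I_im, mul_one, sub_self, add_zero] at this
      exact hIcc this
    · refine hΞ.differentiableOn.mono fun z hz => ?_
      have := hz.1
      simp only [Complex.add_re, Complex.ofReal_re, Complex.mul_re, Complex.I_re, mul_zero,
        Complex.ofReal_im, Complex.I_im, mul_one, sub_self, add_zero] at this
      exact ⟨(le_min hs.1 hs'.1).trans_lt this.1, this.2.trans_le (max_le hs.2 hs'.2)⟩
  have hl := (((hhor (fun T => -T) fun T => by ring).sub (hhor (fun T => T) fun T => rfl)).add
    ((hlim s' hs').const_smul Complex.I)).sub ((hlim s hs).const_smul Complex.I)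
  have h0 := tendsto_nhds_unique (hl.congr hrect) tendsto_const_nhds
  simp only [sub_self, zero_add, smul_eq_mul] at h0
  rw [← mul_sub, mul_eq_zero, or_iff_right Complex.I_ne_zero, sub_eq_zero] at h0
  exact h0.symm

/-- The entire function `√(b/π) e^(b w²)`, whose restriction to the imaginary axis is a Gaussian
probability density. -/
noncomputable def gaussKernel (b : ℝ) (w : ℂ) : ℂ := (√(b / Real.pi) : ℝ) * Complex.exp (b * w ^ 2)

theorem differentiable_gaussKernel (b : ℝ) : Differentiable ℂ (gaussKernel b) := by
  unfold gaussKernel; fun_prop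

theorem norm_gaussKernel (b : ℝ) (w : ℂ) :
    ‖gaussKernel b w‖ = √(b / Real.pi) * Real.exp (b * (w.re ^ 2 - w.im ^ 2)) := by
  rw [gaussKernel, norm_mul, Complex.norm_real, Real.norm_of_nonneg (Real.sqrt_nonneg _),
    Complex.norm_exp]
  simp [sq]

theorem gaussKernel_mul_I (b τ : ℝ) :
    gaussKernel b (τ * Complex.I) = (√(b / Real.pi) * Real.exp (-b * τ ^ 2) : ℝ) := by
  rw [gaussKernel, mul_pow, Complex.I_sq]
  push_cast
  ring_nf

theorem integral_sqrt_mul_gaussian {b : ℝ} (hb : 0 < b) :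
    ∫ τ : ℝ, √(b / Real.pi) * Real.exp (-b * τ ^ 2) = 1 := by
  rw [integral_const_mul, integral_gaussian, ← Real.sqrt_mul (by positivity)]
  have := Real.pi_pos
  rw [show b / Real.pi * (Real.pi / b) = 1 by field_simp, Real.sqrt_one]

theorem integral_gaussKernel {b : ℝ} (hb : 0 < b) :
    ∫ τ : ℝ, gaussKernel b (τ * Complex.I) = 1 := by
  simp_rw [gaussKernel_mul_I]
  rw [integral_complex_ofReal, integral_sqrt_mul_gaussian hb, Complex.ofReal_one]

variable {n : ℕ} {p q p₀ q₀ p₁ q₁ θ : ℝ} {hq₀ : 1 ≤ q₀} {hq₁ : 1 ≤ q₁}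
  {H : ℂ → MeasFun n} {g₀ : ℝ → MorreySpace n p₀ q₀ hq₀} {g₁ : ℝ → MorreySpace n p₁ q₁ hq₁}

theorem norm_gaussKernel_sub_le {b : ℝ} (hb : 0 < b) (hθ : θ ∈ Ioo (0 : ℝ) 1) {z : ℂ}
    (hz : z ∈ verticalClosedStrip 0 1) :
    ‖gaussKernel b (z - θ)‖ ≤ √(b / Real.pi) * Real.exp b * Real.exp (-b * z.im ^ 2) := by
  have h : 0 ≤ z.re ∧ z.re ≤ 1 := hz
  rw [norm_gaussKernel, mul_assoc, ← Real.exp_add]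
  gcongr
  simp only [Complex.sub_re, Complex.ofReal_re, Complex.sub_im, Complex.ofReal_im, sub_zero]
  have : (z.re - θ) ^ 2 ≤ 1 := by
    rw [sq_le_one_iff_abs_le_one, abs_le]
    constructor <;> linarith [hθ.1, hθ.2, h.1, h.2]
  nlinarith

theorem WeakCalderon.integral_gaussKernel_eq (W : WeakCalderon H g₀ g₁) {b : ℝ} (hb : 0 < b)
    (hθ : θ ∈ Ioo (0 : ℝ) 1) {S : Set (EuclideanSpace ℝ (Fin n))} (hS : MeasurableSet S)
    (hSb : Bornology.IsBounded S) {s : ℝ} (hs : s ∈ Icc (0 : ℝ) 1) :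
    ∫ τ : ℝ, gaussKernel b (s + τ * Complex.I - θ) * ∫ y in S, H (s + τ * Complex.I) y =
      ∫ τ : ℝ, gaussKernel b (τ * Complex.I) * ∫ y in S, H (θ + τ * Complex.I) y := by
  obtain ⟨C, hC⟩ := W.bounded S hS hSb
  have hC0 : 0 ≤ C := (norm_nonneg _).trans (hC _ (mem_closedStrip_left 0))
  have h := integral_vertical_line_eq (K := √(b / Real.pi) * Real.exp b * C)
    (Ξ := fun z => gaussKernel b (z - θ) * ∫ y in S, H z y)
    (((differentiable_gaussKernel b).comp (differentiable_id.sub_const _)).diffContOnCl.smul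
      (W.diffContOnCl S hS hSb)) hb (fun z hz => ?_) hs ⟨hθ.1.le, hθ.2.le⟩
  · simpa using h
  · rw [norm_mul]
    calc _ ≤ (√(b / Real.pi) * Real.exp b * Real.exp (-b * z.im ^ 2)) * C := by
          gcongr
          · exact norm_gaussKernel_sub_le hb hθ hz
          · exact hC z hz
      _ = _ := by ring

theorem ae_eq_of_forall_setIntegral_eq {f g : MeasFun n}
    (hf : ∀ S : Set (EuclideanSpace ℝ (Fin n)), Bornology.IsBounded S → IntegrableOn f S)
    (hg : ∀ S : Set (EuclideanSpace ℝ (Fin n)), Bornology.IsBounded S → IntegrableOn g S)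
    (h : ∀ S : Set (EuclideanSpace ℝ (Fin n)), MeasurableSet S → Bornology.IsBounded S →
      ∫ y in S, f y = ∫ y in S, g y) : f = g := by
  refine AEEqFun.ext (ae_of_forall_ae_restrict_ball fun k => ?_)
  refine Integrable.ae_eq_of_forall_setIntegral_eq _ _ (hf _ Metric.isBounded_ball)
    (hg _ Metric.isBounded_ball) fun s hs _ => ?_
  rw [Measure.restrict_restrict hs]
  exact h _ (hs.inter measurableSet_ball) (Metric.isBounded_ball.subset inter_subset_right)

/-- The integral of a vector-valued boundary function against a Gaussian kernel, as an element of
the Morrey space, is determined by integrals over bounded sets. -/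
theorem setIntegral_integral_smul (hp : 0 < p) {hq : 1 ≤ q} {g : ℝ → MorreySpace n p q hq}
    (hg : Continuous g) {C : ℝ} (hC : ∀ t, ‖g t‖ ≤ C) {c : ℝ → ℂ} (hc : Continuous c) {K b : ℝ}
    (hb : 0 < b) (hK : ∀ t, ‖c t‖ ≤ K * Real.exp (-b * t ^ 2))
    {S : Set (EuclideanSpace ℝ (Fin n))} (hS : Bornology.IsBounded S) :
    ∫ y in S, MorreySpace.incl n p q hq (∫ t, c t • g t) y =
      ∫ t, c t * ∫ y in S, MorreySpace.incl n p q hq (g t) y := by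
  have := MorreySpace.completeSpace (n := n) hp hq
  have hi : Integrable fun t => c t • g t := by
    refine Integrable.mono' (((integrable_exp_neg_mul_sq hb).const_mul K).mul_const C)
      (hc.smul hg).aestronglyMeasurable (ae_of_all _ fun t => ?_)
    rw [norm_smul]
    exact mul_le_mul (hK t) (hC t) (norm_nonneg _) ((norm_nonneg _).trans (hK t))
  rw [← MorreySpace.setIntegralCLM_apply hp hq S hS, ← ContinuousLinearMap.integral_comp_comm _ hi]
  simp_rw [map_smul, MorreySpace.setIntegralCLM_apply, smul_eq_mul]

/-- The Gaussian average of the family along the line through `θ` belongs to both spaces of the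
couple: the contour can be moved to either boundary line, where the boundary values may be
integrated in the Banach space. -/
theorem WeakCalderon.exists_gaussian_average (W : WeakCalderon H g₀ g₁) (hp₀ : 0 < p₀)
    (hp₁ : 0 < p₁) (hθ : θ ∈ Ioo (0 : ℝ) 1) {b : ℝ} (hb : 0 < b) :
    ∃ h : MeasFun n, h ∈ morreySet n p₀ q₀ ∧ h ∈ morreySet n p₁ q₁ ∧
      ∀ S : Set (EuclideanSpace ℝ (Fin n)), MeasurableSet S → Bornology.IsBounded S →
        ∫ y in S, h y =
          ∫ τ : ℝ, gaussKernel b (τ * Complex.I) * ∫ y in S, H (θ + τ * Complex.I) y := by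
  obtain ⟨C₀, hC₀⟩ := exists_enorm_le_of_tendsto_cocompact W.continuous_left W.zero_left
  obtain ⟨C₁, hC₁⟩ := exists_enorm_le_of_tendsto_cocompact W.continuous_right W.zero_right
  have hcont := (differentiable_gaussKernel b).continuous
  set h₀ : MorreySpace n p₀ q₀ hq₀ := ∫ τ : ℝ, gaussKernel b (τ * Complex.I - θ) • g₀ τ with hh₀
  set h₁ : MorreySpace n p₁ q₁ hq₁ := ∫ τ : ℝ, gaussKernel b (1 + τ * Complex.I - θ) • g₁ τ with hh₁
  have e₀ : ∀ S : Set (EuclideanSpace ℝ (Fin n)), MeasurableSet S → Bornology.IsBounded S →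
      ∫ y in S, MorreySpace.incl n p₀ q₀ hq₀ h₀ y =
        ∫ τ : ℝ, gaussKernel b (τ * Complex.I) * ∫ y in S, H (θ + τ * Complex.I) y := by
    intro S hS hSb
    rw [hh₀, setIntegral_integral_smul hp₀ W.continuous_left hC₀ (by fun_prop) hb
      (fun t => by simpa using norm_gaussKernel_sub_le hb hθ (mem_closedStrip_left t)) hSb,
      ← W.integral_gaussKernel_eq hb hθ hS hSb (left_mem_Icc.2 zero_le_one)]
    refine integral_congr_ae (ae_of_all _ fun τ => ?_)
    simp only [Complex.ofReal_zero, zero_add, W.left]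
  have e₁ : ∀ S : Set (EuclideanSpace ℝ (Fin n)), MeasurableSet S → Bornology.IsBounded S →
      ∫ y in S, MorreySpace.incl n p₁ q₁ hq₁ h₁ y =
        ∫ τ : ℝ, gaussKernel b (τ * Complex.I) * ∫ y in S, H (θ + τ * Complex.I) y := by
    intro S hS hSb
    rw [hh₁, setIntegral_integral_smul hp₁ W.continuous_right hC₁ (by fun_prop) hb
      (fun t => by simpa using norm_gaussKernel_sub_le hb hθ (mem_closedStrip_right t)) hSb,
      ← W.integral_gaussKernel_eq hb hθ hS hSb (right_mem_Icc.2 zero_le_one)]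
    refine integral_congr_ae (ae_of_all _ fun τ => ?_)
    simp only [Complex.ofReal_one, W.right]
  have heq : MorreySpace.incl n p₀ q₀ hq₀ h₀ = MorreySpace.incl n p₁ q₁ hq₁ h₁ :=
    ae_eq_of_forall_setIntegral_eq
      (fun S hS => integrableOn_of_mem_morreySet hp₀ hq₀ hS h₀.incl_mem)
      (fun S hS => integrableOn_of_mem_morreySet hp₁ hq₁ hS h₁.incl_mem)
      (fun S hS hSb => (e₀ S hS hSb).trans (e₁ S hS hSb).symm)
  exact ⟨MorreySpace.incl n p₀ q₀ hq₀ h₀, h₀.incl_mem, heq ▸ h₁.incl_mem, e₀⟩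

theorem setIntegral_measFun_sub {S : Set (EuclideanSpace ℝ (Fin n))} {f g : MeasFun n}
    (hf : IntegrableOn f S) (hg : IntegrableOn g S) :
    ∫ y in S, (f - g) y = (∫ y in S, f y) - ∫ y in S, g y := by
  rw [← integral_sub hf hg]
  exact integral_congr_ae (ae_restrict_of_ae (measFun_coe_sub f g))

theorem integrableOn_measFun_sub {S : Set (EuclideanSpace ℝ (Fin n))} {f g : MeasFun n}
    (hf : IntegrableOn f S) (hg : IntegrableOn g S) : IntegrableOn (f - g : MeasFun n) S :=
  (hf.sub hg).congr (ae_restrict_of_ae (measFun_coe_sub f g).symm)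

/-- The difference of a weakly holomorphic family and its vertical translate is again such a
family. -/
theorem WeakCalderon.sub_shift (W : WeakCalderon H g₀ g₁) (τ : ℝ) :
    WeakCalderon (fun z => H z - H (z + τ * Complex.I)) (fun t => g₀ t - g₀ (t + τ))
      (fun t => g₁ t - g₁ (t + τ)) := by
  have hmem : ∀ z ∈ verticalClosedStrip 0 1, z + τ * Complex.I ∈ verticalClosedStrip 0 1 :=
    fun z hz => by
      have : 0 ≤ z.re ∧ z.re ≤ 1 := hz
      simpa [verticalClosedStrip] using this
  have hmem' : MapsTo (fun z : ℂ => z + τ * Complex.I) (verticalStrip 0 1) (verticalStrip 0 1) :=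
    fun z hz => by
      have : 0 < z.re ∧ z.re < 1 := hz
      simpa [verticalStrip] using this
  have hint : ∀ S : Set (EuclideanSpace ℝ (Fin n)), Bornology.IsBounded S →
      ∀ z ∈ verticalClosedStrip 0 1, ∫ y in S, (H z - H (z + τ * Complex.I) : MeasFun n) y =
        (∫ y in S, H z y) - ∫ y in S, H (z + τ * Complex.I) y := fun S hS z hz =>
    setIntegral_measFun_sub (W.integrableOn z hz S hS) (W.integrableOn _ (hmem z hz) S hS)
  have hshift : Tendsto (fun t : ℝ => t + τ) (cocompact ℝ) (cocompact ℝ) :=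
    (Homeomorph.addRight τ).isClosedEmbedding.tendsto_cocompact
  refine ⟨fun z hz S hS => integrableOn_measFun_sub (W.integrableOn z hz S hS)
    (W.integrableOn _ (hmem z hz) S hS), fun S hS hSb => ?_, fun S hS hSb => ?_, fun t => ?_,
    fun t => ?_, W.continuous_left.sub (W.continuous_left.comp (by fun_prop)),
    W.continuous_right.sub (W.continuous_right.comp (by fun_prop)), ?_, ?_⟩
  · have hd := W.diffContOnCl S hS hSb
    have hd2 : DiffContOnCl ℂ (fun z => ∫ y in S, H (z + τ * Complex.I) y) (verticalStrip 0 1) :=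
      hd.comp (differentiable_id.add_const _).diffContOnCl hmem'
    have hd3 := hd.sub hd2
    exact ⟨hd3.differentiableOn.congr fun z hz =>
        hint S hSb z (closure_verticalStrip ▸ subset_closure hz),
      hd3.continuousOn.congr fun z hz => hint S hSb z (closure_verticalStrip ▸ hz)⟩
  · obtain ⟨C, hC⟩ := W.bounded S hS hSb
    refine ⟨C + C, fun z hz => ?_⟩
    rw [hint S hSb z hz]
    exact (norm_sub_le _ _).trans (add_le_add (hC z hz) (hC _ (hmem z hz)))
  · rw [map_sub, ← W.left, ← W.left]
    congr 2
    push_cast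
    ring
  · rw [map_sub, ← W.right, ← W.right]
    congr 2
    push_cast
    ring
  · simpa using W.zero_left.sub (W.zero_left.comp hshift)
  · simpa using W.zero_right.sub (W.zero_right.comp hshift)

theorem WeakCalderon.setIntegral_sub_average (W : WeakCalderon H g₀ g₁) (hθ : θ ∈ Ioo (0 : ℝ) 1)
    {b : ℝ} (hb : 0 < b) {h : MeasFun n}
    (hi : ∀ S : Set (EuclideanSpace ℝ (Fin n)), Bornology.IsBounded S → IntegrableOn h S)
    (hh : ∀ S : Set (EuclideanSpace ℝ (Fin n)), MeasurableSet S → Bornology.IsBounded S →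
        ∫ y in S, h y =
          ∫ τ : ℝ, gaussKernel b (τ * Complex.I) * ∫ y in S, H (θ + τ * Complex.I) y)
    {S : Set (EuclideanSpace ℝ (Fin n))} (hS : MeasurableSet S) (hSb : Bornology.IsBounded S) :
    Integrable (fun τ : ℝ => gaussKernel b (τ * Complex.I) *
      ∫ y in S, (H θ - H (θ + τ * Complex.I) : MeasFun n) y) ∧
    ∫ y in S, (H θ - h : MeasFun n) y = ∫ τ : ℝ, gaussKernel b (τ * Complex.I) *
      ∫ y in S, (H θ - H (θ + τ * Complex.I) : MeasFun n) y := by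
  have hmem : ∀ τ : ℝ, (θ + τ * Complex.I : ℂ) ∈ verticalClosedStrip 0 1 := fun τ => by
    simpa [verticalClosedStrip] using ⟨hθ.1.le, hθ.2.le⟩
  have hθs : (θ : ℂ) ∈ verticalClosedStrip 0 1 := by simpa using hmem 0
  have hk : Integrable fun τ : ℝ => gaussKernel b (τ * Complex.I) := by
    simp_rw [gaussKernel_mul_I]
    exact ((integrable_exp_neg_mul_sq hb).const_mul _).ofReal
  have hint : ∀ τ : ℝ, ∫ y in S, (H θ - H (θ + τ * Complex.I) : MeasFun n) y =
      (∫ y in S, H θ y) - ∫ y in S, H (θ + τ * Complex.I) y := fun τ =>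
    setIntegral_measFun_sub (W.integrableOn _ hθs S hSb) (W.integrableOn _ (hmem τ) S hSb)
  obtain ⟨C, hC⟩ := W.bounded S hS hSb
  have hcont : Continuous fun τ : ℝ => ∫ y in S, H (θ + τ * Complex.I) y :=
    (closure_verticalStrip ▸ (W.diffContOnCl S hS hSb).continuousOn).comp_continuous
      (by fun_prop) hmem
  have i1 : Integrable fun τ : ℝ => gaussKernel b (τ * Complex.I) * ∫ y in S, H θ y :=
    hk.mul_const _
  have i2 : Integrable fun τ : ℝ =>
      gaussKernel b (τ * Complex.I) * ∫ y in S, H (θ + τ * Complex.I) y :=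
    hk.mul_bdd hcont.aestronglyMeasurable (ae_of_all _ fun τ => hC _ (hmem τ))
  simp_rw [hint, mul_sub]
  refine ⟨i1.sub i2, ?_⟩
  rw [integral_sub i1 i2, integral_mul_const, integral_gaussKernel hb, one_mul, ← hh S hS hSb,
    setIntegral_measFun_sub (W.integrableOn _ hθs S hSb) (hi S hSb)]

/-- Minkowski's inequality in dual form: the distance of `H θ` from its Gaussian average is at most
the average of the distances from the translates. -/
theorem WeakCalderon.morreyNorm_sub_average_le (W : WeakCalderon H g₀ g₁)
    (hθ : θ ∈ Ioo (0 : ℝ) 1) (hp' : 0 < p) (hq' : 1 ≤ q) {b : ℝ} (hb : 0 < b) {h : MeasFun n}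
    (hi : ∀ S : Set (EuclideanSpace ℝ (Fin n)), Bornology.IsBounded S → IntegrableOn h S)
    (hh : ∀ S : Set (EuclideanSpace ℝ (Fin n)), MeasurableSet S → Bornology.IsBounded S →
        ∫ y in S, h y =
          ∫ τ : ℝ, gaussKernel b (τ * Complex.I) * ∫ y in S, H (θ + τ * Complex.I) y)
    {ω : ℝ → ℝ≥0∞}
    (hω : ∀ τ : ℝ, morreyNorm n p q (H θ - H (θ + τ * Complex.I) : MeasFun n) ≤ ω τ) :
    morreyNorm n p q (H θ - h : MeasFun n) ≤
      ∫⁻ τ : ℝ, ‖gaussKernel b (τ * Complex.I)‖ₑ * ω τ := by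
  have hq0 : 0 < q := by linarith
  have hmem : ∀ τ : ℝ, (θ + τ * Complex.I : ℂ) ∈ verticalClosedStrip 0 1 := fun τ => by
    simpa [verticalClosedStrip] using ⟨hθ.1.le, hθ.2.le⟩
  have hθs : (θ : ℂ) ∈ verticalClosedStrip 0 1 := by simpa using hmem 0
  refine morreyNorm_le_of_lpOn_le hq0 fun x r hr => ?_
  have hw0 := ballWeight_ne_zero p q x hr
  have hwt := ballWeight_ne_top hp' hq0 x hr
  rw [ENNReal.mul_le_iff_le_inv hw0 hwt]
  set S := Metric.ball x r
  have hS : MeasurableSet S := measurableSet_ball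
  have hSb : Bornology.IsBounded S := Metric.isBounded_ball
  refine lpOn_le_of_dual hq' (volume_ball_ne_top x r) (AEEqFun.measurable _)
    (integrableOn_measFun_sub (W.integrableOn _ hθs S hSb) (hi S hSb)) fun s => ?_
  set T := (∫⁻ y in S, ‖s y‖ₑ ^ q) ^ (1 - 1 / q) with hT
  have hTt : T ≠ ∞ := ENNReal.rpow_ne_top_of_nonneg
    (by rw [sub_nonneg, div_le_one hq0]; exact hq')
    (lintegral_simpleFunc_rpow_ne_top hq0 (volume_ball_ne_top x r) s)
  set a : ℂ := ((q - 1 : ℝ) : ℂ) with ha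
  have hpiece : ∀ c : ℂ, _ := fun c : ℂ => W.setIntegral_sub_average hθ hb hi hh
    (S := S ∩ s ⁻¹' {c}) (hS.inter (s.measurableSet_fiber c)) (hSb.subset inter_subset_left)
  have key : ∫ y in S, (H θ - h : MeasFun n) y * dualPow a (s y) =
      ∫ τ : ℝ, gaussKernel b (τ * Complex.I) *
        ∫ y in S, (H θ - H (θ + τ * Complex.I) : MeasFun n) y * dualPow a (s y) := by
    rw [setIntegral_mul_dualPow_eq_sum
      (integrableOn_measFun_sub (W.integrableOn _ hθs S hSb) (hi S hSb))]
    have h1 : ∀ c ∈ s.range, dualPow a c * ∫ y in S ∩ s ⁻¹' {c}, (H θ - h : MeasFun n) y =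
        ∫ τ : ℝ, dualPow a c * (gaussKernel b (τ * Complex.I) *
          ∫ y in S ∩ s ⁻¹' {c}, (H θ - H (θ + τ * Complex.I) : MeasFun n) y) := fun c _ => by
      rw [(hpiece c).2, integral_const_mul]
    rw [Finset.sum_congr rfl h1, ← integral_finsetSum _ fun c _ => ((hpiece c).1).const_mul _]
    refine integral_congr_ae (ae_of_all _ fun τ => ?_)
    beta_reduce
    rw [setIntegral_mul_dualPow_eq_sum
      (integrableOn_measFun_sub (W.integrableOn _ hθs S hSb) (W.integrableOn _ (hmem τ) S hSb)),
      Finset.mul_sum]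
    exact Finset.sum_congr rfl fun c _ => by ring
  rw [key]
  have hkm : Measurable fun τ : ℝ => ‖gaussKernel b (τ * Complex.I)‖ₑ :=
    (((differentiable_gaussKernel b).continuous.comp
      (by fun_prop : Continuous fun τ : ℝ => (τ * Complex.I : ℂ))).enorm).measurable
  calc _ ≤ ∫⁻ τ : ℝ, ‖gaussKernel b (τ * Complex.I) *
        ∫ y in S, (H θ - H (θ + τ * Complex.I) : MeasFun n) y * dualPow a (s y)‖ₑ :=
        enorm_integral_le_lintegral_enorm _
    _ ≤ ∫⁻ τ : ℝ, ((ballWeight p q x r)⁻¹ * T) * (‖gaussKernel b (τ * Complex.I)‖ₑ * ω τ) := by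
        refine lintegral_mono fun τ => ?_
        rw [enorm_mul]
        calc _ ≤ ‖gaussKernel b (τ * Complex.I)‖ₑ * ((ballWeight p q x r)⁻¹ * ω τ * T) := by
              gcongr
              refine (enorm_setIntegral_mul_dualPow_le (q := q) hq' (AEEqFun.aestronglyMeasurable _)
                (by rw [ha, Complex.ofReal_re]; field_simp) s).trans ?_
              gcongr
              refine (lpOn_ball_le hp' hq0 _ x hr).trans ?_
              gcongr
              exact (morreyM_le_morreyNorm _ hr).trans (hω τ)
          _ = _ := by ring
    _ = ((ballWeight p q x r)⁻¹ * T) * ∫⁻ τ : ℝ, (‖gaussKernel b (τ * Complex.I)‖ₑ * ω τ) :=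
        lintegral_const_mul' _ _ (ENNReal.mul_ne_top (ENNReal.inv_ne_top.2 hw0) hTt)
    _ = _ := by ring

/-- The Gaussian average of `δ + C e^(b/2 (τ² - η²))`, a majorant of the function that is `δ` for
`|τ| < η` and `C` elsewhere, exceeds `δ` by a term that tends to zero as `b → ∞` when `η > 0`. -/
theorem lintegral_gaussKernel_mul_le {b δ C η : ℝ} (hb : 0 < b) (hδ : 0 ≤ δ) (hC : 0 ≤ C) :
    ∫⁻ τ : ℝ, ‖gaussKernel b (τ * Complex.I)‖ₑ *
      ENNReal.ofReal (δ + C * Real.exp (b / 2 * (τ ^ 2 - η ^ 2))) ≤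
      ENNReal.ofReal (δ + C * √2 * Real.exp (-(b / 2) * η ^ 2)) := by
  have hb2 : 0 < b / 2 := by linarith
  have e : ∀ τ : ℝ, ‖gaussKernel b (τ * Complex.I)‖ₑ *
      ENNReal.ofReal (δ + C * Real.exp (b / 2 * (τ ^ 2 - η ^ 2))) =
      ENNReal.ofReal (δ * (√(b / Real.pi) * Real.exp (-b * τ ^ 2)) +
        C * √2 * Real.exp (-(b / 2) * η ^ 2) *
          (√(b / 2 / Real.pi) * Real.exp (-(b / 2) * τ ^ 2))) := fun τ => by
    rw [gaussKernel_mul_I, ← ofReal_norm, Complex.norm_real, Real.norm_of_nonneg (by positivity),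
      ← ENNReal.ofReal_mul (by positivity)]
    congr 1
    have h1 : √(b / Real.pi) = √2 * √(b / 2 / Real.pi) := by
      rw [← Real.sqrt_mul (by norm_num)]
      congr 1
      ring
    have h2 : Real.exp (-b * τ ^ 2) * Real.exp (b / 2 * (τ ^ 2 - η ^ 2)) =
        Real.exp (-(b / 2) * η ^ 2) * Real.exp (-(b / 2) * τ ^ 2) := by
      rw [← Real.exp_add, ← Real.exp_add]
      congr 1
      ring
    calc _ = δ * (√(b / Real.pi) * Real.exp (-b * τ ^ 2)) + C * √(b / Real.pi) *
          (Real.exp (-b * τ ^ 2) * Real.exp (b / 2 * (τ ^ 2 - η ^ 2))) := by ring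
      _ = _ := by rw [h2, h1]; ring
  simp_rw [e]
  have i1 := ((integrable_exp_neg_mul_sq hb).const_mul √(b / Real.pi)).const_mul δ
  have i2 := ((integrable_exp_neg_mul_sq hb2).const_mul √(b / 2 / Real.pi)).const_mul
    (C * √2 * Real.exp (-(b / 2) * η ^ 2))
  rw [← ofReal_integral_eq_lintegral_ofReal (i1.fun_add i2)
    (ae_of_all _ fun τ => by positivity)]
  refine ENNReal.ofReal_le_ofReal (le_of_eq ?_)
  rw [integral_add i1 i2, integral_const_mul δ, integral_const_mul (C * √2 * _),
    integral_sqrt_mul_gaussian hb,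
    integral_sqrt_mul_gaussian hb2, mul_one, mul_one]

/-- The value at `θ` of a weakly holomorphic family with Morrey boundary values lies in the closure
of the intersection of the couple in `M^p_q`. -/
theorem WeakCalderon.exists_mem_inter_morreyNorm_sub_le (W : WeakCalderon H g₀ g₁)
    (hp₀ : 0 < p₀) (hp₁ : 0 < p₁) (hθ : θ ∈ Ioo (0 : ℝ) 1) (hp' : 0 < p) (hq' : 1 ≤ q)
    (hp : 1 / p = (1 - θ) / p₀ + θ / p₁) (hq : 1 / q = (1 - θ) / q₀ + θ / q₁)
    {ε : ℝ} (hε : 0 < ε) :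
    ∃ h : MeasFun n, h ∈ morreySet n p₀ q₀ ∧ h ∈ morreySet n p₁ q₁ ∧
      morreyNorm n p q (H θ - h : MeasFun n) ≤ ENNReal.ofReal ε := by
  obtain ⟨C₀, hC₀⟩ := exists_enorm_le_of_tendsto_cocompact W.continuous_left W.zero_left
  obtain ⟨C₁, hC₁⟩ := exists_enorm_le_of_tendsto_cocompact W.continuous_right W.zero_right
  set C := max C₀ C₁ with hCdef
  have hC0 : 0 ≤ C := (norm_nonneg _).trans ((hC₀ 0).trans (le_max_left _ _))
  have u₀ := Metric.uniformContinuous_iff.1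
    (W.continuous_left.uniformContinuous_of_tendsto_cocompact W.zero_left) (ε / 2) (by positivity)
  have u₁ := Metric.uniformContinuous_iff.1
    (W.continuous_right.uniformContinuous_of_tendsto_cocompact W.zero_right) (ε / 2) (by positivity)
  obtain ⟨η₀, hη₀, hu₀⟩ := u₀
  obtain ⟨η₁, hη₁, hu₁⟩ := u₁
  set η := min η₀ η₁ with hη
  have hηp : 0 < η := lt_min hη₀ hη₁
  obtain ⟨b, hb, hbε⟩ : ∃ b : ℝ, 0 < b ∧ 2 * C * √2 * Real.exp (-(b / 2) * η ^ 2) ≤ ε / 2 := by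
    have h1 : Tendsto (fun b : ℝ => 2 * C * √2 * Real.exp (-(b / 2) * η ^ 2)) atTop (𝓝 0) := by
      have h2 : Tendsto (fun b : ℝ => b * (-(1 / 2) * η ^ 2)) atTop atBot :=
        tendsto_id.atTop_mul_const_of_neg (by nlinarith [sq_pos_of_pos hηp])
      have h3 := (Real.tendsto_exp_atBot.comp h2).const_mul (2 * C * √2)
      rw [mul_zero] at h3
      refine h3.congr fun b => ?_
      simp only [Function.comp]
      congr 2
      ring
    obtain ⟨b, hb1, hb2⟩ := ((eventually_gt_atTop 0).and
      (h1.eventually_le_const (show (0 : ℝ) < ε / 2 by positivity))).exists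
    exact ⟨b, hb1, hb2⟩
  obtain ⟨h, hm₀, hm₁, hh⟩ := W.exists_gaussian_average hp₀ hp₁ hθ hb
  refine ⟨h, hm₀, hm₁, ?_⟩
  -- Near `τ = 0` uniform continuity is used, elsewhere the exponential exceeds `1`.
  have hω : ∀ τ : ℝ, morreyNorm n p q (H θ - H (θ + τ * Complex.I) : MeasFun n) ≤
      ENNReal.ofReal (ε / 2 + 2 * C * Real.exp (b / 2 * (τ ^ 2 - η ^ 2))) := by
    intro τ
    have hpos : 0 ≤ 2 * C * Real.exp (b / 2 * (τ ^ 2 - η ^ 2)) := by positivity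
    have hfar : η ≤ |τ| → 2 * C ≤ 2 * C * Real.exp (b / 2 * (τ ^ 2 - η ^ 2)) := fun hτ => by
      refine le_mul_of_one_le_right (by positivity) (Real.one_le_exp ?_)
      have : η ^ 2 ≤ τ ^ 2 := by
        rw [← sq_abs τ]
        gcongr
      exact mul_nonneg (by linarith) (by linarith)
    refine (W.sub_shift τ).morreyNorm_le hθ hp₀ hp₁ hq' hp hq ENNReal.ofReal_ne_top
      (fun t => ?_) fun t => ?_
    · rw [← ofReal_norm]
      refine ENNReal.ofReal_le_ofReal ?_
      by_cases hτ : |τ| < η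
      · have := hu₀ (a := t) (b := t + τ) (by
          rw [Real.dist_eq]; simpa using hτ.trans_le (min_le_left _ _))
        rw [dist_eq_norm] at this
        linarith
      · have := norm_sub_le (g₀ t) (g₀ (t + τ))
        linarith [hfar (not_lt.1 hτ), hC₀ t, hC₀ (t + τ), le_max_left C₀ C₁]
    · rw [← ofReal_norm]
      refine ENNReal.ofReal_le_ofReal ?_
      by_cases hτ : |τ| < η
      · have := hu₁ (a := t) (b := t + τ) (by
          rw [Real.dist_eq]; simpa using hτ.trans_le (min_le_right _ _))
        rw [dist_eq_norm] at this
        linarith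
      · have := norm_sub_le (g₁ t) (g₁ (t + τ))
        linarith [hfar (not_lt.1 hτ), hC₁ t, hC₁ (t + τ), le_max_right C₀ C₁]
  refine (W.morreyNorm_sub_average_le hθ hp' hq' hb
    (fun S hS => integrableOn_of_mem_morreySet hp₀ hq₀ hS hm₀) hh hω).trans ?_
  refine (lintegral_gaussKernel_mul_le hb (by positivity) (by positivity)).trans ?_
  exact ENNReal.ofReal_le_ofReal (by linarith)

end Density

/-! ### Convergence of truncations -/

section Truncation

variable {n : ℕ} {p q p₀ q₀ p₁ q₁ θ : ℝ} {hq₀ : 1 ≤ q₀} {hq₁ : 1 ≤ q₁}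

/-- On a set where `|h|^(q - q₀) ≤ K^(q - q₀)`, the `M^p_q` norm of `h` is controlled by its
`M^{p₀}_{q₀}` norm with a constant that is a power of `K`. -/
theorem morreyNorm_indicator_le (hp : 0 < p) (hq : 0 < q) (hp₀ : 0 < p₀) (hq₀ : 0 < q₀)
    (hratio : p / q = p₀ / q₀) {h : EuclideanSpace ℝ (Fin n) → ℂ} {K : ℝ} (hK : 0 < K)
    {E : Set (EuclideanSpace ℝ (Fin n))}
    (hE : ∀ y ∈ E, h y ≠ 0 → ‖h y‖ ^ (q - q₀) ≤ K ^ (q - q₀)) (hq₀' : 1 ≤ q₀) :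
    morreyNorm n p q (E.indicator h) ≤
      (ENNReal.ofReal (K ^ ((q - q₀) / q₀)) * morreyNorm n p₀ q₀ h) ^ (q₀ / q) := by
  set c : ℝ := K ^ ((q - q₀) / q₀) with hc
  have hc0 : 0 ≤ c := by positivity
  have h1 := morreyNorm_smul (n := n) (p := p₀) hq₀' (c : ℂ) h
  have hce : ‖(c : ℂ)‖ₑ = ENNReal.ofReal c := by
    rw [← ofReal_norm, Complex.norm_real, Real.norm_of_nonneg hc0]
  rw [← hce, ← h1]
  refine morreyNorm_le_rpow hp₀ hq₀ hp hq hratio.symm (ae_of_all _ fun y => ?_)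
  by_cases hy : y ∈ E ∧ h y ≠ 0
  · have hpos : 0 < ‖h y‖ := norm_pos_iff.2 hy.2
    rw [indicator_of_mem hy.1, ← ofReal_norm, ← ofReal_norm, norm_mul, Complex.norm_real,
      Real.norm_of_nonneg hc0, ENNReal.ofReal_rpow_of_nonneg (norm_nonneg _) hq.le,
      ENNReal.ofReal_rpow_of_nonneg (by positivity) hq₀.le]
    refine ENNReal.ofReal_le_ofReal ?_
    have e : c ^ q₀ = K ^ (q - q₀) := by
      rw [hc, ← Real.rpow_mul hK.le, div_mul_cancel₀ _ hq₀.ne']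
    calc ‖h y‖ ^ q = ‖h y‖ ^ (q - q₀) * ‖h y‖ ^ q₀ := by
          rw [← Real.rpow_add hpos, sub_add_cancel]
      _ ≤ K ^ (q - q₀) * ‖h y‖ ^ q₀ := by
          exact mul_le_mul_of_nonneg_right (hE y hy.1 hy.2) (by positivity)
      _ = (c * ‖h y‖) ^ q₀ := by rw [Real.mul_rpow hc0 hpos.le, e]
  · have : E.indicator h y = 0 := by
      by_cases hyE : y ∈ E
      · rw [indicator_of_mem hyE]
        by_contra h0
        exact hy ⟨hyE, h0⟩
      · exact indicator_of_notMem hyE _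
    rw [this, enorm_zero, ENNReal.zero_rpow_of_pos hq]
    exact zero_le

theorem tendsto_ofReal_mul_rpow {M : ℝ≥0∞} (hM : M ≠ ∞) {s : ℝ} (hs : 0 < s) {c : ℕ → ℝ}
    (hc : Tendsto c atTop (𝓝 0)) :
    Tendsto (fun N => (ENNReal.ofReal (c N) * M) ^ s) atTop (𝓝 0) := by
  have h1 : Tendsto (fun N => ENNReal.ofReal (c N) * M) atTop (𝓝 (ENNReal.ofReal 0 * M)) :=
    ENNReal.Tendsto.mul_const (ENNReal.tendsto_ofReal hc) (Or.inr hM)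
  rw [ENNReal.ofReal_zero, zero_mul] at h1
  have h2 := (ENNReal.continuous_rpow_const (y := s)).tendsto 0 |>.comp h1
  rwa [ENNReal.zero_rpow_of_pos hs] at h2

theorem tendsto_morreyNorm_high (hp : 0 < p) (hp₀ : 0 < p₀) (hq₀ : 1 ≤ q₀) (hq : 0 < q)
    (hlt : q < q₀) (hratio : p / q = p₀ / q₀) {h : MeasFun n} (hh : h ∈ morreySet n p₀ q₀) :
    Tendsto (fun N : ℕ => morreyNorm n p q ({y | (N : ℝ) / 2 < ‖h y‖}.indicator h)) atTop
      (𝓝 0) := by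
  have h0 : 0 < q₀ := by linarith
  have hN2 : Tendsto (fun N : ℕ => (N : ℝ) / 2) atTop atTop :=
    tendsto_natCast_atTop_atTop.atTop_div_const (by norm_num)
  have hc : Tendsto (fun N : ℕ => ((N : ℝ) / 2) ^ ((q - q₀) / q₀)) atTop (𝓝 0) := by
    have : (q - q₀) / q₀ = -((q₀ - q) / q₀) := by ring
    rw [this]
    exact (tendsto_rpow_neg_atTop (div_pos (by linarith) h0)).comp hN2
  refine tendsto_of_tendsto_of_tendsto_of_le_of_le' tendsto_const_nhds
    (tendsto_ofReal_mul_rpow (LT.lt.ne hh) (s := q₀ / q) (by positivity) hc)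
    (Eventually.of_forall fun _ => zero_le) ?_
  filter_upwards [eventually_gt_atTop 0] with N hN
  have hN' : (0 : ℝ) < (N : ℝ) / 2 := by positivity
  exact morreyNorm_indicator_le hp hq hp₀ h0 hratio hN' (fun y hy _ =>
    Real.rpow_le_rpow_of_nonpos hN' (le_of_lt hy) (by linarith)) hq₀

theorem tendsto_morreyNorm_low (hp : 0 < p) (hp₀ : 0 < p₀) (hq₀ : 1 ≤ q₀) (hq : 0 < q)
    (hlt : q₀ < q) (hratio : p / q = p₀ / q₀) {h : MeasFun n} (hh : h ∈ morreySet n p₀ q₀) :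
    Tendsto (fun N : ℕ => morreyNorm n p q ({y | ‖h y‖ < 2 / (N : ℝ)}.indicator h)) atTop
      (𝓝 0) := by
  have h0 : 0 < q₀ := by linarith
  have hN2 : Tendsto (fun N : ℕ => 2 / (N : ℝ)) atTop (𝓝 0) :=
    tendsto_const_nhds.div_atTop tendsto_natCast_atTop_atTop
  have hs : 0 < (q - q₀) / q₀ := div_pos (by linarith) h0
  have hc : Tendsto (fun N : ℕ => (2 / (N : ℝ)) ^ ((q - q₀) / q₀)) atTop (𝓝 0) := by
    have := (Real.continuousAt_rpow_const 0 ((q - q₀) / q₀) (Or.inr hs.le)).tendsto.comp hN2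
    rwa [Real.zero_rpow hs.ne'] at this
  refine tendsto_of_tendsto_of_tendsto_of_le_of_le' tendsto_const_nhds
    (tendsto_ofReal_mul_rpow (LT.lt.ne hh) (s := q₀ / q) (by positivity) hc)
    (Eventually.of_forall fun _ => zero_le) ?_
  filter_upwards [eventually_gt_atTop 0] with N hN
  have hN' : (0 : ℝ) < 2 / (N : ℝ) := by positivity
  exact morreyNorm_indicator_le hp hq hp₀ h0 hratio hN' (fun y hy _ =>
    Real.rpow_le_rpow (norm_nonneg _) (le_of_lt hy) (by linarith)) hq₀

theorem truncRemainder_eq (f : EuclideanSpace ℝ (Fin n) → ℂ) (N : ℕ) :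
    truncRemainder n f N = {y | 1 / (N : ℝ) ≤ ‖f y‖ ∧ ‖f y‖ ≤ (N : ℝ)}ᶜ.indicator f := by
  rw [indicator_compl]
  rfl

/-- Where `f` is removed by truncation, either `h` is large or small at half or twice the threshold,
or `|f| ≤ 2 |f - h|`. -/
theorem norm_truncRemainder_le (f h : EuclideanSpace ℝ (Fin n) → ℂ) (N : ℕ)
    (y : EuclideanSpace ℝ (Fin n)) :
    ‖truncRemainder n f N y‖ ≤ 2 * ‖f y - h y‖ + ‖{y | (N : ℝ) / 2 < ‖h y‖}.indicator h y‖ +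
      ‖{y | ‖h y‖ < 2 / (N : ℝ)}.indicator h y‖ := by
  have ht : ‖f y‖ ≤ ‖f y - h y‖ + ‖h y‖ := by
    simpa using norm_add_le (f y - h y) (h y)
  have ht' : ‖h y‖ ≤ ‖f y - h y‖ + ‖f y‖ := by
    have := norm_add_le (h y - f y) (f y)
    rwa [sub_add_cancel, norm_sub_rev] at this
  have n1 := norm_nonneg (f y - h y)
  have n2 := norm_nonneg ({y | (N : ℝ) / 2 < ‖h y‖}.indicator h y)
  have n3 := norm_nonneg ({y | ‖h y‖ < 2 / (N : ℝ)}.indicator h y)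
  rw [truncRemainder_eq]
  by_cases hy : 1 / (N : ℝ) ≤ ‖f y‖ ∧ ‖f y‖ ≤ (N : ℝ)
  · rw [indicator_of_notMem (by simpa using hy), norm_zero]
    positivity
  rw [indicator_of_mem (by simpa using hy)]
  rw [not_and_or, not_le, not_le] at hy
  rcases hy with hy | hy
  · by_cases hh : ‖h y‖ < 2 / (N : ℝ)
    · have : {y | ‖h y‖ < 2 / (N : ℝ)}.indicator h y = h y :=
        indicator_of_mem (s := {y | ‖h y‖ < 2 / (N : ℝ)}) hh h
      rw [this]
      linarith
    · have : 2 / (N : ℝ) = 2 * (1 / N) := by ring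
      linarith [not_lt.1 hh]
  · by_cases hh : (N : ℝ) / 2 < ‖h y‖
    · have : {y | (N : ℝ) / 2 < ‖h y‖}.indicator h y = h y :=
        indicator_of_mem (s := {y | (N : ℝ) / 2 < ‖h y‖}) hh h
      rw [this]
      linarith
    · linarith [not_lt.1 hh]

theorem morreyNorm_truncRemainder_le (hq : 1 ≤ q) (f h : MeasFun n) (N : ℕ) :
    morreyNorm n p q (truncRemainder n f N) ≤ 2 * morreyNorm n p q (f - h : MeasFun n) +
      morreyNorm n p q ({y | (N : ℝ) / 2 < ‖h y‖}.indicator h) +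
      morreyNorm n p q ({y | ‖h y‖ < 2 / (N : ℝ)}.indicator h) := by
  have h0 : 0 < q := by linarith
  have hm : Measurable fun y => ‖h y‖ := h.measurable.norm
  have m1 : AEStronglyMeasurable (fun y => ((2 : ℝ) * ‖f y - h y‖ : ℂ)) volume := by
    have := f.measurable
    have := h.measurable
    exact Measurable.aestronglyMeasurable (by fun_prop)
  have m2 : AEStronglyMeasurable (fun y =>
      (‖{y | (N : ℝ) / 2 < ‖h y‖}.indicator h y‖ : ℂ)) volume := by
    have := (h.measurable.indicator (measurableSet_lt (measurable_const (a := (N : ℝ) / 2)) hm))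
    exact Measurable.aestronglyMeasurable (by fun_prop)
  have m3 : AEStronglyMeasurable (fun y =>
      (‖{y | ‖h y‖ < 2 / (N : ℝ)}.indicator h y‖ : ℂ)) volume := by
    have := (h.measurable.indicator (measurableSet_lt hm (measurable_const (a := 2 / (N : ℝ)))))
    exact Measurable.aestronglyMeasurable (by fun_prop)
  have hnorm : ∀ g : EuclideanSpace ℝ (Fin n) → ℂ,
      morreyNorm n p q (fun y => (‖g y‖ : ℂ)) ≤ morreyNorm n p q g := fun g =>
    morreyNorm_mono h0 (ae_of_all _ fun y => by
      rw [← ofReal_norm, ← ofReal_norm, Complex.norm_real, norm_norm])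
  have hd : morreyNorm n p q (fun y => ((2 : ℝ) * ‖f y - h y‖ : ℂ)) ≤
      2 * morreyNorm n p q (f - h : MeasFun n) := by
    refine (le_of_eq (morreyNorm_smul hq ((2 : ℝ) : ℂ) _)).trans ?_
    have : ‖((2 : ℝ) : ℂ)‖ₑ = 2 := by
      rw [← ofReal_norm, Complex.norm_real]; norm_num
    rw [this]
    gcongr
    refine (hnorm _).trans (le_of_eq (morreyNorm_congr (measFun_coe_sub f h)).symm)
  calc _ ≤ morreyNorm n p q (fun y => (((2 : ℝ) * ‖f y - h y‖ : ℂ) +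
        (‖{y | (N : ℝ) / 2 < ‖h y‖}.indicator h y‖ : ℂ)) +
        (‖{y | ‖h y‖ < 2 / (N : ℝ)}.indicator h y‖ : ℂ)) := by
        refine morreyNorm_mono h0 (ae_of_all _ fun y => ?_)
        rw [← ofReal_norm, ← ofReal_norm]
        refine ENNReal.ofReal_le_ofReal ((norm_truncRemainder_le f h N y).trans ?_)
        rw [← Complex.ofReal_mul, ← Complex.ofReal_add, ← Complex.ofReal_add, Complex.norm_real]
        exact le_abs_self _
    _ ≤ _ := (morreyNorm_add_le hq (m1.add m2) m3).trans
        (add_le_add ((morreyNorm_add_le hq m1 m2).trans (add_le_add hd (hnorm _))) (hnorm _))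

/-- Truncations converge on the closure of `M^{p₀}_{q₀} ∩ M^{p₁}_{q₁}` in `M^p_q`. -/
theorem truncationsConverge_of_approx (hp' : 0 < p) (hq' : 1 ≤ q) (hp₀ : 0 < p₀) (hp₁ : 0 < p₁)
    (hq₀ : 1 ≤ q₀) (hq₁ : 1 ≤ q₁) (hr₀ : p / q = p₀ / q₀) (hr₁ : p / q = p₁ / q₁)
    (hlt : q₀ < q ∧ q < q₁ ∨ q₁ < q ∧ q < q₀) {f : MeasFun n}
    (hf : ∀ ε : ℝ, 0 < ε → ∃ h : MeasFun n, h ∈ morreySet n p₀ q₀ ∧ h ∈ morreySet n p₁ q₁ ∧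
      morreyNorm n p q (f - h : MeasFun n) ≤ ENNReal.ofReal ε) :
    TruncationsConverge n p q f := by
  have h0 : 0 < q := by linarith
  refine ENNReal.tendsto_nhds_zero.2 fun ε hε => ?_
  have hε4 : 0 < ε / 4 := ENNReal.div_pos hε.ne' (by norm_num)
  obtain ⟨δ, hδ0, hδ⟩ := ENNReal.lt_iff_exists_nnreal_btwn.1 hε4
  obtain ⟨h, hh₀, hh₁, hfh⟩ := hf δ (by exact_mod_cast hδ0)
  have hhi : Tendsto (fun N : ℕ => morreyNorm n p q ({y | (N : ℝ) / 2 < ‖h y‖}.indicator h)) atTop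
      (𝓝 0) := by
    rcases hlt with hlt | hlt
    · exact tendsto_morreyNorm_high hp' hp₁ hq₁ h0 hlt.2 hr₁ hh₁
    · exact tendsto_morreyNorm_high hp' hp₀ hq₀ h0 hlt.2 hr₀ hh₀
  have hlo : Tendsto (fun N : ℕ => morreyNorm n p q ({y | ‖h y‖ < 2 / (N : ℝ)}.indicator h)) atTop
      (𝓝 0) := by
    rcases hlt with hlt | hlt
    · exact tendsto_morreyNorm_low hp' hp₀ hq₀ h0 hlt.1 hr₀ hh₀
    · exact tendsto_morreyNorm_low hp' hp₁ hq₁ h0 hlt.1 hr₁ hh₁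
  filter_upwards [hhi.eventually_le_const hε4, hlo.eventually_le_const hε4] with N h1 h2
  calc _ ≤ 2 * (ε / 4) + ε / 4 + ε / 4 := by
        refine (morreyNorm_truncRemainder_le hq' f h N).trans ?_
        gcongr
        rw [ENNReal.ofReal_coe_nnreal] at hfh
        exact hfh.trans hδ.le
    _ = 4 * (ε / 4) := by ring
    _ = ε := ENNReal.mul_div_cancel (by norm_num) (by norm_num)

end Truncation

/-! ### Holomorphic multiplier families on solid subspaces -/

section Multipliers

variable {n : ℕ} {p q : ℝ} {hq : 1 ≤ q}

/-- A subspace of the Morrey space is solid when it contains, with a function, all functions of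
smaller absolute value. -/
def IsSolidSubspace (W : Submodule ℂ (MorreySpace n p q hq)) : Prop :=
  ∀ f ∈ W, ∀ g : MorreySpace n p q hq,
    (∀ᵐ y, ‖MorreySpace.incl n p q hq g y‖ₑ ≤ ‖MorreySpace.incl n p q hq f y‖ₑ) → g ∈ W

variable {W : Submodule ℂ (MorreySpace n p q hq)}

theorem IsSolidSubspace.exists_mul (hW : IsSolidSubspace W) (ω : W)
    {m : EuclideanSpace ℝ (Fin n) → ℂ} (hm : Measurable m) {C : ℝ} (hC : ∀ y, ‖m y‖ ≤ C) :
    ∃ g : W, MorreySpace.incl n p q hq g =ᵐ[volume]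
      fun y => MorreySpace.incl n p q hq ω y * m y := by
  have h0 : 0 < q := by linarith
  set φ := MorreySpace.incl n p q hq ω
  have hφm : AEStronglyMeasurable (fun y => φ y * m y) volume :=
    φ.aestronglyMeasurable.mul hm.aestronglyMeasurable
  have hC0 : 0 ≤ C := (norm_nonneg _).trans (hC 0)
  have hle : ∀ᵐ y, ‖(AEEqFun.mk _ hφm : MeasFun n) y‖ₑ ≤
      ‖MorreySpace.incl n p q hq ((C : ℂ) • (ω : MorreySpace n p q hq)) y‖ₑ := by
    rw [map_smul]
    filter_upwards [AEEqFun.coeFn_mk _ hφm, measFun_coe_smul (C : ℂ) φ] with y h1 h2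
    rw [h1, h2, enorm_mul, enorm_mul, mul_comm]
    gcongr
    rw [← ofReal_norm, ← ofReal_norm, Complex.norm_real, Real.norm_of_nonneg hC0]
    exact ENNReal.ofReal_le_ofReal (hC y)
  have hmem : (AEEqFun.mk _ hφm : MeasFun n) ∈ morreySet n p q :=
    (morreyNorm_mono h0 hle).trans_lt (MorreySpace.incl_mem _)
  exact ⟨⟨MorreySpace.ofMem hq _ hmem, hW _ (W.smul_mem (C : ℂ) ω.2) _ hle⟩,
    AEEqFun.coeFn_mk _ hφm⟩

open Classical in
/-- The product of an element of a solid subspace and a bounded measurable function; it is `0` when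
the second factor is not measurable and bounded. -/
noncomputable def IsSolidSubspace.mul (hW : IsSolidSubspace W) (ω : W)
    (m : EuclideanSpace ℝ (Fin n) → ℂ) : W :=
  if h : Measurable m ∧ ∃ C : ℝ, ∀ y, ‖m y‖ ≤ C then
    (hW.exists_mul ω h.1 h.2.choose_spec).choose else 0

theorem IsSolidSubspace.coe_mul (hW : IsSolidSubspace W) (ω : W)
    {m : EuclideanSpace ℝ (Fin n) → ℂ} (hm : Measurable m) {C : ℝ} (hC : ∀ y, ‖m y‖ ≤ C) :
    MorreySpace.incl n p q hq (hW.mul ω m) =ᵐ[volume]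
      fun y => MorreySpace.incl n p q hq ω y * m y := by
  have h : Measurable m ∧ ∃ C : ℝ, ∀ y, ‖m y‖ ≤ C := ⟨hm, C, hC⟩
  rw [IsSolidSubspace.mul, dif_pos h]
  exact (hW.exists_mul ω h.1 h.2.choose_spec).choose_spec

theorem norm_le_of_ae_le {f g : W} {C : ℝ} (hC : 0 ≤ C)
    (h : ∀ᵐ y, ‖MorreySpace.incl n p q hq g y‖ ≤ C * ‖MorreySpace.incl n p q hq f y‖) :
    ‖g‖ ≤ C * ‖f‖ := by
  have h0 : 0 < q := by linarith
  have h1 : morreyNorm n p q (MorreySpace.incl n p q hq g) ≤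
      ‖(C : ℂ)‖ₑ * morreyNorm n p q (MorreySpace.incl n p q hq f) := by
    rw [← morreyNorm_smul hq]
    refine morreyNorm_mono h0 ?_
    filter_upwards [h] with y hy
    rw [← ofReal_norm, ← ofReal_norm, norm_mul, Complex.norm_real, Real.norm_of_nonneg hC]
    exact ENNReal.ofReal_le_ofReal hy
  have h2 := ENNReal.toReal_mono (ENNReal.mul_ne_top enorm_ne_top (MorreySpace.incl_mem _).ne) h1
  rw [ENNReal.toReal_mul, toReal_enorm, Complex.norm_real, Real.norm_of_nonneg hC] at h2
  exact h2

theorem norm_exp_neg_mul_le {z : ℂ} (hz : 0 ≤ z.re) {t : ℝ} (ht : 0 ≤ t) :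
    ‖Complex.exp (-(z * t))‖ ≤ 1 := by
  rw [Complex.norm_exp, Real.exp_le_one_iff]
  simp only [Complex.neg_re, Complex.mul_re, Complex.ofReal_re, Complex.ofReal_im, mul_zero,
    sub_zero]
  nlinarith

theorem norm_exp_neg_mul_sub_le {z w : ℂ} (hz : 0 ≤ z.re) (hw : 0 ≤ w.re) {t : ℝ} (ht : 0 ≤ t) :
    ‖Complex.exp (-(z * t)) - Complex.exp (-(w * t))‖ ≤ t * ‖z - w‖ := by
  have hconv : Convex ℝ {u : ℂ | 0 ≤ u.re} := convex_halfSpace_re_ge 0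
  refine hconv.norm_image_sub_le_of_norm_deriv_le (f := fun u : ℂ => Complex.exp (-(u * t)))
    (fun u _ => by fun_prop) (fun u hu => ?_) hw hz
  have : HasDerivAt (fun u : ℂ => Complex.exp (-(u * t))) (Complex.exp (-(u * t)) * (-(1 * t))) u :=
    (((hasDerivAt_id u).mul_const (t : ℂ)).neg).cexp
  rw [this.deriv, norm_mul, norm_neg, one_mul, Complex.norm_real, Real.norm_of_nonneg ht]
  exact mul_le_of_le_one_left ht (norm_exp_neg_mul_le hu ht)

theorem sq_mul_exp_neg_le {c t : ℝ} (hc : 0 < c) (ht : 0 ≤ t) :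
    t ^ 2 * Real.exp (-(c * t)) ≤ 2 / c ^ 2 := by
  have h1 := Real.quadratic_le_exp_of_nonneg (mul_nonneg hc.le ht)
  have h2 : (c * t) ^ 2 / 2 ≤ Real.exp (c * t) := by nlinarith [mul_nonneg hc.le ht]
  rw [Real.exp_neg, ← div_eq_mul_inv, div_le_div_iff₀ (Real.exp_pos _) (by positivity)]
  nlinarith

theorem mul_exp_neg_le {c t : ℝ} (hc : 0 < c) : t * Real.exp (-(c * t)) ≤ 1 / c := by
  have h1 := Real.add_one_le_exp (c * t)
  rw [Real.exp_neg, ← div_eq_mul_inv, div_le_div_iff₀ (Real.exp_pos _) hc]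
  nlinarith

/-- Second-order Taylor estimate for `z ↦ e^(-zt)`, uniform in `t ≥ 0`. -/
theorem norm_exp_neg_mul_taylor_le {z h : ℂ} (hz : 0 < z.re) (hh : ‖h‖ ≤ z.re / 2) {t : ℝ}
    (ht : 0 ≤ t) :
    ‖Complex.exp (-((z + h) * t)) - Complex.exp (-(z * t)) - h * (-t * Complex.exp (-(z * t)))‖ ≤
      8 / z.re ^ 2 * ‖h‖ ^ 2 := by
  have e : Complex.exp (-((z + h) * t)) - Complex.exp (-(z * t)) -
      h * (-t * Complex.exp (-(z * t))) = Complex.exp (-(z * t)) *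
        (Complex.exp (-(h * t)) - ∑ m ∈ Finset.range 2, (-(h * t)) ^ m / (m.factorial : ℂ)) := by
    rw [show -((z + h) * t) = -(z * t) + -(h * t) by ring, Complex.exp_add]
    simp [Finset.sum_range_succ]
    ring
  have hn : ‖-(h * (t : ℂ))‖ = ‖h‖ * t := by
    rw [norm_neg, norm_mul, Complex.norm_real, Real.norm_of_nonneg ht]
  have hz' : ‖Complex.exp (-(z * t))‖ = Real.exp (-(z.re * t)) := by
    rw [Complex.norm_exp]; simp
  rw [e, norm_mul, hz']
  calc _ ≤ Real.exp (-(z.re * t)) * (‖-(h * (t : ℂ))‖ ^ 2 * Real.exp ‖-(h * (t : ℂ))‖) := by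
        gcongr
        exact Complex.norm_exp_sub_sum_le_norm_mul_exp _ 2
    _ = ‖h‖ ^ 2 * (t ^ 2 * Real.exp (-((z.re - ‖h‖) * t))) := by
        rw [hn, show -((z.re - ‖h‖) * t) = -(z.re * t) + ‖h‖ * t by ring, Real.exp_add]
        ring
    _ ≤ ‖h‖ ^ 2 * (t ^ 2 * Real.exp (-(z.re / 2 * t))) := by
        gcongr
        linarith
    _ ≤ ‖h‖ ^ 2 * (2 / (z.re / 2) ^ 2) := by
        gcongr
        exact sq_mul_exp_neg_le (by positivity) ht
    _ = _ := by ring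

variable {lam : EuclideanSpace ℝ (Fin n) → ℝ}

/-- The semigroup `z ↦ ω e^(-zλ)`, `Re z ≥ 0`, of multiplications by a function `λ ≥ 0`. -/
noncomputable def IsSolidSubspace.semigroup (hW : IsSolidSubspace W)
    (lam : EuclideanSpace ℝ (Fin n) → ℝ) (ω : W) (z : ℂ) : W :=
  hW.mul ω fun y => Complex.exp (-(z * lam y))

theorem IsSolidSubspace.coe_semigroup (hW : IsSolidSubspace W) (hlm : Measurable lam)
    (hl : ∀ y, 0 ≤ lam y) (ω : W) {z : ℂ} (hz : 0 ≤ z.re) :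
    MorreySpace.incl n p q hq (hW.semigroup lam ω z) =ᵐ[volume]
      fun y => MorreySpace.incl n p q hq ω y * Complex.exp (-(z * lam y)) :=
  hW.coe_mul ω (by fun_prop) fun y => norm_exp_neg_mul_le hz (hl y)

theorem IsSolidSubspace.norm_semigroup_le (hW : IsSolidSubspace W) (hlm : Measurable lam)
    (hl : ∀ y, 0 ≤ lam y) (ω : W) {z : ℂ} (hz : 0 ≤ z.re) : ‖hW.semigroup lam ω z‖ ≤ ‖ω‖ := by
  rw [← one_mul ‖ω‖]
  refine norm_le_of_ae_le zero_le_one ?_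
  filter_upwards [hW.coe_semigroup hlm hl ω hz] with y hy
  rw [hy, norm_mul, one_mul]
  exact mul_le_of_le_one_right (norm_nonneg _) (norm_exp_neg_mul_le hz (hl y))

theorem IsSolidSubspace.coe_semigroup_sub (hW : IsSolidSubspace W) (hlm : Measurable lam)
    (hl : ∀ y, 0 ≤ lam y) (ω : W) {z w : ℂ} (hz : 0 ≤ z.re) (hw : 0 ≤ w.re) :
    MorreySpace.incl n p q hq ((hW.semigroup lam ω z - hW.semigroup lam ω w : W)) =ᵐ[volume]
      fun y => MorreySpace.incl n p q hq ω y *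
        (Complex.exp (-(z * lam y)) - Complex.exp (-(w * lam y))) := by
  rw [Submodule.coe_sub, map_sub]
  filter_upwards [measFun_coe_sub (MorreySpace.incl n p q hq (hW.semigroup lam ω z))
    (MorreySpace.incl n p q hq (hW.semigroup lam ω w)), hW.coe_semigroup hlm hl ω hz,
    hW.coe_semigroup hlm hl ω hw] with y h1 h2 h3
  rw [h1, h2, h3]
  ring

/-- Strong continuity up to the boundary holds for the functions `ω` whose parts on `{λ > K}` tend
to zero in norm; it may fail for other `ω`, as Morrey norms are not absolutely continuous. -/
theorem IsSolidSubspace.continuousOn_semigroup (hW : IsSolidSubspace W) (hlm : Measurable lam)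
    (hl : ∀ y, 0 ≤ lam y) (ω : W)
    (htail : ∀ ε : ℝ, 0 < ε → ∃ K : ℝ, morreyNorm n p q
      ({y | K < lam y}.indicator (MorreySpace.incl n p q hq ω)) ≤ ENNReal.ofReal ε) :
    ContinuousOn (hW.semigroup lam ω) {z | 0 ≤ z.re} := by
  have h0 : 0 < q := by linarith
  set φ := MorreySpace.incl n p q hq ω with hφ
  intro z hz
  rw [Metric.continuousWithinAt_iff]
  intro ε hε
  obtain ⟨K, hK⟩ := htail (ε / 8) (by positivity)
  set M := max K 0 * ‖ω‖ with hM
  have hM0 : 0 ≤ M := by positivity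
  refine ⟨ε / (2 * (M + 1)), by positivity, fun w hw hwz => ?_⟩
  rw [dist_eq_norm] at hwz ⊢
  set E := {y | K < lam y} with hE
  have hEm : MeasurableSet E := measurableSet_lt measurable_const hlm
  set g := hW.semigroup lam ω w - hW.semigroup lam ω z with hg
  have hpt : ∀ᵐ y, ‖MorreySpace.incl n p q hq g y‖ₑ ≤
      ‖((2 : ℂ) * E.indicator (fun y => (‖φ y‖ : ℂ)) y +
        ((max K 0 * ‖w - z‖ : ℝ) : ℂ) * (‖φ y‖ : ℂ))‖ₑ := by
    filter_upwards [hW.coe_semigroup_sub hlm hl ω hw hz] with y hy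
    rw [hy, ← ofReal_norm, ← ofReal_norm, norm_mul]
    refine ENNReal.ofReal_le_ofReal ?_
    by_cases hyE : y ∈ E
    · rw [indicator_of_mem hyE]
      have h2 : ‖Complex.exp (-(w * lam y)) - Complex.exp (-(z * lam y))‖ ≤ 2 :=
        (norm_sub_le _ _).trans (by
          linarith [norm_exp_neg_mul_le hw (hl y), norm_exp_neg_mul_le hz (hl y)])
      have : ((2 : ℂ) * (‖φ y‖ : ℂ) + ((max K 0 * ‖w - z‖ : ℝ) : ℂ) * (‖φ y‖ : ℂ)) =
          ((2 * ‖φ y‖ + max K 0 * ‖w - z‖ * ‖φ y‖ : ℝ) : ℂ) := by push_cast; ring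
      rw [this, Complex.norm_real, Real.norm_of_nonneg (by positivity)]
      have : 0 ≤ max K 0 * ‖w - z‖ * ‖φ y‖ := by positivity
      nlinarith [norm_nonneg (φ y)]
    · rw [indicator_of_notMem hyE, mul_zero, zero_add, norm_mul, Complex.norm_real,
        Complex.norm_real, norm_norm, Real.norm_of_nonneg (by positivity), mul_comm]
      gcongr
      refine (norm_exp_neg_mul_sub_le hw hz (hl y)).trans ?_
      gcongr
      exact (not_lt.1 hyE).trans (le_max_left _ _)
  have hφm : Measurable fun y => (‖φ y‖ : ℂ) := by
    have := φ.measurable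
    fun_prop
  have key : morreyNorm n p q (MorreySpace.incl n p q hq g) ≤
      ENNReal.ofReal (2 * (ε / 8) + max K 0 * ‖w - z‖ * ‖ω‖) := by
    refine (morreyNorm_mono h0 hpt).trans ((morreyNorm_add_le hq
      ((hφm.indicator hEm).const_mul 2).aestronglyMeasurable
      (hφm.const_mul _).aestronglyMeasurable).trans ?_)
    rw [ENNReal.ofReal_add (by positivity) (by positivity), ENNReal.ofReal_mul (by positivity),
      ENNReal.ofReal_mul (by positivity)]
    refine add_le_add ?_ ?_
    · rw [morreyNorm_smul hq]
      have : ‖(2 : ℂ)‖ₑ = ENNReal.ofReal 2 := by rw [← ofReal_norm]; norm_num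
      rw [this]
      gcongr
      refine le_trans (morreyNorm_mono h0 (ae_of_all _ fun y => ?_)) hK
      by_cases hyE : y ∈ E
      · rw [indicator_of_mem hyE, indicator_of_mem hyE, ← ofReal_norm, ← ofReal_norm,
          Complex.norm_real, norm_norm]
      · rw [indicator_of_notMem hyE, indicator_of_notMem hyE]
    · rw [morreyNorm_smul hq]
      refine mul_le_mul' (le_of_eq ?_) ?_
      · rw [← ofReal_norm, Complex.norm_real, Real.norm_of_nonneg (by positivity)]
      · rw [ofReal_norm]
        refine le_trans (morreyNorm_mono h0 (ae_of_all _ fun y => le_of_eq ?_))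
          (le_of_eq (MorreySpace.enorm_eq (ω : MorreySpace n p q hq)).symm)
        rw [← ofReal_norm, ← ofReal_norm, Complex.norm_real, norm_norm]
  have hnorm : ‖g‖ ≤ 2 * (ε / 8) + max K 0 * ‖w - z‖ * ‖ω‖ := by
    have := ENNReal.toReal_mono ENNReal.ofReal_ne_top key
    rwa [ENNReal.toReal_ofReal (by positivity)] at this
  have h3 : max K 0 * ‖w - z‖ * ‖ω‖ ≤ ε / 2 := by
    have h4 : ‖w - z‖ * (M + 1) ≤ ε / 2 := by
      rw [lt_div_iff₀ (by positivity)] at hwz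
      linarith
    calc max K 0 * ‖w - z‖ * ‖ω‖ = ‖w - z‖ * M := by rw [hM]; ring
      _ ≤ ‖w - z‖ * (M + 1) := by gcongr; linarith
      _ ≤ _ := h4
  linarith

theorem IsSolidSubspace.differentiableOn_semigroup (hW : IsSolidSubspace W) (hlm : Measurable lam)
    (hl : ∀ y, 0 ≤ lam y) (ω : W) :
    DifferentiableOn ℂ (hW.semigroup lam ω) {z | 0 < z.re} := by
  intro z hz
  have hz : 0 < z.re := hz
  refine DifferentiableAt.differentiableWithinAt ?_
  set D : W := hW.mul ω fun y => -(lam y : ℂ) * Complex.exp (-(z * lam y)) with hD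
  have hDc : MorreySpace.incl n p q hq D =ᵐ[volume] fun y => MorreySpace.incl n p q hq ω y *
      (-(lam y : ℂ) * Complex.exp (-(z * lam y))) := by
    refine hW.coe_mul ω (by fun_prop) (C := 1 / z.re) fun y => ?_
    rw [norm_mul, norm_neg, Complex.norm_real, Real.norm_of_nonneg (hl y), Complex.norm_exp]
    simpa using mul_exp_neg_le (t := lam y) hz
  have : HasDerivAt (hW.semigroup lam ω) D z := by
    rw [hasDerivAt_iff_isLittleO_nhds_zero]
    refine Asymptotics.IsBigO.trans_isLittleO (g := fun h : ℂ => h ^ 2) ?_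
      (Asymptotics.isLittleO_pow_id one_lt_two)
    refine Asymptotics.IsBigO.of_bound (8 / z.re ^ 2 * ‖ω‖) ?_
    filter_upwards [Metric.closedBall_mem_nhds (0 : ℂ) (show 0 < z.re / 2 by positivity)] with h hh
    rw [mem_closedBall_zero_iff] at hh
    have hzh : 0 ≤ (z + h).re := by
      have := (abs_le.1 ((Complex.abs_re_le_norm h).trans hh)).1
      rw [Complex.add_re]
      linarith
    rw [norm_pow, mul_right_comm]
    refine norm_le_of_ae_le (by positivity) ?_
    rw [Submodule.coe_sub, map_sub, Submodule.coe_smul, map_smul]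
    filter_upwards [measFun_coe_sub (MorreySpace.incl n p q hq
        ((hW.semigroup lam ω (z + h) - hW.semigroup lam ω z : W)))
        (h • MorreySpace.incl n p q hq D), measFun_coe_smul h (MorreySpace.incl n p q hq D),
      hW.coe_semigroup_sub hlm hl ω hzh hz.le, hDc] with y h1 h2 h3 h4
    rw [h1, h2, h3, h4]
    have := norm_exp_neg_mul_taylor_le hz hh (hl y)
    calc _ = ‖MorreySpace.incl n p q hq ω y * (Complex.exp (-((z + h) * lam y)) -
          Complex.exp (-(z * lam y)) - h * (-lam y * Complex.exp (-(z * lam y))))‖ := by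
          congr 1; ring
      _ ≤ ‖MorreySpace.incl n p q hq ω y‖ * (8 / z.re ^ 2 * ‖h‖ ^ 2) := by
          rw [norm_mul]
          gcongr
      _ = _ := by ring
  exact this.differentiableAt

end Multipliers

/-! ### A function of the class `𝓕` with prescribed value at `θ` -/

section Factorization

open Complex.HadamardThreeLines

variable {n : ℕ} {p q p₀ q₀ p₁ q₁ θ : ℝ} {hq : 1 ≤ q} {hq₀ : 1 ≤ q₀} {hq₁ : 1 ≤ q₁}

section Mask

variable {W : Submodule ℂ (MorreySpace n p q hq)}

/-- The restriction of an element of a solid subspace to a measurable set, extended by zero. -/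
noncomputable def IsSolidSubspace.mask (hW : IsSolidSubspace W)
    (A : Set (EuclideanSpace ℝ (Fin n))) (ω : W) : W :=
  hW.mul ω (A.indicator fun _ => 1)

theorem IsSolidSubspace.coe_mask (hW : IsSolidSubspace W) {A : Set (EuclideanSpace ℝ (Fin n))}
    (hA : MeasurableSet A) (ω : W) :
    MorreySpace.incl n p q hq (hW.mask A ω) =ᵐ[volume]
      fun y => MorreySpace.incl n p q hq ω y * A.indicator (fun _ => 1) y := by
  refine hW.coe_mul ω (measurable_const.indicator hA) (C := 1) fun y => ?_
  by_cases hy : y ∈ A <;> simp [hy]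

theorem IsSolidSubspace.coe_semigroup_mask (hW : IsSolidSubspace W)
    {lam : EuclideanSpace ℝ (Fin n) → ℝ} (hlm : Measurable lam) (hl : ∀ y, 0 ≤ lam y)
    {A : Set (EuclideanSpace ℝ (Fin n))} (hA : MeasurableSet A) (ω : W) {z : ℂ} (hz : 0 ≤ z.re) :
    MorreySpace.incl n p q hq (hW.semigroup lam (hW.mask A ω) z) =ᵐ[volume]
      fun y => MorreySpace.incl n p q hq ω y * A.indicator (fun _ => 1) y *
        Complex.exp (-(z * lam y)) := by
  filter_upwards [hW.coe_semigroup hlm hl (hW.mask A ω) hz, hW.coe_mask hA ω] with y h1 h2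
  rw [h1, h2]

/-- The tails of `f` along the level sets of `λ` tend to zero in the Morrey norm. -/
def HasSmallTails (p q : ℝ) (lam : EuclideanSpace ℝ (Fin n) → ℝ) (f : MeasFun n) : Prop :=
  ∀ ε : ℝ, 0 < ε → ∃ K : ℝ,
    morreyNorm n p q ({y | K < lam y}.indicator f) ≤ ENNReal.ofReal ε

theorem IsSolidSubspace.hasSmallTails_mask (hW : IsSolidSubspace W)
    {lam : EuclideanSpace ℝ (Fin n) → ℝ} {A : Set (EuclideanSpace ℝ (Fin n))}
    (hA : MeasurableSet A) {ω : W} (h : HasSmallTails p q lam (MorreySpace.incl n p q hq ω)) :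
    HasSmallTails p q lam (MorreySpace.incl n p q hq (hW.mask A ω)) := by
  intro ε hε
  obtain ⟨K, hK⟩ := h ε hε
  refine ⟨K, le_trans (morreyNorm_mono (by linarith) ?_) hK⟩
  filter_upwards [hW.coe_mask hA ω] with y hy
  by_cases hyK : y ∈ {y | K < lam y}
  · rw [indicator_of_mem hyK, indicator_of_mem hyK, hy]
    by_cases hyA : y ∈ A <;> simp [hyA]
  · rw [indicator_of_notMem hyK, indicator_of_notMem hyK]

end Mask

variable {W₀ : Submodule ℂ (MorreySpace n p₀ q₀ hq₀)} {W₁ : Submodule ℂ (MorreySpace n p₁ q₁ hq₁)}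

/-- The continuous linear map `(a, b) ↦ a + b` onto the sum of a couple. -/
noncomputable def CoupleSum.ofProd {X₀ X₁ Z : Type*} [NormedAddCommGroup X₀] [NormedSpace ℂ X₀]
    [NormedAddCommGroup X₁] [NormedSpace ℂ X₁] [AddCommGroup Z] [Module ℂ Z]
    (ι₀ : X₀ →ₗ[ℂ] Z) (ι₁ : X₁ →ₗ[ℂ] Z) : X₀ × X₁ →L[ℂ] CoupleSum ι₀ ι₁ :=
  (LinearMap.ker (coupleMap ι₀ ι₁)).mkQL ∘L
    (WithLp.prodContinuousLinearEquiv 1 ℂ X₀ X₁).symm.toContinuousLinearMap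

theorem CoupleSum.toAmbient_ofProd {X₀ X₁ Z : Type*} [NormedAddCommGroup X₀] [NormedSpace ℂ X₀]
    [NormedAddCommGroup X₁] [NormedSpace ℂ X₁] [AddCommGroup Z] [Module ℂ Z]
    (ι₀ : X₀ →ₗ[ℂ] Z) (ι₁ : X₁ →ₗ[ℂ] Z) (x : X₀ × X₁) :
    CoupleSum.toAmbient ι₀ ι₁ (CoupleSum.ofProd ι₀ ι₁ x) = ι₀ x.1 + ι₁ x.2 := rfl

theorem CoupleSum.norm_ofProd_le {X₀ X₁ Z : Type*} [NormedAddCommGroup X₀] [NormedSpace ℂ X₀]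
    [NormedAddCommGroup X₁] [NormedSpace ℂ X₁] [AddCommGroup Z] [Module ℂ Z]
    (ι₀ : X₀ →ₗ[ℂ] Z) (ι₁ : X₁ →ₗ[ℂ] Z) (x : X₀ × X₁) :
    ‖CoupleSum.ofProd ι₀ ι₁ x‖ ≤ ‖x.1‖ + ‖x.2‖ :=
  (Submodule.Quotient.norm_mk_le _ _).trans (WithLp.prod_norm_eq_of_L1 _).le

/-- The multiplier `e^(ζℓ)` written as `e^(αℓ) e^(-u|ℓ|)` on `{ℓ ≤ 0}` and as `e^(βℓ) e^(-v|ℓ|)` on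
`{ℓ > 0}`. -/
theorem mul_exp_add_mul_exp {S : Set (EuclideanSpace ℝ (Fin n))}
    {ℓ : EuclideanSpace ℝ (Fin n) → ℝ} (hS : S = {y | ℓ y ≤ 0}) (y : EuclideanSpace ℝ (Fin n))
    (c : ℂ) {α β : ℝ} {u v ζ : ℂ} (hu : α + u = ζ) (hv : β - v = ζ) :
    c * Complex.exp ((α * ℓ y : ℝ) : ℂ) * S.indicator (fun _ => 1) y *
        Complex.exp (-(u * (|ℓ y| : ℝ))) +
      c * Complex.exp ((β * ℓ y : ℝ) : ℂ) * Sᶜ.indicator (fun _ => 1) y *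
        Complex.exp (-(v * (|ℓ y| : ℝ))) = c * Complex.exp (ζ * ℓ y) := by
  subst hS
  by_cases hy : ℓ y ≤ 0
  · rw [indicator_of_mem (by exact hy), indicator_of_notMem (by simpa using hy), abs_of_nonpos hy,
      mul_one, mul_zero, zero_mul, add_zero, mul_assoc, ← Complex.exp_add, ← hu]
    congr 2
    push_cast
    ring
  · rw [indicator_of_notMem (by simpa using hy), indicator_of_mem (by simpa using hy),
      abs_of_pos (not_le.1 hy), mul_one, mul_zero, zero_mul, zero_add, mul_assoc,
      ← Complex.exp_add, ← hv]
    congr 2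
    push_cast
    ring

/-- If `w₀ = f e^(-θℓ)` lies in `W₀` and `w₁ = f e^((1-θ)ℓ)` lies in `W₁`, then the function
`F(z) = f e^((z-θ)ℓ)` is in the class `𝓕(W₀, W₁)`: on `{ℓ ≤ 0}` it is the semigroup of
multiplications by `e^(-z|ℓ|)` acting on `w₀`, on `{ℓ > 0}` the semigroup acting on `w₁` at the
time `1 - z`. The tail conditions make it continuous on the boundary lines. -/
theorem mem_interpSub_of_factorization (hW₀ : IsSolidSubspace W₀) (hW₁ : IsSolidSubspace W₁)
    (hθ : θ ∈ Ioo (0 : ℝ) 1) {ℓ : EuclideanSpace ℝ (Fin n) → ℝ} (hℓ : Measurable ℓ)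
    {f : MeasFun n} (w₀ : W₀) (w₁ : W₁)
    (h₀ : MorreySpace.incl n p₀ q₀ hq₀ w₀ =ᵐ[volume]
      fun y => f y * Complex.exp (((-θ * ℓ y : ℝ)) : ℂ))
    (h₁ : MorreySpace.incl n p₁ q₁ hq₁ w₁ =ᵐ[volume]
      fun y => f y * Complex.exp ((((1 - θ) * ℓ y : ℝ)) : ℂ))
    (ht₀ : HasSmallTails p₀ q₀ (fun y => |ℓ y|) (MorreySpace.incl n p₀ q₀ hq₀ w₀))
    (ht₁ : HasSmallTails p₁ q₁ (fun y => |ℓ y|) (MorreySpace.incl n p₁ q₁ hq₁ w₁)) :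
    f ∈ interpSub W₀ W₁ θ := by
  set lam : EuclideanSpace ℝ (Fin n) → ℝ := fun y => |ℓ y| with hlam
  have hlm : Measurable lam := hℓ.abs
  have hl : ∀ y, 0 ≤ lam y := fun y => abs_nonneg _
  set A : Set (EuclideanSpace ℝ (Fin n)) := {y | ℓ y ≤ 0} with hAdef
  have hA : MeasurableSet A := measurableSet_le hℓ measurable_const
  set a : ℂ → W₀ := hW₀.semigroup lam (hW₀.mask A w₀) with ha
  set a' : ℂ → W₀ := hW₀.semigroup lam (hW₀.mask Aᶜ w₀) with ha'
  set b : ℂ → W₁ := hW₁.semigroup lam (hW₁.mask Aᶜ w₁) with hb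
  set b' : ℂ → W₁ := hW₁.semigroup lam (hW₁.mask A w₁) with hb'
  have hac : ContinuousOn a {z | 0 ≤ z.re} :=
    hW₀.continuousOn_semigroup hlm hl _ (hW₀.hasSmallTails_mask hA ht₀)
  have hac' : ContinuousOn a' {z | 0 ≤ z.re} :=
    hW₀.continuousOn_semigroup hlm hl _ (hW₀.hasSmallTails_mask hA.compl ht₀)
  have hbc : ContinuousOn b {z | 0 ≤ z.re} :=
    hW₁.continuousOn_semigroup hlm hl _ (hW₁.hasSmallTails_mask hA.compl ht₁)
  have hbc' : ContinuousOn b' {z | 0 ≤ z.re} :=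
    hW₁.continuousOn_semigroup hlm hl _ (hW₁.hasSmallTails_mask hA ht₁)
  have hline : ∀ {X : Type} [TopologicalSpace X] {g : ℂ → X} (_ : ContinuousOn g {z | 0 ≤ z.re})
      (c : ℂ) (_ : c.re = 0), Continuous fun t : ℝ => g (t * c) := by
    intro X _ g hg c hc
    refine hg.comp_continuous (by fun_prop) fun t => ?_
    simp [hc]
  have hI : Complex.I.re = 0 := Complex.I_re
  have hI' : (-Complex.I).re = 0 := by simp
  have hre : ∀ (t : ℝ) {c : ℂ}, c.re = 0 → 0 ≤ ((t : ℂ) * c).re := fun t c hc => by simp [hc]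
  let ι₀ : W₀ →ₗ[ℂ] MeasFun n := MorreySpace.incl n p₀ q₀ hq₀ ∘ₗ W₀.subtype
  let ι₁ : W₁ →ₗ[ℂ] MeasFun n := MorreySpace.incl n p₁ q₁ hq₁ ∘ₗ W₁.subtype
  set T := CoupleSum.ofProd ι₀ ι₁ with hT
  set F : ℂ → CoupleSum ι₀ ι₁ := fun z => T (a z, b (1 - z)) with hF
  have hval : ∀ z ∈ verticalClosedStrip 0 1, (CoupleSum.toAmbient ι₀ ι₁ (F z) : MeasFun n)
      =ᵐ[volume]
      fun y => f y * Complex.exp ((z - θ) * ℓ y) := by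
    intro z hz
    have hz : 0 ≤ z.re ∧ z.re ≤ 1 := hz
    rw [hF, hT]
    simp only [CoupleSum.toAmbient_ofProd]
    filter_upwards [measFun_coe_add (MorreySpace.incl n p₀ q₀ hq₀ (a z))
      (MorreySpace.incl n p₁ q₁ hq₁ (b (1 - z))), hW₀.coe_semigroup_mask hlm hl hA w₀ hz.1,
      hW₁.coe_semigroup_mask hlm hl hA.compl w₁ (z := 1 - z) (by simpa using hz.2), h₀, h₁]
      with y e1 e2 e3 e4 e5
    refine e1.trans ?_
    rw [e2, e3, e4, e5]
    exact mul_exp_add_mul_exp hAdef y _ (by push_cast; ring) (by push_cast; ring)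
  have hle : ∀ z ∈ verticalClosedStrip 0 1, ‖F z‖ ≤ ‖hW₀.mask A w₀‖ + ‖hW₁.mask Aᶜ w₁‖ := by
    intro z hz
    have hz : 0 ≤ z.re ∧ z.re ≤ 1 := hz
    exact (CoupleSum.norm_ofProd_le ι₀ ι₁ _).trans (add_le_add
      (hW₀.norm_semigroup_le hlm hl _ hz.1)
      (hW₁.norm_semigroup_le hlm hl _ (z := 1 - z) (by simpa using hz.2)))
  refine ⟨F, ⟨⟨_, hle⟩, ?_, ?_, ?_, ?_⟩, ?_⟩
  · refine T.continuous.comp_continuousOn (ContinuousOn.prodMk ?_ ?_)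
    · exact hac.mono fun z hz => (show 0 ≤ z.re ∧ z.re ≤ 1 from hz).1
    · refine hbc.comp (by fun_prop) fun z hz => ?_
      simpa using (show 0 ≤ z.re ∧ z.re ≤ 1 from hz).2
  · refine DifferentiableOn.continuousLinearMap_comp T (DifferentiableOn.prodMk ?_ ?_)
    · exact (hW₀.differentiableOn_semigroup hlm hl _).mono
        fun z hz => (show 0 < z.re ∧ z.re < 1 from hz).1
    · refine (hW₁.differentiableOn_semigroup hlm hl _).comp (by fun_prop) fun z hz => ?_
      simpa using (show 0 < z.re ∧ z.re < 1 from hz).2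
  · refine ⟨fun t => a (t * Complex.I) + a' (t * -Complex.I),
      (hline hac _ hI).add (hline hac' _ hI'),
      ⟨‖hW₀.mask A w₀‖ + ‖hW₀.mask Aᶜ w₀‖, fun t => (norm_add_le _ _).trans (add_le_add
        (hW₀.norm_semigroup_le hlm hl _ (hre t hI)) (hW₀.norm_semigroup_le hlm hl _ (hre t hI')))⟩,
      fun t => AEEqFun.ext ?_⟩
    refine (hval _ (mem_closedStrip_left t)).trans ?_
    rw [map_add]
    filter_upwards [measFun_coe_add (MorreySpace.incl n p₀ q₀ hq₀ (a (t * Complex.I)))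
      (MorreySpace.incl n p₀ q₀ hq₀ (a' (t * -Complex.I))),
      hW₀.coe_semigroup_mask hlm hl hA w₀ (hre t hI),
      hW₀.coe_semigroup_mask hlm hl hA.compl w₀ (hre t hI'), h₀] with y e1 e2 e3 e4
    refine Eq.trans ?_ e1.symm
    rw [e2, e3, e4]
    exact (mul_exp_add_mul_exp hAdef y _ (by push_cast; ring) (by push_cast; ring)).symm
  · refine ⟨fun t => b' (t * Complex.I) + b (t * -Complex.I),
      (hline hbc' _ hI).add (hline hbc _ hI'),
      ⟨‖hW₁.mask A w₁‖ + ‖hW₁.mask Aᶜ w₁‖, fun t => (norm_add_le _ _).trans (add_le_add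
        (hW₁.norm_semigroup_le hlm hl _ (hre t hI)) (hW₁.norm_semigroup_le hlm hl _ (hre t hI')))⟩,
      fun t => AEEqFun.ext ?_⟩
    refine (hval _ (mem_closedStrip_right t)).trans ?_
    rw [map_add]
    filter_upwards [measFun_coe_add (MorreySpace.incl n p₁ q₁ hq₁ (b' (t * Complex.I)))
      (MorreySpace.incl n p₁ q₁ hq₁ (b (t * -Complex.I))),
      hW₁.coe_semigroup_mask hlm hl hA w₁ (hre t hI),
      hW₁.coe_semigroup_mask hlm hl hA.compl w₁ (hre t hI'), h₁] with y e1 e2 e3 e4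
    refine Eq.trans ?_ e1.symm
    rw [e2, e3, e4]
    exact (mul_exp_add_mul_exp hAdef y _ (by push_cast; ring) (by push_cast; ring)).symm
  · refine AEEqFun.ext ((hval θ ?_).trans (ae_of_all _ fun y => by simp))
    exact ⟨by simpa using hθ.1.le, by simpa using hθ.2.le⟩

end Factorization

/-! ### Powers of a function with convergent truncations -/

section Powers

variable {n : ℕ} {p q p₀ q₀ p₁ q₁ θ : ℝ} {hq : 1 ≤ q} {hq₀ : 1 ≤ q₀} {hq₁ : 1 ≤ q₁}

theorem mem_morreySet_of_rpow_le (hp : 0 < p) (hq : 0 < q) (hp₀ : 0 < p₀) (hq₀ : 0 < q₀)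
    (hratio : p / q = p₀ / q₀) {f g : MeasFun n} (h : ∀ᵐ y, ‖g y‖ₑ ^ q₀ ≤ ‖f y‖ₑ ^ q)
    (hf : f ∈ morreySet n p q) : g ∈ morreySet n p₀ q₀ :=
  (morreyNorm_le_rpow hp hq hp₀ hq₀ hratio h).trans_lt
    (ENNReal.rpow_lt_top_of_nonneg (by positivity) hf.ne)

theorem tendsto_morreyM_of_rpow_le (hp : 0 < p) (hq : 0 < q) (hp₀ : 0 < p₀) (hq₀ : 0 < q₀)
    (hratio : p / q = p₀ / q₀) {f g : MeasFun n} (h : ∀ᵐ y, ‖g y‖ₑ ^ q₀ ≤ ‖f y‖ₑ ^ q)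
    {l : Filter ℝ} (hf : Tendsto (fun r => morreyM n p q f r) l (𝓝 0)) :
    Tendsto (fun r => morreyM n p₀ q₀ g r) l (𝓝 0) := by
  have h1 : Tendsto (fun r => morreyM n p q f r ^ (q / q₀)) l (𝓝 0) := by
    have := (ENNReal.continuous_rpow_const (y := q / q₀)).tendsto 0 |>.comp hf
    rwa [ENNReal.zero_rpow_of_pos (by positivity)] at this
  exact tendsto_of_tendsto_of_tendsto_of_le_of_le tendsto_const_nhds h1 (fun _ => zero_le)
    fun r => morreyM_le_rpow hp hq hp₀ hq₀ hratio h

theorem mem_vanishingZeroSet_of_rpow_le (hp : 0 < p) (hq : 0 < q) (hp₀ : 0 < p₀) (hq₀ : 0 < q₀)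
    (hratio : p / q = p₀ / q₀) {f g : MeasFun n} (h : ∀ᵐ y, ‖g y‖ₑ ^ q₀ ≤ ‖f y‖ₑ ^ q)
    (hf : f ∈ vanishingZeroSet n p q) : g ∈ vanishingZeroSet n p₀ q₀ :=
  ⟨mem_morreySet_of_rpow_le hp hq hp₀ hq₀ hratio h hf.1,
    tendsto_morreyM_of_rpow_le hp hq hp₀ hq₀ hratio h hf.2⟩

theorem mem_vanishingInftySet_of_rpow_le (hp : 0 < p) (hq : 0 < q) (hp₀ : 0 < p₀) (hq₀ : 0 < q₀)
    (hratio : p / q = p₀ / q₀) {f g : MeasFun n} (h : ∀ᵐ y, ‖g y‖ₑ ^ q₀ ≤ ‖f y‖ₑ ^ q)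
    (hf : f ∈ vanishingInftySet n p q) : g ∈ vanishingInftySet n p₀ q₀ :=
  ⟨mem_morreySet_of_rpow_le hp hq hp₀ hq₀ hratio h hf.1,
    tendsto_morreyM_of_rpow_le hp hq hp₀ hq₀ hratio h hf.2⟩

theorem mem_vanishingStarSet_of_rpow_le (hp : 0 < p) (hq : 0 < q) (hp₀ : 0 < p₀) (hq₀ : 0 < q₀)
    (hratio : p / q = p₀ / q₀) {f g : MeasFun n} (h : ∀ᵐ y, ‖g y‖ₑ ^ q₀ ≤ ‖f y‖ₑ ^ q)
    (hf : f ∈ vanishingStarSet n p q) : g ∈ vanishingStarSet n p₀ q₀ := by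
  refine ⟨mem_morreySet_of_rpow_le hp hq hp₀ hq₀ hratio h hf.1,
    tendsto_of_tendsto_of_tendsto_of_le_of_le tendsto_const_nhds hf.2 (fun _ => zero_le)
      fun N => iSup_mono fun x => lintegral_mono_ae (ae_restrict_of_ae ?_)⟩
  filter_upwards [h] with y hy
  exact indicator_le_indicator hy

theorem isSolidSubspace_vanishingZero (hp : 0 < p) (hq : 1 ≤ q) :
    IsSolidSubspace (VanishingZero n p q hq) := fun f hf g hle =>
  mem_vanishingZeroSet_of_rpow_le hp (by linarith) hp (by linarith) rfl
    (hle.mono fun _ hy => ENNReal.rpow_le_rpow hy (by linarith)) hf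

theorem isSolidSubspace_vanishingInfty (hp : 0 < p) (hq : 1 ≤ q) :
    IsSolidSubspace (VanishingInfty n p q hq) := fun f hf g hle =>
  mem_vanishingInftySet_of_rpow_le hp (by linarith) hp (by linarith) rfl
    (hle.mono fun _ hy => ENNReal.rpow_le_rpow hy (by linarith)) hf

theorem isSolidSubspace_vanishingStar (hp : 0 < p) (hq : 1 ≤ q) :
    IsSolidSubspace (VanishingStar n p q hq) := fun f hf g hle =>
  mem_vanishingStarSet_of_rpow_le hp (by linarith) hp (by linarith) rfl
    (hle.mono fun _ hy => ENNReal.rpow_le_rpow hy (by linarith)) hf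

theorem morreyM_le_of_enorm_le (hq : 0 < q) {f : EuclideanSpace ℝ (Fin n) → ℂ}
    {C : ℝ≥0∞} (h : ∀ y, ‖f y‖ₑ ≤ C) {r : ℝ} (hr : 0 < r) :
    morreyM n p q f r ≤
      volume (Metric.ball (0 : EuclideanSpace ℝ (Fin n)) r) ^ (1 / p) * C := by
  refine iSup_le fun x => ?_
  rw [Measure.addHaar_ball_center]
  set B := Metric.ball (0 : EuclideanSpace ℝ (Fin n)) r with hB
  gcongr
  calc ((volume B)⁻¹ * ∫⁻ y in Metric.ball x r, ‖f y‖ₑ ^ q) ^ (1 / q)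
      ≤ ((volume B)⁻¹ * ∫⁻ _ in Metric.ball x r, C ^ q) ^ (1 / q) := by
        gcongr with y
        exact h y
    _ = C := by
        rw [setLIntegral_const, Measure.addHaar_ball_center volume x, mul_comm (C ^ q), ← mul_assoc,
          ENNReal.inv_mul_cancel (volume_ball_ne_zero 0 hr) (volume_ball_ne_top 0 r), one_mul,
          ← ENNReal.rpow_mul, mul_one_div_cancel hq.ne', ENNReal.rpow_one]

theorem tendsto_volume_ball_zero (hn : 1 ≤ n) :
    Tendsto (fun r => volume (Metric.ball (0 : EuclideanSpace ℝ (Fin n)) r)) (𝓝[>] 0) (𝓝 0) := by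
  have h1 : Tendsto (fun r : ℝ => ENNReal.ofReal (r ^ n) *
      volume (Metric.ball (0 : EuclideanSpace ℝ (Fin n)) 1)) (𝓝[>] 0) (𝓝 0) := by
    have h2 : Tendsto (fun r : ℝ => ENNReal.ofReal (r ^ n)) (𝓝 0) (𝓝 0) := by
      have : Continuous fun r : ℝ => ENNReal.ofReal (r ^ n) :=
        ENNReal.continuous_ofReal.comp (continuous_pow n)
      simpa [zero_pow (by omega : n ≠ 0)] using this.tendsto 0
    simpa using ENNReal.Tendsto.mul_const (h2.mono_left nhdsWithin_le_nhds)
      (Or.inr (volume_ball_ne_top (0 : EuclideanSpace ℝ (Fin n)) 1))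
  have : Nonempty (Fin n) := ⟨⟨0, by omega⟩⟩
  refine h1.congr' ?_
  filter_upwards [self_mem_nhdsWithin] with r hr
  rw [Measure.addHaar_ball _ _ (le_of_lt hr), finrank_euclideanSpace_fin]

/-- On small balls the truncated functions, being bounded, have small Morrey means. -/
theorem mem_vanishingZeroSet_of_truncationsConverge (hn : 1 ≤ n) (hp : 0 < p) (hq : 1 ≤ q)
    {f : MeasFun n} (hf : f ∈ morreySet n p q) (ht : TruncationsConverge n p q f) :
    f ∈ vanishingZeroSet n p q := by
  refine ⟨hf, ENNReal.tendsto_nhds_zero.2 fun ε hε => ?_⟩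
  have hε2 : 0 < ε / 2 := ENNReal.half_pos hε.ne'
  obtain ⟨N, hN⟩ := (ENNReal.tendsto_nhds_zero.1 ht (ε / 2) hε2).exists
  set A := {y | 1 / (N : ℝ) ≤ ‖f y‖ ∧ ‖f y‖ ≤ (N : ℝ)} with hA
  have hfm : Measurable f := f.measurable
  have hAm : MeasurableSet A :=
    (measurableSet_le measurable_const hfm.norm).inter (measurableSet_le hfm.norm measurable_const)
  have hbd : ∀ y, ‖A.indicator f y‖ₑ ≤ ENNReal.ofReal N := fun y => by
    by_cases hy : y ∈ A
    · rw [indicator_of_mem hy, ← ofReal_norm]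
      exact ENNReal.ofReal_le_ofReal hy.2
    · simp [indicator_of_notMem hy]
  have hlim : Tendsto (fun r => volume (Metric.ball (0 : EuclideanSpace ℝ (Fin n)) r) ^ (1 / p) *
      ENNReal.ofReal N) (𝓝[>] 0) (𝓝 0) := by
    have h1 := ((ENNReal.continuous_rpow_const (y := 1 / p)).tendsto 0).comp
      (tendsto_volume_ball_zero hn)
    rw [ENNReal.zero_rpow_of_pos (by positivity)] at h1
    have h2 := ENNReal.Tendsto.mul_const h1 (Or.inr (ENNReal.ofReal_ne_top (r := (N : ℝ))))
    rwa [zero_mul] at h2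
  filter_upwards [ENNReal.tendsto_nhds_zero.1 hlim (ε / 2) hε2, self_mem_nhdsWithin] with r hr hr0
  have e : (f : EuclideanSpace ℝ (Fin n) → ℂ) =
      fun y => truncRemainder n f N y + A.indicator f y := by
    funext y
    simp [truncRemainder, hA]
  calc morreyM n p q f r
      ≤ morreyM n p q (truncRemainder n f N) r + morreyM n p q (A.indicator f) r := by
        conv_lhs => rw [e]
        refine morreyM_add_le hq ?_ (hfm.indicator hAm).aestronglyMeasurable r
        rw [truncRemainder_eq]
        exact (hfm.indicator hAm.compl).aestronglyMeasurable
    _ ≤ ε / 2 + ε / 2 := add_le_add ((morreyM_le_morreyNorm _ hr0).trans hN)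
        ((morreyM_le_of_enorm_le (by linarith) hbd hr0).trans hr)
    _ = ε := ENNReal.add_halves ε

theorem enorm_mul_exp_log_rpow (hq : 0 < q) (hq₀ : 0 < q₀) {c : ℝ} (hc : 1 + c = q / q₀) (z : ℂ) :
    ‖z * Complex.exp ((c * Real.log ‖z‖ : ℝ) : ℂ)‖ₑ ^ q₀ = ‖z‖ₑ ^ q := by
  rcases eq_or_ne z 0 with rfl | hz
  · simp [hq, hq₀, ENNReal.zero_rpow_of_pos]
  · have hz0 : 0 < ‖z‖ := norm_pos_iff.2 hz
    have e : ‖z * Complex.exp ((c * Real.log ‖z‖ : ℝ) : ℂ)‖ = ‖z‖ ^ (q / q₀) := by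
      rw [norm_mul, Complex.norm_exp, Complex.ofReal_re, mul_comm c, ← Real.rpow_def_of_pos hz0,
        ← hc, Real.rpow_add hz0, Real.rpow_one]
    rw [← ofReal_norm, ← ofReal_norm, e, ENNReal.ofReal_rpow_of_nonneg (by positivity) hq₀.le,
      ENNReal.ofReal_rpow_of_nonneg (by positivity) hq.le, ← Real.rpow_mul hz0.le,
      div_mul_cancel₀ _ hq₀.ne']

/-- The functions `f e^(c log |f|)` with `1 + c = q/q₀` have the absolute value `|f|^(q/q₀)`. -/
theorem exists_morreySpace_mul_exp_log (hp : 0 < p) (hq : 0 < q) (hp₀ : 0 < p₀) (hq₀ : 1 ≤ q₀)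
    (hratio : p / q = p₀ / q₀) {c : ℝ} (hc : 1 + c = q / q₀) {f : MeasFun n}
    (hf : f ∈ morreySet n p q) :
    ∃ g : MorreySpace n p₀ q₀ hq₀,
      MorreySpace.incl n p₀ q₀ hq₀ g =ᵐ[volume]
        (fun y => f y * Complex.exp ((c * Real.log ‖f y‖ : ℝ) : ℂ)) ∧
      ∀ᵐ y, ‖MorreySpace.incl n p₀ q₀ hq₀ g y‖ₑ ^ q₀ = ‖f y‖ₑ ^ q := by
  have hfm : Measurable f := f.measurable
  have hm : AEStronglyMeasurable
      (fun y => f y * Complex.exp ((c * Real.log ‖f y‖ : ℝ) : ℂ)) volume :=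
    Measurable.aestronglyMeasurable (by fun_prop)
  have h : ∀ᵐ y, ‖(AEEqFun.mk _ hm : MeasFun n) y‖ₑ ^ q₀ = ‖f y‖ₑ ^ q := by
    filter_upwards [AEEqFun.coeFn_mk _ hm] with y hy
    rw [hy, enorm_mul_exp_log_rpow hq (by linarith) hc]
  have hmem := mem_morreySet_of_rpow_le hp hq hp₀ (by linarith) hratio (h.mono fun _ hy => hy.le) hf
  exact ⟨MorreySpace.ofMem hq₀ _ hmem, AEEqFun.coeFn_mk _ hm, h⟩

/-- Where `|log |f||` is large, `f` agrees with the remainder of its truncation; at the zeros of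
`f` this uses the value `log 0 = 0`. -/
theorem hasSmallTails_of_truncationsConverge (hp : 0 < p) (hq : 0 < q) (hp₀ : 0 < p₀)
    (hq₀ : 0 < q₀) (hratio : p / q = p₀ / q₀) {f g : MeasFun n}
    (h : ∀ᵐ y, ‖g y‖ₑ ^ q₀ = ‖f y‖ₑ ^ q) (ht : TruncationsConverge n p q f) (β : ℝ) :
    HasSmallTails p₀ q₀ (fun y => |β * Real.log ‖f y‖|) g := by
  intro ε hε
  have h1 : Tendsto (fun N => morreyNorm n p q (truncRemainder n f N) ^ (q / q₀)) atTop (𝓝 0) := by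
    have := (ENNReal.continuous_rpow_const (y := q / q₀)).tendsto 0 |>.comp ht
    rwa [ENNReal.zero_rpow_of_pos (by positivity)] at this
  obtain ⟨N, hN, hN1⟩ := ((ENNReal.tendsto_nhds_zero.1 h1 (ENNReal.ofReal ε)
    (ENNReal.ofReal_pos.2 hε)).and (eventually_ge_atTop 1)).exists
  have hN1' : (1 : ℝ) ≤ N := by exact_mod_cast hN1
  have hN0 : (0 : ℝ) < N := by linarith
  refine ⟨|β| * Real.log N, le_trans ?_ hN⟩
  refine morreyNorm_le_rpow hp hq hp₀ hq₀ hratio ?_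
  filter_upwards [h] with y hy
  by_cases hyK : y ∈ {y | |β| * Real.log N < |β * Real.log ‖f y‖|}
  · rw [indicator_of_mem hyK, hy, truncRemainder_eq, indicator_of_mem]
    rintro ⟨h2, h3⟩
    refine not_lt.2 ?_ hyK.out
    have hf0 : 0 < ‖f y‖ := lt_of_lt_of_le (by positivity) h2
    rw [abs_mul]
    gcongr
    rw [abs_le, ← Real.log_inv, ← one_div]
    exact ⟨Real.log_le_log (by positivity) h2, Real.log_le_log hf0 h3⟩
  · rw [indicator_of_notMem hyK]
    simp [ENNReal.zero_rpow_of_pos hq₀]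

/-- The factorization is taken with `ℓ = (q/q₁ - q/q₀) log |f|`, for which `|f e^(-θℓ)|` is
`|f|^(q/q₀)` and `|f e^((1-θ)ℓ)|` is `|f|^(q/q₁)`. -/
theorem mem_interpSub_of_truncationsConverge (hθ : θ ∈ Ioo (0 : ℝ) 1) (hp : 0 < p) (hq : 0 < q)
    (hp₀ : 0 < p₀) (hp₁ : 0 < p₁) (hr₀ : p / q = p₀ / q₀) (hr₁ : p / q = p₁ / q₁)
    (hqθ : 1 / q = (1 - θ) / q₀ + θ / q₁)
    {W₀ : Submodule ℂ (MorreySpace n p₀ q₀ hq₀)} {W₁ : Submodule ℂ (MorreySpace n p₁ q₁ hq₁)}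
    (hW₀ : IsSolidSubspace W₀) (hW₁ : IsSolidSubspace W₁) {f : MeasFun n}
    (hf : f ∈ morreySet n p q) (ht : TruncationsConverge n p q f)
    (h₀ : ∀ g, (∀ᵐ y, ‖MorreySpace.incl n p₀ q₀ hq₀ g y‖ₑ ^ q₀ ≤ ‖f y‖ₑ ^ q) → g ∈ W₀)
    (h₁ : ∀ g, (∀ᵐ y, ‖MorreySpace.incl n p₁ q₁ hq₁ g y‖ₑ ^ q₁ ≤ ‖f y‖ₑ ^ q) → g ∈ W₁) :
    f ∈ interpSub W₀ W₁ θ := by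
  have hq₀0 : 0 < q₀ := by linarith
  have hq₁0 : 0 < q₁ := by linarith
  set β := q / q₁ - q / q₀ with hβ
  have hone : (1 - θ) * (q / q₀) + θ * (q / q₁) = 1 := by
    have : q * (1 / q) = q * ((1 - θ) / q₀ + θ / q₁) := by rw [hqθ]
    rw [mul_one_div_cancel hq.ne'] at this
    linear_combination -this
  obtain ⟨w₀, hw₀, hn₀⟩ := exists_morreySpace_mul_exp_log (c := -θ * β) hp hq hp₀ hq₀ hr₀
    (by rw [hβ]; linarith) hf
  obtain ⟨w₁, hw₁, hn₁⟩ := exists_morreySpace_mul_exp_log (c := (1 - θ) * β) hp hq hp₁ hq₁ hr₁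
    (by rw [hβ]; linarith) hf
  have hfm : Measurable f := f.measurable
  refine mem_interpSub_of_factorization hW₀ hW₁ hθ (ℓ := fun y => β * Real.log ‖f y‖) (by fun_prop)
    ⟨w₀, h₀ w₀ (hn₀.mono fun _ hy => hy.le)⟩ ⟨w₁, h₁ w₁ (hn₁.mono fun _ hy => hy.le)⟩ ?_ ?_
    (hasSmallTails_of_truncationsConverge hp hq hp₀ hq₀0 hr₀ hn₀ ht β)
    (hasSmallTails_of_truncationsConverge hp hq hp₁ hq₁0 hr₁ hn₁ ht β)
  · simpa only [mul_assoc] using hw₀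
  · simpa only [mul_assoc] using hw₁

end Powers

/-! ### The interpolation spaces -/

section Exponents

variable {θ p₀ q₀ p₁ q₁ p q : ℝ}

theorem pos_of_one_div_eq (hθ : θ ∈ Ioo (0 : ℝ) 1) (hq₀ : 0 < q₀) (hq₁ : 0 < q₁)
    (hq : 1 / q = (1 - θ) / q₀ + θ / q₁) : 0 < q := by
  have h1 : 0 < 1 - θ := sub_pos.2 hθ.2
  have h2 := hθ.1
  have : 0 < 1 / q := by rw [hq]; positivity
  exact one_div_pos.1 this

theorem one_le_of_one_div_eq (hθ : θ ∈ Ioo (0 : ℝ) 1) (hq₀ : 1 ≤ q₀) (hq₁ : 1 ≤ q₁)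
    (hq : 1 / q = (1 - θ) / q₀ + θ / q₁) : 1 ≤ q := by
  have h1 : 0 < 1 - θ := sub_pos.2 hθ.2
  have h0 := pos_of_one_div_eq hθ (by linarith) (by linarith) hq
  have : 1 / q ≤ 1 := by
    rw [hq]
    linarith [div_le_self h1.le hq₀, div_le_self hθ.1.le hq₁]
  rwa [div_le_one h0] at this

theorem between_of_one_div_eq (hθ : θ ∈ Ioo (0 : ℝ) 1) (hq₀ : 0 < q₀) (hlt : q₀ < q₁)
    (hq : 1 / q = (1 - θ) / q₀ + θ / q₁) : q₀ < q ∧ q < q₁ := by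
  have hq₁ : 0 < q₁ := hq₀.trans hlt
  have h0 := pos_of_one_div_eq hθ hq₀ hq₁ hq
  have h1 : 0 < 1 - θ := sub_pos.2 hθ.2
  have h2 : 0 < 1 / q₀ - 1 / q₁ := sub_pos.2 (one_div_lt_one_div_of_lt hq₀ hlt)
  have e1 : 1 / q - 1 / q₁ = (1 - θ) * (1 / q₀ - 1 / q₁) := by rw [hq]; ring
  have e2 : 1 / q₀ - 1 / q = θ * (1 / q₀ - 1 / q₁) := by rw [hq]; ring
  exact ⟨lt_of_one_div_lt_one_div h0 (by nlinarith [mul_pos hθ.1 h2]),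
    lt_of_one_div_lt_one_div hq₁ (by nlinarith [mul_pos h1 h2])⟩

theorem ratio_of_one_div_eq (hq₀ : 0 < q₀) (hq₁ : 0 < q₁) (hratio : p₀ / q₀ = p₁ / q₁)
    (hp0 : 0 < p) (hq0 : 0 < q)
    (hp : 1 / p = (1 - θ) / p₀ + θ / p₁) (hq : 1 / q = (1 - θ) / q₀ + θ / q₁) :
    p / q = p₀ / q₀ := by
  set κ := p₀ / q₀ with hκ
  have e0 : p₀ = κ * q₀ := by rw [hκ]; field_simp
  have e1 : p₁ = κ * q₁ := by rw [hratio]; field_simp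
  have e : 1 / p = 1 / q / κ := by
    rw [hp, hq, e0, e1, ← div_div, ← div_div, div_right_comm, div_right_comm θ]
    ring
  have hκ0 : κ ≠ 0 := by
    intro h
    rw [h, div_zero] at e
    exact (one_div_pos.2 hp0).ne' e
  field_simp at e ⊢
  linarith

end Exponents

section Main

variable {n : ℕ} {θ p₀ q₀ p₁ q₁ p q : ℝ} {hq₀ : 1 ≤ q₀} {hq₁ : 1 ≤ q₁}

theorem truncationsConverge_of_mem_interpMorrey (hθ : θ ∈ Ioo (0 : ℝ) 1) (hp₀ : 0 < p₀)
    (hp₁ : 0 < p₁) (hp0 : 0 < p) (hq1 : 1 ≤ q) (hr₀ : p / q = p₀ / q₀) (hr₁ : p / q = p₁ / q₁)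
    (hlt : q₀ < q ∧ q < q₁ ∨ q₁ < q ∧ q < q₀)
    (hp : 1 / p = (1 - θ) / p₀ + θ / p₁) (hq : 1 / q = (1 - θ) / q₀ + θ / q₁) {f : MeasFun n}
    (hf : f ∈ interpMorrey n p₀ q₀ p₁ q₁ hq₀ hq₁ θ) :
    f ∈ morreySet n p q ∧ TruncationsConverge n p q f := by
  obtain ⟨H, g₀, g₁, W, rfl⟩ := exists_weakCalderon_of_mem_interpMorrey hp₀ hp₁ hf
  exact ⟨W.mem_morreySet hθ hp₀ hp₁ hq1 hp hq,
    truncationsConverge_of_approx hp0 hq1 hp₀ hp₁ hq₀ hq₁ hr₀ hr₁ hlt fun ε hε =>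
      W.exists_mem_inter_morreyNorm_sub_le hp₀ hp₁ hθ hp0 hq1 hp hq hε⟩

end Main

theorem theorem1p2 (n : ℕ) (hn : 1 ≤ n) (θ p₀ q₀ p₁ q₁ p q : ℝ)
    (hθ : θ ∈ Ioo (0 : ℝ) 1)
    (hq₀ : 1 ≤ q₀) (hqp₀ : q₀ ≤ p₀) (hq₁ : 1 ≤ q₁) (hqp₁ : q₁ ≤ p₁)
    (hratio : p₀ / q₀ = p₁ / q₁) (hne : q₀ ≠ q₁)
    (hp : 1 / p = (1 - θ) / p₀ + θ / p₁) (hq : 1 / q = (1 - θ) / q₀ + θ / q₁) :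
    (interpSub (VanishingZero n p₀ q₀ hq₀) (VanishingZero n p₁ q₁ hq₁) θ
        = interpMorrey n p₀ q₀ p₁ q₁ hq₀ hq₁ θ ∧
      interpMorrey n p₀ q₀ p₁ q₁ hq₀ hq₁ θ
        = {f : MeasFun n | f ∈ morreySet n p q ∧ TruncationsConverge n p q f}) ∧
    (interpSub (VanishingInfty n p₀ q₀ hq₀) (VanishingInfty n p₁ q₁ hq₁) θ
        = vanishingInftySet n p q ∩ interpMorrey n p₀ q₀ p₁ q₁ hq₀ hq₁ θ ∧
      vanishingInftySet n p q ∩ interpMorrey n p₀ q₀ p₁ q₁ hq₀ hq₁ θ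
        = {f : MeasFun n | f ∈ vanishingInftySet n p q ∧ TruncationsConverge n p q f}) ∧
    (interpSub (VanishingStar n p₀ q₀ hq₀) (VanishingStar n p₁ q₁ hq₁) θ
        = vanishingStarSet n p q ∩ interpMorrey n p₀ q₀ p₁ q₁ hq₀ hq₁ θ ∧
      vanishingStarSet n p q ∩ interpMorrey n p₀ q₀ p₁ q₁ hq₀ hq₁ θ
        = {f : MeasFun n | f ∈ vanishingStarSet n p q ∧ TruncationsConverge n p q f}) := by
  have hp₀ : 0 < p₀ := by linarith
  have hp₁ : 0 < p₁ := by linarith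
  have hp0 : 0 < p := pos_of_one_div_eq hθ hp₀ hp₁ hp
  have hq1 : 1 ≤ q := one_le_of_one_div_eq hθ hq₀ hq₁ hq
  have hq0 : 0 < q := by linarith
  have hq₀0 : 0 < q₀ := by linarith
  have hq₁0 : 0 < q₁ := by linarith
  have hr₀ : p / q = p₀ / q₀ := ratio_of_one_div_eq hq₀0 hq₁0 hratio hp0 hq0 hp hq
  have hr₁ : p / q = p₁ / q₁ := hr₀.trans hratio
  have hlt : q₀ < q ∧ q < q₁ ∨ q₁ < q ∧ q < q₀ := by
    rcases hne.lt_or_gt with h | h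
    · exact Or.inl (between_of_one_div_eq hθ hq₀0 h hq)
    · refine Or.inr (between_of_one_div_eq (θ := 1 - θ) ⟨sub_pos.2 hθ.2, ?_⟩ hq₁0 h ?_)
      · linarith [hθ.1]
      · rw [hq, sub_sub_cancel, add_comm]
  have hM : ∀ f : MeasFun n, f ∈ interpMorrey n p₀ q₀ p₁ q₁ hq₀ hq₁ θ →
      f ∈ morreySet n p q ∧ TruncationsConverge n p q f := fun f =>
    truncationsConverge_of_mem_interpMorrey hθ hp₀ hp₁ hp0 hq1 hr₀ hr₁ hlt hp hq
  have hZ : ∀ f : MeasFun n, f ∈ morreySet n p q → TruncationsConverge n p q f →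
      f ∈ interpSub (VanishingZero n p₀ q₀ hq₀) (VanishingZero n p₁ q₁ hq₁) θ := by
    intro f hf ht
    have hfV := mem_vanishingZeroSet_of_truncationsConverge hn hp0 hq1 hf ht
    exact mem_interpSub_of_truncationsConverge hθ hp0 hq0 hp₀ hp₁ hr₀ hr₁ hq
      (isSolidSubspace_vanishingZero hp₀ hq₀) (isSolidSubspace_vanishingZero hp₁ hq₁) hf ht
      (fun g hg => mem_vanishingZeroSet_of_rpow_le hp0 hq0 hp₀ hq₀0 hr₀ hg hfV)
      (fun g hg => mem_vanishingZeroSet_of_rpow_le hp0 hq0 hp₁ hq₁0 hr₁ hg hfV)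
  have hI : ∀ f : MeasFun n, f ∈ vanishingInftySet n p q → TruncationsConverge n p q f →
      f ∈ interpSub (VanishingInfty n p₀ q₀ hq₀) (VanishingInfty n p₁ q₁ hq₁) θ := fun f hf ht =>
    mem_interpSub_of_truncationsConverge hθ hp0 hq0 hp₀ hp₁ hr₀ hr₁ hq
      (isSolidSubspace_vanishingInfty hp₀ hq₀) (isSolidSubspace_vanishingInfty hp₁ hq₁) hf.1 ht
      (fun g hg => mem_vanishingInftySet_of_rpow_le hp0 hq0 hp₀ hq₀0 hr₀ hg hf)
      (fun g hg => mem_vanishingInftySet_of_rpow_le hp0 hq0 hp₁ hq₁0 hr₁ hg hf)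
  have hS : ∀ f : MeasFun n, f ∈ vanishingStarSet n p q → TruncationsConverge n p q f →
      f ∈ interpSub (VanishingStar n p₀ q₀ hq₀) (VanishingStar n p₁ q₁ hq₁) θ := fun f hf ht =>
    mem_interpSub_of_truncationsConverge hθ hp0 hq0 hp₀ hp₁ hr₀ hr₁ hq
      (isSolidSubspace_vanishingStar hp₀ hq₀) (isSolidSubspace_vanishingStar hp₁ hq₁) hf.1 ht
      (fun g hg => mem_vanishingStarSet_of_rpow_le hp0 hq0 hp₀ hq₀0 hr₀ hg hf)
      (fun g hg => mem_vanishingStarSet_of_rpow_le hp0 hq0 hp₁ hq₁0 hr₁ hg hf)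
  have hVI : ∀ f : MeasFun n,
      f ∈ interpSub (VanishingInfty n p₀ q₀ hq₀) (VanishingInfty n p₁ q₁ hq₁) θ →
      f ∈ vanishingInftySet n p q := by
    intro f hf
    obtain ⟨H, g₀, g₁, W, rfl, h₀, h₁⟩ := exists_weakCalderon_of_mem_interpSub hp₀ hp₁ hf
    exact W.mem_vanishingInftySet hθ hp₀ hp₁ hq1 hp hq h₀ h₁
  have hVS : ∀ f : MeasFun n,
      f ∈ interpSub (VanishingStar n p₀ q₀ hq₀) (VanishingStar n p₁ q₁ hq₁) θ →
      f ∈ vanishingStarSet n p q := by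
    intro f hf
    obtain ⟨H, g₀, g₁, W, rfl, h₀, h₁⟩ := exists_weakCalderon_of_mem_interpSub hp₀ hp₁ hf
    exact W.mem_vanishingStarSet hθ hp₀ hp₁ hq1 hp hq h₀ h₁
  refine ⟨⟨?_, ?_⟩, ⟨?_, ?_⟩, ?_, ?_⟩
  · exact (interpSub_subset_interpMorrey _ _).antisymm fun f hf => hZ f (hM f hf).1 (hM f hf).2
  · exact Subset.antisymm hM fun f hf => interpSub_subset_interpMorrey _ _ (hZ f hf.1 hf.2)
  · exact Subset.antisymm (fun f hf => ⟨hVI f hf, interpSub_subset_interpMorrey _ _ hf⟩)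
      fun f hf => hI f hf.1 (hM f hf.2).2
  · exact Subset.antisymm (fun f hf => ⟨hf.1, (hM f hf.2).2⟩)
      fun f hf => ⟨hf.1, interpSub_subset_interpMorrey _ _ (hI f hf.1 hf.2)⟩
  · exact Subset.antisymm (fun f hf => ⟨hVS f hf, interpSub_subset_interpMorrey _ _ hf⟩)
      fun f hf => hS f hf.1 (hM f hf.2).2
  · exact Subset.antisymm (fun f hf => ⟨hf.1, (hM f hf.2).2⟩)
      fun f hf => ⟨hf.1, interpSub_subset_interpMorrey _ _ (hS f hf.1 hf.2)⟩
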